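/- Let $N\ge 1$, $m_1,\dots,m_N>0$, and let $q(t)=(q_i(t))_{1\le i\le N}\in\mathbb C^N$, $t\in\mathbb R$, be a planar periodic solution of the $N$-body problem $\ddot q_i=-\sum_{j\ne i} m_j\frac{q_i-q_j}{|q_i-q_j|^3}$ with $\inf\{|q_i(t)-q_j(t)|: t\in\mathbb R,\ i\neq j\}>0$. The restricted $(N+1)$-body problem is the equation $$\ddot z(t)=-\sum_{i=1}^N \frac{m_i\,(z(t)-q_i(t))}{|z(t)-q_i(t)|^3}, \qquad z(t)\in\mathbb C. \tag{R}$$ A path $\gamma$ is called collision-free at time $t$ if $\gamma(t)\ne q_i(t)$ for all $i$. For $h\in\mathbb R$, $a<b$ and $\gamma\in H^1([a,b],\mathbb C)$ (identified with its continuous representative), put $$\mathcal A_h(\gamma;a,b)=\int_a^b \Big(\tfrac12|\dot\gamma(t)|^2+\sum_{i=1}^N\frac{m_i}{|\gamma(t)-q_i(t)|}+h\Big)\,dt\in(-\infty,+\infty],$$ and let $H^1_{a,b}(x,y)$ be the set of $\gamma\in H^1([a,b],\mathbb C)$ with $\gamma(a)=x$, $\gamma(b)=y$. A path $\gamma\in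 H^1_{a,b}(x,y)$ is a fixed-end local minimizer of $\mathcal A_h$ if there is $\varepsilon>0$ such that $\mathcal A_h(\gamma;a,b)\le\mathcal A_h(\xi;a,b)$ for all $\xi\in H^1_{a,b}(x,y)$ with $\|\xi-\gamma\|_{H^1}\le\varepsilon$, where $\|\gamma\|_{H^1}^2=\int_a^b|\gamma|^2+|\dot\gamma|^2\,dt$. Fix $h\in\mathbb R$. (1) Let $t_1<t_2$ and $x,y\in\mathbb C$. If $\gamma\in H^1_{t_1,t_2}(x,y)$ is a fixed-end local minimizer of $\mathcal A_h$, then at every $t\in(t_1,t_2)$ the path $\gamma$ is collision-free, twice differentiable, and satisfies (R). (2) Let $t_0\in\mathbb R$, $\delta>0$, and let $\gamma\in H^1([t_0-\delta,t_0+\delta],\mathbb C)$ satisfy $\gamma(t_0)=q_{i_0}(t_0)$ for some $i_0$, be collision-free at every $t\neq t_0$ in $[t_0-\delta,t_0+\delta]$, and satisfy (R) at every $t\ne t_0$ in $(t_0-\delta,t_0+\delta)$. Then the limits $$\sigma_\pm=\lim_{t\to t_0^\pm}\frac{\gamma(t)-q_{i_0}(t)}{|\gamma(t)-q_{i_0}(t)|}$$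 exist. If $\sigma_-\neq\sigma_+$, then: (a) For every $\varepsilon>0$ there are two distinct paths $\eta^+,\eta^-\in H^1_{t_0-\delta,t_0+\delta}(\gamma(t_0-\delta),\gamma(t_0+\delta))$, each collision-free on $[t_0-\delta,t_0+\delta]$, with $\mathcal A_h(\eta^\pm;t_0-\delta,t_0+\delta)<\mathcal A_h(\gamma;t_0-\delta,t_0+\delta)$ and $|\eta^\pm(t)-\gamma(t)|\le\varepsilon$ for all $t\in[t_0-\delta,t_0+\delta]$. (b) There is $\delta_0\in(0,\delta]$ such that for every $\delta'\in(0,\delta_0]$ and every $\varepsilon>0$ there are paths $\eta^\pm$ with all the properties in (a) on the interval $[t_0-\delta',t_0+\delta']$ in place of $[t_0-\delta,t_0+\delta]$ which moreover satisfy $$\mathrm{Arg}\big(\eta^+-q_{i_0}\big)\Big|_{t_0-\delta'}^{t_0+\delta'}\in(0,2\pi),\qquad \mathrm{Arg}\big(\eta^--q_{i_0}\big)\Big|_{t_0-\delta'}^{t_0+\delta'}\in(-2\pi,0),$$ where the differences are those of a continuous determination of the argument along the path. -/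

import Mathlib

open Set Filter Topology MeasureTheory

namespace RestrictedNBody

noncomputable section

/-- The primaries `q i`, with masses `m i`, are twice differentiable on the whole real line and
move according to Newton's law of gravitation (the `N`-body problem, in the plane `ℂ`). -/
def SolvesNBody {N : ℕ} (m : Fin N → ℝ) (q : Fin N → ℝ → ℂ) : Prop :=
  ∀ i t, DifferentiableAt ℝ (q i) t ∧
    HasDerivAt (deriv (q i))
      (-∑ j ∈ Finset.univ.erase i, (m j / ‖q i t - q j t‖ ^ 3) • (q i t - q j t)) t

/-- A planar collision-free periodic solution of the `N`-body problem: `q` is periodic, and the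
mutual distances of the primaries are bounded below by a positive constant (this says that their
infimum `ρ₀` is positive, with the infimum of the empty family read as `+∞` when `N ≤ 1`). -/
structure IsCollisionFreePeriodic {N : ℕ} (m : Fin N → ℝ) (q : Fin N → ℝ → ℂ) : Prop where
  solves : SolvesNBody m q
  periodic : ∃ T : ℝ, 0 < T ∧ ∀ i t, q i (t + T) = q i t
  separated : ∃ ρ : ℝ, 0 < ρ ∧ ∀ t i j, i ≠ j → ρ ≤ ‖q i t - q j t‖

/-- The position `γ t` of the massless body at time `t` is collision-free. -/
def CollisionFreeAt {N : ℕ} (q : Fin N → ℝ → ℂ) (γ : ℝ → ℂ) (t : ℝ) : Prop :=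
  ∀ i, γ t ≠ q i t

/-- `γ` is twice differentiable at `t` and satisfies there the equation of motion of the massless
body in the restricted `(N+1)`-body problem. -/
def SolvesRestrictedAt {N : ℕ} (m : Fin N → ℝ) (q : Fin N → ℝ → ℂ) (γ : ℝ → ℂ) (t : ℝ) : Prop :=
  DifferentiableAt ℝ γ t ∧
    HasDerivAt (deriv γ) (-∑ i, (m i / ‖γ t - q i t‖ ^ 3) • (γ t - q i t)) t

/-- The potential `U(z, t) = ∑ i, m i / |z - q i t|`, with its true value `+∞` at collisions. -/
def potential {N : ℕ} (m : Fin N → ℝ) (q : Fin N → ℝ → ℂ) (z : ℂ) (t : ℝ) : ENNReal :=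
  ∑ i, ENNReal.ofReal (m i) / ENNReal.ofReal ‖z - q i t‖

/-- The Lagrangian action
`𝒜_h(γ; a, b) = ∫_a^b (1/2 |γ'|² + U(γ(t), t) + h) dt ∈ (-∞, +∞]`, for `a ≤ b`. The nonnegative
part is a Lebesgue integral with values in `[0, +∞]`; the constant `h` contributes
`h * (b - a)`. -/
def action {N : ℕ} (m : Fin N → ℝ) (q : Fin N → ℝ → ℂ) (h : ℝ) (γ : ℝ → ℂ) (a b : ℝ) : EReal :=
  ((∫⁻ t in Icc a b,
      (ENNReal.ofReal (‖deriv γ t‖ ^ 2 / 2) + potential m q (γ t) t) : ENNReal) : EReal) +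
    ((h * (b - a) : ℝ) : EReal)

/-- `γ ∈ H¹([a, b], ℂ)`, given by its continuous representative: `γ` is absolutely continuous on
`[a, b]` and its (almost everywhere defined) derivative is square integrable. Only the values of
`γ` on `[a, b]` matter. -/
def IsH1Path (γ : ℝ → ℂ) (a b : ℝ) : Prop :=
  AbsolutelyContinuousOnInterval γ a b ∧ MemLp (deriv γ) 2 (volume.restrict (Icc a b))

/-- The set `H¹_{a,b}(x, y)` of Sobolev paths on `[a, b]` from `x` to `y`. -/
def H1Paths (a b : ℝ) (x y : ℂ) : Set (ℝ → ℂ) :=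
  {γ | IsH1Path γ a b ∧ γ a = x ∧ γ b = y}

/-- The Sobolev norm `(∫_a^b |γ|² + |γ'|² dt)^{1/2}` of a path in `H¹([a, b], ℂ)`. -/
def h1Norm (γ : ℝ → ℂ) (a b : ℝ) : ℝ :=
  Real.sqrt (∫ t in Icc a b, (‖γ t‖ ^ 2 + ‖deriv γ t‖ ^ 2))

/-- `γ ∈ H¹_{a,b}(x, y)` is a fixed-end local minimizer of the action `𝒜_h`. -/
def IsFixedEndLocalMinimizer {N : ℕ} (m : Fin N → ℝ) (q : Fin N → ℝ → ℂ) (h : ℝ)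
    (a b : ℝ) (x y : ℂ) (γ : ℝ → ℂ) : Prop :=
  γ ∈ H1Paths a b x y ∧ ∃ ε : ℝ, 0 < ε ∧ ∀ ξ ∈ H1Paths a b x y,
    h1Norm (fun t => ξ t - γ t) a b ≤ ε → action m q h γ a b ≤ action m q h ξ a b

/-- `γ ∈ H¹([t₀ - δ, t₀ + δ], ℂ)` is a collision-ejection solution of the restricted problem: it
collides with the primary `i₀` at time `t₀`, and away from `t₀` it is a collision-free solution. -/
structure IsCollisionEjection {N : ℕ} (m : Fin N → ℝ) (q : Fin N → ℝ → ℂ) (i₀ : Fin N)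
    (t₀ δ : ℝ) (γ : ℝ → ℂ) : Prop where
  h1 : IsH1Path γ (t₀ - δ) (t₀ + δ)
  collision : γ t₀ = q i₀ t₀
  collisionFree : ∀ t ∈ Icc (t₀ - δ) (t₀ + δ), t ≠ t₀ → CollisionFreeAt q γ t
  solves : ∀ t ∈ Ioo (t₀ - δ) (t₀ + δ), t ≠ t₀ → SolvesRestrictedAt m q γ t

/-- The direction `(γ(t) - p(t)) / |γ(t) - p(t)|` in which `γ` is seen from `p`. -/
def direction (γ p : ℝ → ℂ) (t : ℝ) : ℂ :=
  (γ t - p t) / (‖γ t - p t‖ : ℂ)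

/-- `η` is a local deformation of `γ` on `[a, b]` of lower action: a collision-free Sobolev path
with the same ends as `γ`, uniformly `ε`-close to `γ`, and of strictly smaller action. -/
structure IsLoweringDeformation {N : ℕ} (m : Fin N → ℝ) (q : Fin N → ℝ → ℂ) (h : ℝ)
    (a b ε : ℝ) (γ η : ℝ → ℂ) : Prop where
  mem : η ∈ H1Paths a b (γ a) (γ b)
  collisionFree : ∀ t ∈ Icc a b, CollisionFreeAt q η t
  action_lt : action m q h η a b < action m q h γ a b
  close : ∀ t ∈ Icc a b, ‖η t - γ t‖ ≤ ε

/-- The variation `Arg(η(b) - p(b)) - Arg(η(a) - p(a))` of a continuous determination of the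
argument of `η - p` along `[a, b]` lies in the set `S`. (If `η - p` has no zero on `[a, b]`, a
continuous determination exists and its variation does not depend on the choice.) -/
def ArgVariationIn (η p : ℝ → ℂ) (a b : ℝ) (S : Set ℝ) : Prop :=
  ∃ θ : ℝ → ℝ, ContinuousOn θ (Icc a b) ∧
    (∀ t ∈ Icc a b, η t - p t = (‖η t - p t‖ : ℂ) * Complex.exp ((θ t : ℂ) * Complex.I)) ∧
    θ b - θ a ∈ S

end

end RestrictedNBody

namespace RestrictedNBody

noncomputable section

/-! ### Absolutely continuous and Sobolev paths -/

-- Part (1). A local minimizer has finite action, because every Sobolev path has arbitrarily small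
-- perturbations of finite action: add `r c` times a weight vanishing at the ends like the power 2/3
-- of the distance to them. Averaging over `c` in the unit disc makes the potential integrable,
-- since 1/|z| is integrable in the plane and the inverse weight is integrable in time
-- (`exists_perturbation_lagInt_ne_top`). By splicing, minimality passes to subintervals with the
-- same radius. Away from collisions the first variation, tested on the difference between the path
-- and a second primitive of its own force with the same ends, gives the equation of motion
-- (`solves_of_minimal`).
--
-- Suppose a minimizer meets the primary `i` at `t₀`, and let w be its relative position. On [t₀ -
-- s, t₀ + s] replace w by radial motion with the same |w| in the two end directions, plus a tent of
-- height δ in a direction making no obtuse angle with either. The radial motion does not increase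
-- the kinetic energy, the cross terms have nonpositive integral, and the tent costs δ²/s. The
-- Hölder bound |w|² ≤ |t - t₀| E, with E the squared L² norm of w', tends to zero with s, keeps w
-- so close to the primary that the gain in potential exceeds this cost and the effects of the
-- moving primaries (`exists_lifted_path`, `exists_lift_height`, `ne_of_minimal`).
--
-- Part (2). On each side of the collision w solves a Kepler problem with a bounded perturbation.
-- Its energy is bounded, |w| is monotone, and its angular momentum is at most B |w| t. Hence |w| is
-- asymptotic to c t^(2/3) with c³ = 9M/2, and the unit direction is Lipschitz near the collision,
-- so it has a limit (`IsEjection.tendsto_norm_div_rpow`, `IsEjection.exists_tendsto_direction`).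
--
-- The model at the collision is the homothetic parabolic collision-ejection path, of action 8c²/3
-- on [-1, 1]. If its two directions differ, a parabola with focus at the centre, run through with
-- constant areal velocity, joins the same end points in the same time with strictly smaller action
-- (`exists_parabolic_arc`). Lengths are scaled by μ² and times by μ³, which scales the action by μ.
-- Maupertuis' inequality shows that the solution costs at least almost μ times 8c²/3
-- (`IsCollisionEjection.le_lagInt`), while the scaled arc, corrected by an affine term to fit the
-- ends, costs almost μ times its own action (`lagInt_rescaled_le`). The other effects are O(μ³), so
-- the strict gap survives for small μ. Measured from a bisector ω of the two directions, the arc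
-- avoids the negative axis, which controls the variation of its argument. Using ω and -ω gives the
-- two sides of the primary, and the opposite signs of the variations make the two paths distinct.

lemma ac_of_dist_le {X Y : Type*} [PseudoMetricSpace X] [PseudoMetricSpace Y]
    {f : ℝ → X} {g : ℝ → Y} {a b C : ℝ} (hf : AbsolutelyContinuousOnInterval f a b)
    (h : ∀ x ∈ uIcc a b, ∀ y ∈ uIcc a b, dist (g x) (g y) ≤ C * dist (f x) (f y)) :
    AbsolutelyContinuousOnInterval g a b := by
  unfold AbsolutelyContinuousOnInterval at hf ⊢
  have h2 := hf.const_mul C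
  rw [mul_zero] at h2
  refine squeeze_zero' (Eventually.of_forall fun E => Finset.sum_nonneg fun _ _ => dist_nonneg)
    ?_ h2
  rw [eventually_inf_principal]
  refine Eventually.of_forall fun E hE => ?_
  rw [Finset.mul_sum]
  exact Finset.sum_le_sum fun i hi => h _ (hE.1 i hi).1 _ (hE.1 i hi).2

lemma ac_re {f : ℝ → ℂ} {a b : ℝ} (hf : AbsolutelyContinuousOnInterval f a b) :
    AbsolutelyContinuousOnInterval (fun t => (f t).re) a b :=
  ac_of_dist_le (C := 1) hf fun x _ y _ => by
    rw [one_mul, Real.dist_eq, dist_eq_norm, ← Complex.sub_re]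
    exact Complex.abs_re_le_norm _

lemma ac_im {f : ℝ → ℂ} {a b : ℝ} (hf : AbsolutelyContinuousOnInterval f a b) :
    AbsolutelyContinuousOnInterval (fun t => (f t).im) a b :=
  ac_of_dist_le (C := 1) hf fun x _ y _ => by
    rw [one_mul, Real.dist_eq, dist_eq_norm, ← Complex.sub_im]
    exact Complex.abs_im_le_norm _

lemma ac_norm {f : ℝ → ℂ} {a b : ℝ} (hf : AbsolutelyContinuousOnInterval f a b) :
    AbsolutelyContinuousOnInterval (fun t => ‖f t‖) a b :=
  ac_of_dist_le (C := 1) hf fun x _ y _ => by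
    rw [one_mul, Real.dist_eq, dist_eq_norm]
    exact abs_norm_sub_norm_le _ _

lemma ac_ofReal {f : ℝ → ℝ} {a b : ℝ} (hf : AbsolutelyContinuousOnInterval f a b) :
    AbsolutelyContinuousOnInterval (fun t => (f t : ℂ)) a b :=
  ac_of_dist_le (C := 1) hf fun x _ y _ => by
    rw [one_mul, Real.dist_eq, dist_eq_norm, ← Complex.ofReal_sub, Complex.norm_real,
      Real.norm_eq_abs]

lemma ac_congr {X : Type*} [PseudoMetricSpace X] {f g : ℝ → X} {a b : ℝ}
    (hf : AbsolutelyContinuousOnInterval f a b) (h : ∀ x ∈ uIcc a b, g x = f x) :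
    AbsolutelyContinuousOnInterval g a b :=
  ac_of_dist_le (C := 1) hf fun x hx y hy => by rw [h x hx, h y hy, one_mul]

lemma ac_of_re_im {f : ℝ → ℂ} {a b : ℝ}
    (h1 : AbsolutelyContinuousOnInterval (fun t => (f t).re) a b)
    (h2 : AbsolutelyContinuousOnInterval (fun t => (f t).im) a b) :
    AbsolutelyContinuousOnInterval f a b := by
  have := (ac_ofReal h1).add ((ac_ofReal h2).const_smul Complex.I)
  refine ac_congr this fun t _ => ?_
  simp [mul_comm Complex.I, Complex.re_add_im]

lemma ac_ae_hasDerivAt {f : ℝ → ℂ} {a b : ℝ} (hf : AbsolutelyContinuousOnInterval f a b) :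
    ∀ᵐ t, t ∈ uIcc a b → HasDerivAt f (deriv f t) t := by
  filter_upwards [hf.boundedVariationOn.ae_differentiableAt_of_mem_uIcc] with t ht h
  exact (ht h).hasDerivAt

lemma ac_ae_hasDerivAt_real {f : ℝ → ℝ} {a b : ℝ} (hf : AbsolutelyContinuousOnInterval f a b) :
    ∀ᵐ t, t ∈ uIcc a b → HasDerivAt f (deriv f t) t := by
  filter_upwards [hf.boundedVariationOn.ae_differentiableAt_of_mem_uIcc] with t ht h
  exact (ht h).hasDerivAt

lemma hasDerivAt_re {f : ℝ → ℂ} {f' : ℂ} {t : ℝ} (h : HasDerivAt f f' t) :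
    HasDerivAt (fun t => (f t).re) f'.re t :=
  Complex.reCLM.hasFDerivAt.comp_hasDerivAt t h

lemma hasDerivAt_im {f : ℝ → ℂ} {f' : ℂ} {t : ℝ} (h : HasDerivAt f f' t) :
    HasDerivAt (fun t => (f t).im) f'.im t :=
  Complex.imCLM.hasFDerivAt.comp_hasDerivAt t h

/-- Primitives of integrable functions are absolutely continuous. -/
lemma ac_primitive {v : ℝ → ℂ} {a b : ℝ} (hv : IntervalIntegrable v volume a b) :
    AbsolutelyContinuousOnInterval (fun t => ∫ x in a..t, v x) a b := by
  have key : ∀ t ∈ uIcc a b, IntervalIntegrable v volume a t := fun t ht =>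
    hv.mono_set (uIcc_subset_uIcc_left ht)
  have hre : IntervalIntegrable (fun t => (v t).re) volume a b :=
    ⟨hv.1.re, hv.2.re⟩
  have him : IntervalIntegrable (fun t => (v t).im) volume a b :=
    ⟨hv.1.im, hv.2.im⟩
  refine ac_of_re_im ?_ ?_
  · refine ac_congr (hre.absolutelyContinuousOnInterval_intervalIntegral left_mem_uIcc)
      fun t ht => ?_
    exact (Complex.reCLM.intervalIntegral_comp_comm (key t ht)).symm
  · refine ac_congr (him.absolutelyContinuousOnInterval_intervalIntegral left_mem_uIcc)
      fun t ht => ?_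
    exact (Complex.imCLM.intervalIntegral_comp_comm (key t ht)).symm

lemma intervalIntegrable_of_memLp {v : ℝ → ℂ} {a b : ℝ} (hab : a ≤ b)
    (hv : MemLp v 2 (volume.restrict (Icc a b))) : IntervalIntegrable v volume a b := by
  rw [intervalIntegrable_iff_integrableOn_Icc_of_le hab]
  exact hv.integrable (by norm_num)

/-- The converse of `IsH1Path.eq_add_integral`. Together they reduce membership in H¹ to an integral
formula, which only sees the values on the interval and so makes gluing and changes outside the
interval harmless. -/
lemma isH1Path_of_primitive {γ v : ℝ → ℂ} {a b : ℝ} (hab : a ≤ b)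
    (hv : MemLp v 2 (volume.restrict (Icc a b)))
    (h : ∀ t ∈ Icc a b, γ t = γ a + ∫ x in a..t, v x) :
    IsH1Path γ a b ∧ ∀ᵐ t, t ∈ Icc a b → HasDerivAt γ (v t) t := by
  have hi := intervalIntegrable_of_memLp hab hv
  have hd : ∀ᵐ t, t ∈ Icc a b → HasDerivAt γ (v t) t := by
    have h1 : ∀ᵐ x : ℝ, x ≠ a := by simp [ae_iff, measure_singleton]
    have h2 : ∀ᵐ x : ℝ, x ≠ b := by simp [ae_iff, measure_singleton]
    filter_upwards [hi.ae_hasDerivAt_integral, h1, h2] with t ht h1 h2 htab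
    rw [uIcc_of_le hab] at ht
    have := (ht htab a (left_mem_Icc.2 hab)).const_add (γ a)
    refine this.congr_of_eventuallyEq ?_
    filter_upwards [Icc_mem_nhds (lt_of_le_of_ne htab.1 h1.symm) (lt_of_le_of_ne htab.2 h2)]
      with x hx using h x hx
  refine ⟨⟨?_, ?_⟩, hd⟩
  · refine ac_of_dist_le (C := 1) (ac_primitive hi) fun x hx y hy => ?_
    rw [uIcc_of_le hab] at hx hy
    rw [h x hx, h y hy, dist_add_left, one_mul]
  · refine hv.ae_eq ?_
    rw [EventuallyEq, ae_restrict_iff' measurableSet_Icc]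
    filter_upwards [hd] with t ht hm using (ht hm).deriv.symm

namespace IsH1Path

variable {γ η : ℝ → ℂ} {a b c d : ℝ}

lemma mono (h : IsH1Path γ a b) (hac : a ≤ c) (hcd : c ≤ d) (hdb : d ≤ b) : IsH1Path γ c d := by
  have hs : Icc c d ⊆ Icc a b := Icc_subset_Icc hac hdb
  refine ⟨h.1.mono ?_, h.2.mono_measure (Measure.restrict_mono hs le_rfl)⟩
  rwa [uIcc_of_le hcd, uIcc_of_le (hac.trans (hcd.trans hdb))]

lemma ae_hasDerivAt (h : IsH1Path γ a b) : ∀ᵐ t, t ∈ Icc a b → HasDerivAt γ (deriv γ t) t := by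
  filter_upwards [ac_ae_hasDerivAt h.1] with t ht hm using ht (Icc_subset_uIcc hm)

lemma continuousOn (h : IsH1Path γ a b) : ContinuousOn γ (Icc a b) :=
  h.1.continuousOn.mono Icc_subset_uIcc

lemma intervalIntegrable (h : IsH1Path γ a b) (hab : a ≤ b) :
    IntervalIntegrable (deriv γ) volume a b := intervalIntegrable_of_memLp hab h.2

lemma integral_deriv (h : IsH1Path γ a b) (hab : a ≤ b) :
    ∫ t in a..b, deriv γ t = γ b - γ a := by
  have hi := h.intervalIntegrable hab
  have hd : ∀ᵐ t, t ∈ Set.uIoc a b → HasDerivAt γ (deriv γ t) t := by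
    filter_upwards [h.ae_hasDerivAt] with t ht hm
    exact ht (Ioc_subset_Icc_self (by rwa [uIoc_of_le hab] at hm))
  apply Complex.ext
  · have h1 := (ac_re h.1).integral_deriv_eq_sub
    rw [Complex.sub_re, ← h1]
    refine (Complex.reCLM.intervalIntegral_comp_comm hi).symm.trans ?_
    refine intervalIntegral.integral_congr_ae ?_
    filter_upwards [hd] with t ht hm using (hasDerivAt_re (ht hm)).deriv.symm
  · have h1 := (ac_im h.1).integral_deriv_eq_sub
    rw [Complex.sub_im, ← h1]
    refine (Complex.imCLM.intervalIntegral_comp_comm hi).symm.trans ?_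
    refine intervalIntegral.integral_congr_ae ?_
    filter_upwards [hd] with t ht hm using (hasDerivAt_im (ht hm)).deriv.symm

lemma eq_add_integral (h : IsH1Path γ a b) {t : ℝ} (ht : t ∈ Icc a b) :
    γ t = γ a + ∫ x in a..t, deriv γ x := by
  rw [(h.mono le_rfl ht.1 ht.2).integral_deriv ht.1]; ring

lemma integrable_sq (h : IsH1Path γ a b) :
    IntegrableOn (fun t => ‖deriv γ t‖ ^ 2) (Icc a b) :=
  (memLp_two_iff_integrable_sq_norm h.2.1).1 h.2

lemma add (h : IsH1Path γ a b) (h' : IsH1Path η a b) : IsH1Path (fun t => γ t + η t) a b := by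
  refine ⟨h.1.add h'.1, (h.2.add h'.2).ae_eq ?_⟩
  rw [EventuallyEq, ae_restrict_iff' measurableSet_Icc]
  filter_upwards [h.ae_hasDerivAt, h'.ae_hasDerivAt] with t h1 h2 ht
  exact ((h1 ht).add (h2 ht)).deriv.symm

lemma const_mul (c : ℂ) (h : IsH1Path γ a b) : IsH1Path (fun t => c * γ t) a b := by
  refine ⟨h.1.const_smul c, (h.2.const_mul c).ae_eq ?_⟩
  rw [EventuallyEq, ae_restrict_iff' measurableSet_Icc]
  filter_upwards [h.ae_hasDerivAt] with t h1 ht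
  exact ((h1 ht).const_mul c).deriv.symm

lemma sub (h : IsH1Path γ a b) (h' : IsH1Path η a b) : IsH1Path (fun t => γ t - η t) a b := by
  convert h.add (h'.const_mul (-1)) using 2
  ring

/-- A change outside [a, b] can affect `deriv` within [a, b] only at the two ends, a null set. The
integral formula avoids treating them separately. -/
lemma congr (h : IsH1Path γ a b) (hab : a ≤ b) (he : ∀ t ∈ Icc a b, η t = γ t) :
    IsH1Path η a b := by
  refine (isH1Path_of_primitive hab h.2 fun t ht => ?_).1
  rw [he t ht, he a (left_mem_Icc.2 hab), h.eq_add_integral ht]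

lemma glue (hab : a ≤ b) (hbc : b ≤ c) (h : IsH1Path γ a b) (h' : IsH1Path γ b c) :
    IsH1Path γ a c := by
  have hu : Icc a b ∪ Icc b c = Icc a c := Icc_union_Icc_eq_Icc hab hbc
  have hm : MemLp (deriv γ) 2 (volume.restrict (Icc a c)) := by
    refine (memLp_two_iff_integrable_sq_norm ?_).2 ?_
    · exact (stronglyMeasurable_deriv γ).aestronglyMeasurable
    · rw [← hu]
      exact IntegrableOn.union h.integrable_sq h'.integrable_sq
  refine (isH1Path_of_primitive (hab.trans hbc) hm fun t ht => ?_).1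
  rcases le_total t b with htb | htb
  · exact h.eq_add_integral ⟨ht.1, htb⟩
  · have e1 := h'.eq_add_integral ⟨htb, ht.2⟩
    have e2 := h.eq_add_integral (right_mem_Icc.2 hab)
    rw [← intervalIntegral.integral_add_adjacent_intervals (h.intervalIntegrable hab)
      ((h'.mono le_rfl htb ht.2).intervalIntegrable htb), e1, e2, add_assoc]

end IsH1Path

lemma isH1Path_of_lipschitzOn {γ : ℝ → ℂ} {a b : ℝ} {K : NNReal} (hab : a ≤ b)
    (h : LipschitzOnWith K γ (Icc a b)) : IsH1Path γ a b := by
  refine ⟨?_, ?_⟩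
  · apply LipschitzOnWith.absolutelyContinuousOnInterval (K := K)
    rwa [uIcc_of_le hab]
  · refine MemLp.mono_exponent (q := ⊤) ?_ le_top
    refine memLp_top_of_bound (stronglyMeasurable_deriv γ).aestronglyMeasurable K ?_
    rw [ae_restrict_iff' measurableSet_Icc]
    have h1 : ∀ᵐ x : ℝ, x ≠ a := by simp [ae_iff, measure_singleton]
    have h2 : ∀ᵐ x : ℝ, x ≠ b := by simp [ae_iff, measure_singleton]
    filter_upwards [h1, h2] with t h1 h2 ht
    exact norm_deriv_le_of_lipschitzOn
      (Icc_mem_nhds (lt_of_le_of_ne ht.1 h1.symm) (lt_of_le_of_ne ht.2 h2)) h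

lemma isH1Path_of_hasDerivAt {γ γ' : ℝ → ℂ} {a b : ℝ} (hab : a ≤ b)
    (h : ∀ t ∈ Icc a b, HasDerivAt γ (γ' t) t) (h' : ContinuousOn γ' (Icc a b)) :
    IsH1Path γ a b := by
  obtain ⟨C, hC⟩ := isCompact_Icc.exists_bound_of_continuousOn h'
  refine isH1Path_of_lipschitzOn (K := ⟨max C 0, le_max_right _ _⟩) hab ?_
  refine (convex_Icc a b).lipschitzOnWith_of_nnnorm_hasDerivWithin_le
    (fun t ht => (h t ht).hasDerivWithinAt) fun t ht => ?_
  exact (hC t ht).trans (le_max_left _ _)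

/-! ### The action and surgery on paths -/

/-- The integrand of the action, without the constant `h`. -/
def lagr {N : ℕ} (m : Fin N → ℝ) (q : Fin N → ℝ → ℂ) (γ : ℝ → ℂ) (t : ℝ) : ENNReal :=
  ENNReal.ofReal (‖deriv γ t‖ ^ 2 / 2) + potential m q (γ t) t

/-- The action for `h = 0`, as an extended nonnegative real number. -/
def lagInt {N : ℕ} (m : Fin N → ℝ) (q : Fin N → ℝ → ℂ) (γ : ℝ → ℂ) (a b : ℝ) : ENNReal :=
  ∫⁻ t in Icc a b, lagr m q γ t

variable {N : ℕ} {m : Fin N → ℝ} {q : Fin N → ℝ → ℂ}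

/-- The contribution of `h` is a finite constant depending only on the interval. All comparisons are
therefore made for `lagInt`, and `h` plays no further role. -/
lemma action_lt_action {h a b : ℝ} {γ η : ℝ → ℂ} (hlt : lagInt m q η a b < lagInt m q γ a b) :
    action m q h η a b < action m q h γ a b :=
  EReal.add_lt_add_right_coe (EReal.coe_ennreal_lt_coe_ennreal_iff.2 hlt) _

lemma lagInt_le_of_action_le {h a b : ℝ} {γ η : ℝ → ℂ}
    (hle : action m q h γ a b ≤ action m q h η a b) : lagInt m q γ a b ≤ lagInt m q η a b :=
  not_lt.1 fun hlt => not_lt.2 hle (action_lt_action hlt)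

/-- The path which is `η` on `[c, d]` and `γ` elsewhere. -/
def splice (γ η : ℝ → ℂ) (c d : ℝ) (t : ℝ) : ℂ := by
  classical exact if t ∈ Icc c d then η t else γ t

lemma splice_of_mem {γ η : ℝ → ℂ} {c d t : ℝ} (h : t ∈ Icc c d) : splice γ η c d t = η t :=
  if_pos h

lemma splice_of_notMem {γ η : ℝ → ℂ} {c d t : ℝ} (h : t ∉ Icc c d) : splice γ η c d t = γ t :=
  if_neg h

lemma deriv_splice_of_mem {γ η : ℝ → ℂ} {c d t : ℝ} (h : t ∈ Ioo c d) :
    deriv (splice γ η c d) t = deriv η t := by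
  refine EventuallyEq.deriv_eq ?_
  filter_upwards [Icc_mem_nhds h.1 h.2] with x hx using splice_of_mem hx

lemma deriv_splice_of_notMem {γ η : ℝ → ℂ} {c d t : ℝ} (h : t ∉ Icc c d) :
    deriv (splice γ η c d) t = deriv γ t := by
  refine EventuallyEq.deriv_eq ?_
  filter_upwards [isClosed_Icc.isOpen_compl.mem_nhds h] with x hx using splice_of_notMem hx

lemma ae_mem_Ioo (c d : ℝ) : ∀ᵐ t : ℝ, t ∈ Icc c d → t ∈ Ioo c d := by
  have h1 : ∀ᵐ x : ℝ, x ≠ c := by simp [ae_iff, measure_singleton]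
  have h2 : ∀ᵐ x : ℝ, x ≠ d := by simp [ae_iff, measure_singleton]
  filter_upwards [h1, h2] with t h1 h2 ht
  exact ⟨lt_of_le_of_ne ht.1 h1.symm, lt_of_le_of_ne ht.2 h2⟩

section splice

variable {γ η : ℝ → ℂ} {a b c d : ℝ}

lemma splice_eq_of_le (hc : η c = γ c) {t : ℝ} (ht : t ≤ c) (hcd : c ≤ d) :
    splice γ η c d t = γ t := by
  rcases ht.lt_or_eq with h | rfl
  · exact splice_of_notMem fun hm => absurd hm.1 (not_le.2 h)
  · rw [splice_of_mem (left_mem_Icc.2 hcd), hc]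

lemma splice_eq_of_ge (hd : η d = γ d) {t : ℝ} (ht : d ≤ t) (hcd : c ≤ d) :
    splice γ η c d t = γ t := by
  rcases ht.lt_or_eq with h | rfl
  · exact splice_of_notMem fun hm => absurd hm.2 (not_le.2 h)
  · rw [splice_of_mem (right_mem_Icc.2 hcd), hd]

lemma isH1Path_splice (hγ : IsH1Path γ a b) (hη : IsH1Path η c d) (hac : a ≤ c) (hcd : c ≤ d)
    (hdb : d ≤ b) (hc : η c = γ c) (hd : η d = γ d) : IsH1Path (splice γ η c d) a b := by
  refine IsH1Path.glue (b := d) (hac.trans hcd) hdb (IsH1Path.glue (b := c) hac hcd ?_ ?_) ?_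
  · exact (hγ.mono le_rfl hac (hcd.trans hdb)).congr hac fun t ht => splice_eq_of_le hc ht.2 hcd
  · exact hη.congr hcd fun t ht => splice_of_mem ht
  · exact (hγ.mono (hac.trans hcd) hdb le_rfl).congr hdb fun t ht => splice_eq_of_ge hd ht.1 hcd

lemma lagInt_eq_add (γ : ℝ → ℂ) (hac : a ≤ c) (hdb : d ≤ b) :
    lagInt m q γ a b = lagInt m q γ c d + ∫⁻ t in Icc a b \ Icc c d, lagr m q γ t := by
  unfold lagInt
  rw [← lintegral_inter_add_sdiff _ (Icc a b) (measurableSet_Icc (a := c) (b := d)),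
    inter_eq_right.2 (Icc_subset_Icc hac hdb)]

lemma lagInt_splice (hac : a ≤ c) (hdb : d ≤ b) :
    lagInt m q (splice γ η c d) a b =
      lagInt m q η c d + ∫⁻ t in Icc a b \ Icc c d, lagr m q γ t := by
  rw [lagInt_eq_add (c := c) (d := d) _ hac hdb]
  congr 1
  · refine lintegral_congr_ae ?_
    rw [EventuallyEq, ae_restrict_iff' measurableSet_Icc]
    filter_upwards [ae_mem_Ioo c d] with t ht hm
    rw [lagr, lagr, deriv_splice_of_mem (ht hm), splice_of_mem hm]
  · refine setLIntegral_congr_fun (measurableSet_Icc.diff measurableSet_Icc) fun t ht => ?_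
    rw [lagr, lagr, deriv_splice_of_notMem ht.2, splice_of_notMem ht.2]

/-- The difference vanishes off [c, d]. This is why one radius of minimality serves for all
subintervals. -/
lemma h1Norm_splice (hac : a ≤ c) (hdb : d ≤ b) :
    h1Norm (fun t => splice γ η c d t - γ t) a b = h1Norm (fun t => η t - γ t) c d := by
  unfold h1Norm
  congr 1
  have hsub : Icc c d ⊆ Icc a b := Icc_subset_Icc hac hdb
  rw [setIntegral_eq_of_subset_of_ae_sdiff_eq_zero measurableSet_Icc.nullMeasurableSet hsub]
  · refine setIntegral_congr_ae measurableSet_Icc ?_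
    filter_upwards [ae_mem_Ioo c d] with t ht hm
    rw [splice_of_mem hm]
    congr 3
    refine EventuallyEq.deriv_eq ?_
    filter_upwards [Icc_mem_nhds (ht hm).1 (ht hm).2] with x hx
    rw [splice_of_mem hx]
  · refine Eventually.of_forall fun t ht => ?_
    have : deriv (fun t => splice γ η c d t - γ t) t = 0 := by
      have : (fun t => splice γ η c d t - γ t) =ᶠ[𝓝 t] fun _ => 0 := by
        filter_upwards [isClosed_Icc.isOpen_compl.mem_nhds ht.2] with x hx
        rw [splice_of_notMem hx, sub_self]
      rw [this.deriv_eq, deriv_const]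
    simp [this, splice_of_notMem ht.2]

end splice

/-- A local minimizer of finite action is minimal among the small modifications on subintervals. -/
lemma IsFixedEndLocalMinimizer.localize {h a b : ℝ} {x y : ℂ} {γ : ℝ → ℂ}
    (hγ : IsFixedEndLocalMinimizer m q h a b x y γ) (hfin : lagInt m q γ a b ≠ ⊤) :
    ∃ ε : ℝ, 0 < ε ∧ ∀ c d : ℝ, a ≤ c → c ≤ d → d ≤ b → ∀ η : ℝ → ℂ, IsH1Path η c d →
      η c = γ c → η d = γ d → h1Norm (fun t => η t - γ t) c d ≤ ε →
      lagInt m q γ c d ≤ lagInt m q η c d := by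
  obtain ⟨⟨h1, rfl, rfl⟩, ε, hε, hmin⟩ := hγ
  refine ⟨ε, hε, fun c d hac hcd hdb η hη hc hd hn => ?_⟩
  have hs := hmin (splice γ η c d) ⟨isH1Path_splice h1 hη hac hcd hdb hc hd,
    splice_eq_of_le hc hac hcd, splice_eq_of_ge hd hdb hcd⟩
    (by rwa [h1Norm_splice hac hdb])
  have hle := lagInt_le_of_action_le hs
  rw [lagInt_splice hac hdb, lagInt_eq_add (c := c) (d := d) γ hac hdb] at hle
  rw [lagInt_eq_add (c := c) (d := d) γ hac hdb] at hfin
  exact (ENNReal.add_le_add_iff_right (fun h => hfin (by rw [h, add_top]))).1 hle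

/-- Replacing a piece of a path by one of smaller action lowers the action. -/
lemma lagInt_splice_lt {γ η : ℝ → ℂ} {a b c d : ℝ} (hac : a ≤ c) (hdb : d ≤ b)
    (hfin : ∫⁻ t in Icc a b \ Icc c d, lagr m q γ t ≠ ⊤)
    (hlt : lagInt m q η c d < lagInt m q γ c d) :
    lagInt m q (splice γ η c d) a b < lagInt m q γ a b := by
  rw [lagInt_splice hac hdb, lagInt_eq_add (c := c) (d := d) γ hac hdb]
  exact (ENNReal.add_lt_add_iff_right hfin).2 hlt

/-- The integrand of the action as a real number (meaningless at collisions). -/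
def lagReal (m : Fin N → ℝ) (q : Fin N → ℝ → ℂ) (γ : ℝ → ℂ) (t : ℝ) : ℝ :=
  ‖deriv γ t‖ ^ 2 / 2 + ∑ i, m i / ‖γ t - q i t‖

lemma potential_eq (hm : ∀ i, 0 < m i) {z : ℂ} {t : ℝ} (hz : ∀ i, z ≠ q i t) :
    potential m q z t = ENNReal.ofReal (∑ i, m i / ‖z - q i t‖) := by
  unfold potential
  rw [ENNReal.ofReal_sum_of_nonneg fun i _ => div_nonneg (hm i).le (norm_nonneg _)]
  refine Finset.sum_congr rfl fun i _ => ?_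
  rw [ENNReal.ofReal_div_of_pos (norm_pos_iff.2 (sub_ne_zero.2 (hz i)))]

lemma lagr_eq (hm : ∀ i, 0 < m i) {γ : ℝ → ℂ} {t : ℝ} (hz : CollisionFreeAt q γ t) :
    lagr m q γ t = ENNReal.ofReal (lagReal m q γ t) := by
  unfold lagr lagReal
  rw [potential_eq hm hz, ENNReal.ofReal_add (by positivity)
    (Finset.sum_nonneg fun i _ => div_nonneg (hm i).le (norm_nonneg _))]

lemma lagReal_nonneg (hm : ∀ i, 0 < m i) (γ : ℝ → ℂ) (t : ℝ) : 0 ≤ lagReal m q γ t :=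
  add_nonneg (by positivity)
    (Finset.sum_nonneg fun i _ => div_nonneg (hm i).le (norm_nonneg _))

lemma potential_eq_top (hm : ∀ i, 0 < m i) {z : ℂ} {t : ℝ} {i : Fin N} (hz : z = q i t) :
    potential m q z t = ⊤ := by
  unfold potential
  rw [ENNReal.sum_eq_top]
  refine ⟨i, Finset.mem_univ _, ?_⟩
  rw [hz, sub_self, norm_zero, ENNReal.ofReal_zero, ENNReal.div_zero]
  simpa using hm i

lemma aemeasurable_norm_sub {γ : ℝ → ℂ} {a b : ℝ} (hγ : ContinuousOn γ (Icc a b))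
    {p : ℝ → ℂ} (hp : Continuous p) :
    AEMeasurable (fun t => ‖γ t - p t‖) (volume.restrict (Icc a b)) :=
  ((hγ.sub hp.continuousOn).norm).aemeasurable measurableSet_Icc

lemma aemeasurable_lagReal {γ : ℝ → ℂ} {a b : ℝ} (hγ : ContinuousOn γ (Icc a b))
    (hq : ∀ i, Continuous (q i)) :
    AEMeasurable (lagReal m q γ) (volume.restrict (Icc a b)) := by
  refine AEMeasurable.add (f := fun t => ‖deriv γ t‖ ^ 2 / 2)
    (g := fun t => ∑ i, m i / ‖γ t - q i t‖) ?_ ?_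
  · exact (((measurable_deriv γ).norm.pow_const 2).div_const 2).aemeasurable
  · refine Finset.aemeasurable_fun_sum _ fun i _ => ?_
    exact (aemeasurable_norm_sub hγ (hq i)).const_div _

lemma aemeasurable_lagr {γ : ℝ → ℂ} {a b : ℝ} (hγ : ContinuousOn γ (Icc a b))
    (hq : ∀ i, Continuous (q i)) :
    AEMeasurable (lagr m q γ) (volume.restrict (Icc a b)) := by
  refine AEMeasurable.add (f := fun t => ENNReal.ofReal (‖deriv γ t‖ ^ 2 / 2))
    (g := fun t => ∑ i, ENNReal.ofReal (m i) / ENNReal.ofReal ‖γ t - q i t‖) ?_ ?_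
  · exact (((measurable_deriv γ).norm.pow_const 2).div_const 2).ennreal_ofReal.aemeasurable
  · refine Finset.aemeasurable_fun_sum _ fun i _ => ?_
    exact ((aemeasurable_norm_sub hγ (hq i)).ennreal_ofReal).const_div _

/-- A path of finite action is almost everywhere collision-free, and its Lagrangian is
integrable. -/
lemma collisionFree_of_lagInt_ne_top (hm : ∀ i, 0 < m i) (hq : ∀ i, Continuous (q i))
    {γ : ℝ → ℂ} {a b : ℝ} (hγ : ContinuousOn γ (Icc a b)) (hfin : lagInt m q γ a b ≠ ⊤) :
    (∀ᵐ t, t ∈ Icc a b → CollisionFreeAt q γ t) ∧ IntegrableOn (lagReal m q γ) (Icc a b) ∧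
      lagInt m q γ a b = ENNReal.ofReal (∫ t in Icc a b, lagReal m q γ t) := by
  have h1 : ∀ᵐ t, t ∈ Icc a b → CollisionFreeAt q γ t := by
    have := ae_lt_top' (aemeasurable_lagr hγ hq) hfin
    rw [ae_restrict_iff' measurableSet_Icc] at this
    filter_upwards [this] with t ht hm' i hi
    have := ht hm'
    rw [lagr, potential_eq_top hm hi] at this
    simp at this
  have h2 : lagInt m q γ a b = ∫⁻ t in Icc a b, ENNReal.ofReal (lagReal m q γ t) := by
    refine lintegral_congr_ae ?_
    rw [EventuallyEq, ae_restrict_iff' measurableSet_Icc]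
    filter_upwards [h1] with t ht hm' using lagr_eq hm (ht hm')
  have h3 : IntegrableOn (lagReal m q γ) (Icc a b) := by
    refine ⟨(aemeasurable_lagReal hγ hq).aestronglyMeasurable, ?_⟩
    rw [hasFiniteIntegral_iff_ofReal (Eventually.of_forall fun t => lagReal_nonneg hm γ t), ← h2]
    exact hfin.lt_top
  exact ⟨h1, h3, by rw [h2, ofReal_integral_eq_lintegral_ofReal h3
    (Eventually.of_forall fun t => lagReal_nonneg hm γ t)]⟩

/-- If the Lagrangian increases by at most `G` when passing from `γ` to `η`, and the action does
not decrease, then `G` has nonnegative integral. -/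
lemma integral_nonneg_of_lagInt_le (hm : ∀ i, 0 < m i) (hq : ∀ i, Continuous (q i))
    {γ η : ℝ → ℂ} {a b : ℝ} (hγ : ContinuousOn γ (Icc a b)) (hfin : lagInt m q γ a b ≠ ⊤)
    (hle : lagInt m q γ a b ≤ lagInt m q η a b) {G : ℝ → ℝ} (hG : IntegrableOn G (Icc a b))
    (hη : ∀ᵐ t, t ∈ Icc a b → CollisionFreeAt q γ t → CollisionFreeAt q η t ∧
      lagReal m q η t ≤ lagReal m q γ t + G t) :
    0 ≤ ∫ t in Icc a b, G t := by
  obtain ⟨h1, h2, h3⟩ := collisionFree_of_lagInt_ne_top hm hq hγ hfin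
  have h4 : ∀ᵐ t, t ∈ Icc a b → lagr m q η t ≤ ENNReal.ofReal (lagReal m q γ t + G t) := by
    filter_upwards [h1, hη] with t ht1 ht2 ht
    obtain ⟨h5, h6⟩ := ht2 ht (ht1 ht)
    rw [lagr_eq hm h5]
    exact ENNReal.ofReal_le_ofReal h6
  have h5 : 0 ≤ᵐ[volume.restrict (Icc a b)] fun t => lagReal m q γ t + G t := by
    rw [EventuallyLE, ae_restrict_iff' measurableSet_Icc]
    filter_upwards [h1, hη] with t ht1 ht2 ht
    exact (lagReal_nonneg hm η t).trans (ht2 ht (ht1 ht)).2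
  have h6 : lagInt m q η a b ≤ ENNReal.ofReal (∫ t in Icc a b, (lagReal m q γ t + G t)) := by
    rw [ofReal_integral_eq_lintegral_ofReal (f := fun t => lagReal m q γ t + G t) (h2.add hG) h5]
    exact lintegral_mono_ae ((ae_restrict_iff' measurableSet_Icc).2 h4)
  have h7 := hle.trans h6
  rw [h3, ENNReal.ofReal_le_ofReal_iff (integral_nonneg_of_ae h5), integral_add h2 hG] at h7
  linarith

/-! ### Perturbations of finite action -/

/-- In polar coordinates the Jacobian cancels the singularity, leaving at most the area of a bounded
rectangle. -/
lemma lintegral_inv_norm_ball_ne_top :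
    ∫⁻ c in Metric.ball (0 : ℂ) 1, (ENNReal.ofReal ‖c‖)⁻¹ ≠ ⊤ := by
  rw [← lintegral_indicator Metric.isOpen_ball.measurableSet,
    ← Complex.lintegral_comp_polarCoord_symm]
  have hle : ∫⁻ p in polarCoord.target, ENNReal.ofReal p.1 •
      (Metric.ball (0 : ℂ) 1).indicator (fun c => (ENNReal.ofReal ‖c‖)⁻¹)
        (Complex.polarCoord.symm p) ≤
      ∫⁻ p in polarCoord.target, (Ioo (0 : ℝ) 1 ×ˢ Ioo (-Real.pi) Real.pi).indicator 1 p := by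
    refine setLIntegral_mono_ae' (by rw [polarCoord_target]; measurability)
      (Eventually.of_forall fun p hp => ?_)
    rw [polarCoord_target] at hp
    have hp1 : 0 < p.1 := hp.1
    have hn : ‖Complex.polarCoord.symm p‖ = p.1 := by
      rw [Complex.norm_polarCoord_symm, abs_of_pos hp1]
    by_cases h : p.1 < 1
    · rw [indicator_of_mem (by rwa [mem_ball_zero_iff, hn]), hn,
        indicator_of_mem (show p ∈ Ioo (0 : ℝ) 1 ×ˢ Ioo (-Real.pi) Real.pi from ⟨⟨hp1, h⟩, hp.2⟩),
        smul_eq_mul, Pi.one_apply]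
      exact (ENNReal.mul_inv_le_one _)
    · rw [indicator_of_notMem (by rwa [mem_ball_zero_iff, hn])]
      simp
  refine (hle.trans (setLIntegral_le_lintegral _ _)).trans_lt ?_ |>.ne
  rw [lintegral_indicator_one (by measurability), Measure.volume_eq_prod, Measure.prod_prod]
  simp

/-- The integrand is at most 1 plus the singular kernel cut off to the unit disc, and the integral
of the latter over the whole plane is translation invariant. The uniformity in `B` is what the
averaging argument needs. -/
lemma exists_lintegral_inv_norm_add_le : ∃ C : ENNReal, C ≠ ⊤ ∧ ∀ B : ℂ,
    ∫⁻ c in Metric.ball (0 : ℂ) 1, (ENNReal.ofReal ‖c + B‖)⁻¹ ≤ C := by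
  refine ⟨volume (Metric.ball (0 : ℂ) 1) +
    ∫⁻ c in Metric.ball (0 : ℂ) 1, (ENNReal.ofReal ‖c‖)⁻¹,
    ENNReal.add_ne_top.2 ⟨measure_ball_lt_top.ne, lintegral_inv_norm_ball_ne_top⟩, fun B => ?_⟩
  set f : ℂ → ENNReal := (Metric.ball (0 : ℂ) 1).indicator fun c => (ENNReal.ofReal ‖c‖)⁻¹
    with hf
  have h1 : ∀ c, (ENNReal.ofReal ‖c + B‖)⁻¹ ≤ 1 + f (c + B) := by
    intro c
    by_cases h : ‖c + B‖ < 1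
    · rw [hf, indicator_of_mem (by rwa [mem_ball_zero_iff])]
      exact le_add_self
    · refine le_add_of_le_of_nonneg ?_ (zero_le)
      rw [ENNReal.inv_le_one, ENNReal.one_le_ofReal]
      exact not_lt.1 h
  calc ∫⁻ c in Metric.ball (0 : ℂ) 1, (ENNReal.ofReal ‖c + B‖)⁻¹
      ≤ ∫⁻ c in Metric.ball (0 : ℂ) 1, (1 + f (c + B)) := lintegral_mono h1
    _ = volume (Metric.ball (0 : ℂ) 1) + ∫⁻ c in Metric.ball (0 : ℂ) 1, f (c + B) := by
        rw [lintegral_add_left measurable_const]; simp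
    _ ≤ volume (Metric.ball (0 : ℂ) 1) + ∫⁻ c, f (c + B) := by
        exact add_le_add le_rfl (setLIntegral_le_lintegral _ _)
    _ = _ := by
        rw [lintegral_add_right_eq_self, hf, lintegral_indicator Metric.isOpen_ball.measurableSet]

/-- The weight `min (t - a) (b - t) ^ (2 / 3)`: a Sobolev function vanishing at `a` and `b`
whose inverse is integrable. -/
def weight (a b t : ℝ) : ℝ := (min (t - a) (b - t)) ^ (2 / 3 : ℝ)

lemma weight_left {a b : ℝ} (hab : a < b) : weight a b a = 0 := by
  rw [weight, sub_self, min_eq_left (by linarith), Real.zero_rpow (by norm_num)]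

lemma weight_right {a b : ℝ} (hab : a < b) : weight a b b = 0 := by
  rw [weight, sub_self, min_eq_right (by linarith), Real.zero_rpow (by norm_num)]

lemma weight_pos {a b t : ℝ} (ht : t ∈ Ioo a b) : 0 < weight a b t :=
  Real.rpow_pos_of_pos (lt_min (sub_pos.2 ht.1) (sub_pos.2 ht.2)) _

lemma intervalIntegrable_rpow_sub {r : ℝ} (hr : -1 < r) (a c d : ℝ) :
    IntervalIntegrable (fun t => (t - a) ^ r) volume c d := by
  have := (intervalIntegral.intervalIntegrable_rpow' hr (a := c - a) (b := d - a)).comp_sub_right a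
  simpa using this

lemma intervalIntegrable_sub_rpow {r : ℝ} (hr : -1 < r) (b c d : ℝ) :
    IntervalIntegrable (fun t => (b - t) ^ r) volume c d := by
  have := (intervalIntegral.intervalIntegrable_rpow' hr (a := b - c) (b := b - d)).comp_sub_left b
  simpa using this

/-- The exponent 2/3 lies strictly between 1/2 and 1: the squared derivative has order -2/3, which
is integrable, and so has the inverse of the function itself. -/
lemma isH1Path_rpow_sub {a b : ℝ} (hab : a ≤ b) :
    IsH1Path (fun t => (((t - a) ^ (2 / 3 : ℝ) : ℝ) : ℂ)) a b := by
  refine (isH1Path_of_primitive (v := fun t => ((2 / 3 * (t - a) ^ (-(1 / 3) : ℝ) : ℝ) : ℂ))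
    hab ?_ fun t ht => ?_).1
  · refine (memLp_two_iff_integrable_sq_norm ?_).2 ?_
    · exact (Complex.measurable_ofReal.comp (by fun_prop)).aestronglyMeasurable
    · have h1 := ((intervalIntegrable_rpow_sub (r := -(2 / 3)) (by norm_num) a a b).const_mul
        (4 / 9))
      rw [intervalIntegrable_iff_integrableOn_Icc_of_le hab] at h1
      refine h1.congr_fun (fun t ht => ?_) measurableSet_Icc
      have h0 : 0 ≤ t - a := sub_nonneg.2 ht.1
      simp only [Complex.norm_real, Real.norm_eq_abs, sq_abs, mul_pow]
      rw [← Real.rpow_mul_natCast h0]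
      norm_num
  · rw [intervalIntegral.integral_ofReal, intervalIntegral.integral_const_mul,
      intervalIntegral.integral_comp_sub_right (fun x => x ^ (-(1 / 3) : ℝ)) a,
      integral_rpow (Or.inl (by norm_num)), sub_self]
    rw [Real.zero_rpow (by norm_num), Real.zero_rpow (by norm_num)]
    norm_num
    ring

lemma isH1Path_sub_rpow {a b : ℝ} (hab : a ≤ b) :
    IsH1Path (fun t => (((b - t) ^ (2 / 3 : ℝ) : ℝ) : ℂ)) a b := by
  refine (isH1Path_of_primitive (v := fun t => ((-(2 / 3) * (b - t) ^ (-(1 / 3) : ℝ) : ℝ) : ℂ))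
    hab ?_ fun t ht => ?_).1
  · refine (memLp_two_iff_integrable_sq_norm ?_).2 ?_
    · exact (Complex.measurable_ofReal.comp (by fun_prop)).aestronglyMeasurable
    · have h1 := ((intervalIntegrable_sub_rpow (r := -(2 / 3)) (by norm_num) b a b).const_mul
        (4 / 9))
      rw [intervalIntegrable_iff_integrableOn_Icc_of_le hab] at h1
      refine h1.congr_fun (fun t ht => ?_) measurableSet_Icc
      have h0 : 0 ≤ b - t := sub_nonneg.2 ht.2
      simp only [Complex.norm_real, Real.norm_eq_abs, sq_abs, mul_pow]
      rw [← Real.rpow_mul_natCast h0]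
      norm_num
  · rw [intervalIntegral.integral_ofReal, intervalIntegral.integral_const_mul,
      intervalIntegral.integral_comp_sub_left (fun x => x ^ (-(1 / 3) : ℝ)) b,
      integral_rpow (Or.inl (by norm_num))]
    norm_num
    ring

lemma isH1Path_weight {a b : ℝ} (hab : a < b) : IsH1Path (fun t => (weight a b t : ℂ)) a b := by
  have hm1 : a ≤ (a + b) / 2 := by linarith
  have hm2 : (a + b) / 2 ≤ b := by linarith
  refine IsH1Path.glue hm1 hm2 ?_ ?_
  · refine ((isH1Path_rpow_sub hab.le).mono le_rfl hm1 hm2).congr hm1 fun t ht => ?_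
    rw [weight, min_eq_left (by linarith [ht.2])]
  · refine ((isH1Path_sub_rpow hab.le).mono hm1 hm2 le_rfl).congr hm2 fun t ht => ?_
    rw [weight, min_eq_right (by linarith [ht.1])]

lemma lintegral_inv_weight_ne_top {a b : ℝ} (hab : a < b) :
    ∫⁻ t in Icc a b, (ENNReal.ofReal (weight a b t))⁻¹ ≠ ⊤ := by
  have h1 := intervalIntegrable_rpow_sub (r := -(2 / 3)) (by norm_num) a a b
  have h2 := intervalIntegrable_sub_rpow (r := -(2 / 3)) (by norm_num) b a b
  rw [intervalIntegrable_iff_integrableOn_Icc_of_le hab.le] at h1 h2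
  have h3 := (h1.add h2).lintegral_lt_top
  refine (lt_of_le_of_lt (lintegral_mono_ae ?_) h3).ne
  rw [ae_restrict_iff' measurableSet_Icc]
  filter_upwards [ae_mem_Ioo a b] with t ht hm
  obtain ⟨h4, h5⟩ := ht hm
  rw [← ENNReal.ofReal_inv_of_pos (weight_pos ⟨h4, h5⟩)]
  refine ENNReal.ofReal_le_ofReal ?_
  have h6 : 0 ≤ (t - a) ^ (-(2 / 3) : ℝ) := Real.rpow_nonneg (by linarith) _
  have h7 : 0 ≤ (b - t) ^ (-(2 / 3) : ℝ) := Real.rpow_nonneg (by linarith) _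
  rw [weight, ← Real.rpow_neg (le_min (by linarith) (by linarith))]
  simp only [Pi.add_apply]
  rcases min_choice (t - a) (b - t) with h | h <;> rw [h] <;> linarith

/-- Factoring `s` out of the norm reduces the average over the disc to the translated kernel, at the
price of a factor 1/s, uniformly in `A`. -/
lemma lintegral_ball_inv_le {C : ENNReal}
    (hC : ∀ B : ℂ, ∫⁻ c in Metric.ball (0 : ℂ) 1, (ENNReal.ofReal ‖c + B‖)⁻¹ ≤ C)
    {s : ℝ} (hs : 0 < s) (A : ℂ) (M : ℝ) :
    ∫⁻ c in Metric.ball (0 : ℂ) 1, ENNReal.ofReal M / ENNReal.ofReal ‖A + s * c‖ ≤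
      ENNReal.ofReal M * (C * (ENNReal.ofReal s)⁻¹) := by
  have h : ∀ c : ℂ, ENNReal.ofReal M / ENNReal.ofReal ‖A + s * c‖ =
      (ENNReal.ofReal M * (ENNReal.ofReal s)⁻¹) * (ENNReal.ofReal ‖c + A / s‖)⁻¹ := by
    intro c
    have hs' : (s : ℂ) ≠ 0 := by exact_mod_cast hs.ne'
    have h1 : ‖A + s * c‖ = s * ‖c + A / s‖ := by
      rw [show A + s * c = s * (c + A / s) by field_simp; ring, norm_mul, Complex.norm_real,
        Real.norm_of_nonneg hs.le]
    rw [h1, ENNReal.ofReal_mul hs.le, div_eq_mul_inv, ENNReal.mul_inv, mul_assoc]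
    · left; simpa using hs
    · left; exact ENNReal.ofReal_ne_top
  simp_rw [h]
  rw [lintegral_const_mul _ (by fun_prop), mul_assoc, mul_comm C]
  gcongr
  exact hC _

/-- Arbitrarily small perturbations of a Sobolev path have finite action. -/
lemma exists_perturbation_lagInt_ne_top (hq : ∀ i, Continuous (q i)) {γ : ℝ → ℂ} {a b : ℝ}
    (hab : a < b) (hγ : IsH1Path γ a b) {ε : ℝ} (hε : 0 < ε) :
    ∃ ξ : ℝ → ℂ, IsH1Path ξ a b ∧ ξ a = γ a ∧ ξ b = γ b ∧
      h1Norm (fun t => ξ t - γ t) a b ≤ ε ∧ lagInt m q ξ a b ≠ ⊤ := by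
  obtain ⟨C, hC, hCB⟩ := exists_lintegral_inv_norm_add_le
  set φ : ℝ → ℂ := fun t => (weight a b t : ℂ) with hφ
  set r : ℝ := ε / (h1Norm φ a b + 1) with hr
  have hn : 0 ≤ h1Norm φ a b := Real.sqrt_nonneg _
  have hr0 : 0 < r := by positivity
  -- A continuous extension to the whole line, so that `F` below is jointly measurable in the
  -- parameter and the time.
  set γ' : ℝ → ℂ := IccExtend hab.le (fun t : Icc a b => γ t) with hγ'
  have hγc : Continuous γ' := (continuousOn_iff_continuous_domRestrict.1 hγ.continuousOn).Icc_extend'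
  have hγe : ∀ t ∈ Icc a b, γ' t = γ t := fun t ht => by rw [hγ', IccExtend_of_mem _ _ ht]
  have hwc : Continuous (weight a b) := by
    unfold weight
    exact (by fun_prop : Continuous fun t => min (t - a) (b - t)).rpow_const
      fun t => Or.inr (by norm_num)
  set F : ℂ → ℝ → ENNReal := fun c t =>
    ∑ i, ENNReal.ofReal (m i) / ENNReal.ofReal ‖(γ' t - q i t) + ((r * weight a b t : ℝ) : ℂ) * c‖
    with hF
  have hFm : Measurable (Function.uncurry F) := by
    refine Finset.measurable_fun_sum _ fun i _ => Measurable.const_div ?_ _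
    refine ENNReal.measurable_ofReal.comp (Continuous.measurable ?_)
    have := hq i
    fun_prop
  -- Tonelli: for fixed `t` the average over `c` is at most a constant over `r` times the weight,
  -- which is integrable in `t`. Almost every `c` in the disc then gives a finite potential
  -- integral.
  have hfin : ∫⁻ c in Metric.ball (0 : ℂ) 1, ∫⁻ t in Icc a b, F c t ≠ ⊤ := by
    rw [lintegral_lintegral_swap hFm.aemeasurable]
    refine (lt_of_le_of_lt (lintegral_mono_ae (g := fun t => (∑ i, ENNReal.ofReal (m i)) *
      (C * ((ENNReal.ofReal r)⁻¹ * (ENNReal.ofReal (weight a b t))⁻¹))) ?_) ?_).ne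
    · rw [ae_restrict_iff' measurableSet_Icc]
      filter_upwards [ae_mem_Ioo a b] with t ht hm'
      have hw := weight_pos (ht hm')
      have h1 : ∫⁻ c in Metric.ball (0 : ℂ) 1, F c t =
          ∑ i, ∫⁻ c in Metric.ball (0 : ℂ) 1, ENNReal.ofReal (m i) /
            ENNReal.ofReal ‖(γ' t - q i t) + ((r * weight a b t : ℝ) : ℂ) * c‖ := by
        rw [hF]
        exact lintegral_finsetSum _ fun i _ => by fun_prop
      rw [h1, Finset.sum_mul]
      refine Finset.sum_le_sum fun i _ => ?_
      refine (lintegral_ball_inv_le hCB (mul_pos hr0 hw) _ _).trans ?_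
      rw [ENNReal.ofReal_mul hr0.le, ENNReal.mul_inv]
      · left; simpa using hr0
      · left; exact ENNReal.ofReal_ne_top
    · have hwm : Measurable fun t => (ENNReal.ofReal (weight a b t))⁻¹ := by
        have := hwc.measurable
        fun_prop
      rw [lintegral_const_mul _ (by fun_prop), lintegral_const_mul _ (by fun_prop),
        lintegral_const_mul _ hwm]
      refine ENNReal.mul_lt_top (ENNReal.sum_lt_top.2 fun _ _ => ENNReal.ofReal_lt_top)
        (ENNReal.mul_lt_top hC.lt_top (ENNReal.mul_lt_top ?_
          (lintegral_inv_weight_ne_top hab).lt_top))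
      rw [ENNReal.inv_lt_top]
      simpa using hr0
  obtain ⟨c, hc1, hc2⟩ : ∃ c ∈ Metric.ball (0 : ℂ) 1, ∫⁻ t in Icc a b, F c t < ⊤ := by
    have h1 := ae_lt_top (hFm.lintegral_prod_right' (ν := volume.restrict (Icc a b))) hfin
    rw [ae_restrict_iff' Metric.isOpen_ball.measurableSet] at h1
    by_contra! hcon
    have h2 : ∀ᵐ c : ℂ, c ∉ Metric.ball (0 : ℂ) 1 := by
      filter_upwards [h1] with c hc hcb
      exact absurd (hc hcb) (not_lt.2 (hcon c hcb))
    have h3 : volume (Metric.ball (0 : ℂ) 1) = 0 := by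
      rw [← compl_mem_ae_iff]
      exact h2
    exact (Metric.measure_ball_pos volume (0 : ℂ) one_pos).ne' h3
  have hφH : IsH1Path φ a b := isH1Path_weight hab
  have hξ : IsH1Path (fun t => γ t + (r * c) * φ t) a b := hγ.add (hφH.const_mul _)
  refine ⟨_, hξ, ?_, ?_, ?_, ?_⟩
  · simp [hφ, weight_left hab]
  · simp [hφ, weight_right hab]
  · have h1 : h1Norm (fun t => γ t + (r * c) * φ t - γ t) a b = ‖(r * c : ℂ)‖ * h1Norm φ a b := by
      unfold h1Norm
      rw [← Real.sqrt_sq (norm_nonneg (r * c : ℂ)), ← Real.sqrt_mul (sq_nonneg _),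
        ← integral_const_mul]
      congr 2
      ext t
      simp only [add_sub_cancel_left]
      rw [deriv_const_mul_field, norm_mul, norm_mul (r * c : ℂ)]
      ring
    rw [h1, norm_mul, Complex.norm_real, Real.norm_of_nonneg hr0.le]
    have hc3 : ‖c‖ ≤ 1 := (mem_ball_zero_iff.1 hc1).le
    calc r * ‖c‖ * h1Norm φ a b ≤ r * 1 * (h1Norm φ a b + 1) := by gcongr; linarith
      _ = ε := by rw [hr]; field_simp
  · unfold lagInt lagr
    rw [lintegral_add_left (by fun_prop)]
    refine ENNReal.add_ne_top.2 ⟨?_, ?_⟩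
    · exact (hξ.integrable_sq.div_const 2).lintegral_lt_top.ne
    · have h1 : ∫⁻ t in Icc a b, potential m q (γ t + (r * c) * φ t) t =
          ∫⁻ t in Icc a b, F c t := by
        refine setLIntegral_congr_fun measurableSet_Icc fun t ht => ?_
        simp only [potential, hF, hφ, hγe t ht]
        refine Finset.sum_congr rfl fun i _ => ?_
        congr 3
        push_cast
        ring
      rw [h1]
      exact hc2.ne

/-- Otherwise a nearby competitor of finite action would be strictly better. Finiteness allows
actions to be subtracted in every later comparison. -/
lemma IsFixedEndLocalMinimizer.lagInt_ne_top (hq : ∀ i, Continuous (q i)) {h a b : ℝ}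
    (hab : a < b) {x y : ℂ} {γ : ℝ → ℂ} (hγ : IsFixedEndLocalMinimizer m q h a b x y γ) :
    lagInt m q γ a b ≠ ⊤ := by
  obtain ⟨⟨h1, rfl, rfl⟩, ε, hε, hmin⟩ := hγ
  obtain ⟨ξ, h2, h3, h4, h5, h6⟩ :=
    exists_perturbation_lagInt_ne_top (m := m) hq hab h1 hε
  have := lagInt_le_of_action_le (hmin ξ ⟨h2, h3, h4⟩ h5)
  exact (this.trans_lt h6.lt_top).ne

/-! ### The Euler-Lagrange equation -/

lemma integrableOn_inner_of_memLp {u v : ℝ → ℂ} {s : Set ℝ}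
    (hu : MemLp u 2 (volume.restrict s)) (hv : MemLp v 2 (volume.restrict s)) :
    IntegrableOn (fun t => inner ℝ (u t) (v t)) s := by
  have h1 := (memLp_two_iff_integrable_sq_norm hu.1).1 hu
  have h2 := (memLp_two_iff_integrable_sq_norm hv.1).1 hv
  refine (h1.add h2).mono' (hu.1.inner hv.1) (Eventually.of_forall fun t => ?_)
  refine (norm_inner_le_norm _ _).trans ?_
  simp only [Pi.add_apply]
  nlinarith [sq_nonneg (‖u t‖ - ‖v t‖), sq_nonneg ‖u t‖, sq_nonneg ‖v t‖]

lemma IsH1Path.integrableOn_inner {γ η : ℝ → ℂ} {a b : ℝ} (h : IsH1Path γ a b)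
    (h' : IsH1Path η a b) : IntegrableOn (fun t => inner ℝ (deriv γ t) (deriv η t)) (Icc a b) :=
  integrableOn_inner_of_memLp h.2 h'.2

lemma inner_eq_re_im (x y : ℂ) : inner ℝ x y = x.re * y.re + x.im * y.im := by
  rw [Complex.inner, Complex.mul_re, Complex.conj_re, Complex.conj_im]; ring

/-- Integration by parts for the real inner product of Sobolev paths. -/
lemma IsH1Path.integral_inner_deriv {γ η : ℝ → ℂ} {a b : ℝ} (hab : a ≤ b) (h : IsH1Path γ a b)
    (h' : IsH1Path η a b) :
    ∫ t in Icc a b, (inner ℝ (deriv γ t) (η t) + inner ℝ (γ t) (deriv η t)) =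
      inner ℝ (γ b) (η b) - inner ℝ (γ a) (η a) := by
  have hac : AbsolutelyContinuousOnInterval
      (fun t => (γ t).re * (η t).re + (γ t).im * (η t).im) a b :=
    ((ac_re h.1).mul (ac_re h'.1)).add ((ac_im h.1).mul (ac_im h'.1))
  have h1 := hac.integral_deriv_eq_sub
  rw [intervalIntegral.integral_of_le hab, ← integral_Icc_eq_integral_Ioc] at h1
  rw [inner_eq_re_im, inner_eq_re_im, ← h1]
  refine setIntegral_congr_ae measurableSet_Icc ?_
  filter_upwards [h.ae_hasDerivAt, h'.ae_hasDerivAt] with t h2 h3 ht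
  have h4 := h2 ht
  have h5 := h3 ht
  rw [inner_eq_re_im, inner_eq_re_im, (((hasDerivAt_re h4).fun_mul (hasDerivAt_re h5)).fun_add
    ((hasDerivAt_im h4).fun_mul (hasDerivAt_im h5))).deriv]
  ring

/-- A quadratic upper bound for the Newtonian potential. -/
lemma one_div_norm_add_le {x y : ℂ} {κ : ℝ} (hκ : 0 < κ) (hx : 2 * κ ≤ ‖x‖) (hy : ‖y‖ ≤ κ) :
    1 / ‖x + y‖ ≤ 1 / ‖x‖ - inner ℝ x y / ‖x‖ ^ 3 + ‖y‖ ^ 2 / κ ^ 3 := by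
  set a := ‖x‖ with ha
  set b := ‖x + y‖ with hb
  have hb1 : κ ≤ b := by
    have := norm_sub_norm_le x (-y)
    rw [norm_neg, sub_neg_eq_add] at this
    linarith
  have hba : (b - a) ^ 2 ≤ ‖y‖ ^ 2 := by
    have := abs_norm_sub_norm_le (x + y) x
    rw [add_sub_cancel_left] at this
    exact sq_le_sq' (by linarith [abs_le.1 this]) (abs_le.1 this).2
  have hi : inner ℝ x y = (b ^ 2 - a ^ 2 - ‖y‖ ^ 2) / 2 := by
    rw [hb, norm_add_sq_real]; ring
  have ha0 : 0 < a := by linarith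
  have hb0 : 0 < b := by linarith
  -- With a = |x| and b = |x + y| the inner product is (b² - a² - |y|²)/2, so the first-order
  -- remainder is an exact rational expression in a and b. A nonpositive term in |y|² is dropped.
  have key : 1 / b - (1 / a - inner ℝ x y / a ^ 3) ≤ (b - a) ^ 2 * (b + 2 * a) / (2 * a ^ 3 * b) := by
    rw [hi]
    have : 1 / b - (1 / a - (b ^ 2 - a ^ 2 - ‖y‖ ^ 2) / 2 / a ^ 3) =
        (b - a) ^ 2 * (b + 2 * a) / (2 * a ^ 3 * b) - ‖y‖ ^ 2 / (2 * a ^ 3) := by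
      field_simp; ring
    rw [this]
    have : 0 ≤ ‖y‖ ^ 2 / (2 * a ^ 3) := by positivity
    linarith
  have h2 : (b - a) ^ 2 * (b + 2 * a) / (2 * a ^ 3 * b) ≤ ‖y‖ ^ 2 / κ ^ 3 := by
    have h3 : (b + 2 * a) / (2 * a ^ 3 * b) ≤ 1 / κ ^ 3 := by
      have : (b + 2 * a) / (2 * a ^ 3 * b) = 1 / (2 * a ^ 3) + 1 / (a ^ 2 * b) := by
        field_simp
      rw [this]
      have e1 : 1 / (2 * a ^ 3) ≤ 1 / (2 * κ ^ 3) := by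
        gcongr; linarith
      have e2 : 1 / (a ^ 2 * b) ≤ 1 / (2 * κ ^ 3) := by
        apply one_div_le_one_div_of_le (by positivity)
        calc 2 * κ ^ 3 ≤ (2 * κ) ^ 2 * κ := by nlinarith [pow_pos hκ 3]
          _ ≤ a ^ 2 * b := by gcongr
      have e3 : 1 / (2 * κ ^ 3) + 1 / (2 * κ ^ 3) = 1 / κ ^ 3 := by field_simp; norm_num
      linarith
    calc _ = (b - a) ^ 2 * ((b + 2 * a) / (2 * a ^ 3 * b)) := by ring
      _ ≤ ‖y‖ ^ 2 * (1 / κ ^ 3) := by gcongr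
      _ = _ := by ring
  linarith

/-- Used for the first variation: for small ε of the sign opposite to A, the linear term would
dominate the quadratic one. -/
lemma eq_zero_of_forall_small {A B δ : ℝ} (hδ : 0 < δ)
    (h : ∀ ε : ℝ, |ε| ≤ δ → 0 ≤ ε * A + ε ^ 2 * B) : A = 0 := by
  by_contra hA
  have hB : 0 < |B| + 1 := by positivity
  set s := min δ (|A| / (2 * (|B| + 1))) with hs
  have hA' : 0 < |A| := abs_pos.2 hA
  have hs0 : 0 < s := lt_min hδ (by positivity)
  have hs1 : s ≤ δ := min_le_left _ _
  have hs2 : s * (|B| + 1) ≤ |A| / 2 := by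
    have : s ≤ |A| / (2 * (|B| + 1)) := min_le_right _ _
    calc s * (|B| + 1) ≤ |A| / (2 * (|B| + 1)) * (|B| + 1) := by gcongr
      _ = |A| / 2 := by field_simp
  have hB' := le_abs_self B
  rcases lt_or_gt_of_ne hA with h0 | h0
  · have := h s (by rwa [abs_of_pos hs0])
    rw [abs_of_neg h0] at hs2 hA'
    nlinarith
  · have := h (-s) (by rwa [abs_neg, abs_of_pos hs0])
    rw [abs_of_pos h0] at hs2 hA'
    nlinarith

/-- The acceleration of the massless body along `γ`. -/
def force (m : Fin N → ℝ) (q : Fin N → ℝ → ℂ) (γ : ℝ → ℂ) (t : ℝ) : ℂ :=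
  -∑ i, (m i / ‖γ t - q i t‖ ^ 3) • (γ t - q i t)

/-- The first variation with an explicit quadratic remainder. An upper bound on the Lagrangian of
the competitor suffices, because the minimality inequality only uses one direction. -/
lemma lagReal_add_le (hm : ∀ i, 0 < m i) {γ φ : ℝ → ℂ} {t κ ε : ℝ} {v φ' : ℂ} (hκ : 0 < κ)
    (hγ : ∀ i, 2 * κ ≤ ‖γ t - q i t‖) (hv : HasDerivAt γ v t) (hφ : HasDerivAt φ φ' t)
    (hε : |ε| * ‖φ t‖ ≤ κ) :
    CollisionFreeAt q (fun t => γ t + ε * φ t) t ∧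
    lagReal m q (fun t => γ t + ε * φ t) t ≤ lagReal m q γ t +
      (ε * (inner ℝ v φ' + inner ℝ (force m q γ t) (φ t)) +
        ε ^ 2 * (‖φ'‖ ^ 2 / 2 + (∑ i, m i) * (‖φ t‖ ^ 2 / κ ^ 3))) := by
  have hn : ‖(ε : ℂ) * φ t‖ = |ε| * ‖φ t‖ := by
    rw [norm_mul, Complex.norm_real, Real.norm_eq_abs]
  refine ⟨fun i hi => ?_, ?_⟩
  · have h1 : γ t - q i t = -(ε * φ t) := by
      have : γ t + ε * φ t = q i t := hi
      rw [← this]; ring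
    have h2 := hγ i
    rw [h1, norm_neg, hn] at h2
    linarith
  · have hd : deriv (fun t => γ t + ε * φ t) t = v + ε * φ' := (hv.add (hφ.const_mul _)).deriv
    unfold lagReal
    rw [hd, hv.deriv]
    have e1 : ‖v + ε * φ'‖ ^ 2 = ‖v‖ ^ 2 + 2 * (ε * inner ℝ v φ') + ε ^ 2 * ‖φ'‖ ^ 2 := by
      rw [norm_add_sq_real, norm_mul, Complex.norm_real, Real.norm_eq_abs, mul_pow, sq_abs,
        ← Complex.real_smul, real_inner_smul_right]
    have e2 : ∑ i, m i / ‖γ t + ε * φ t - q i t‖ ≤ ∑ i, (m i / ‖γ t - q i t‖ +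
        (-(ε * (m i / ‖γ t - q i t‖ ^ 3 * inner ℝ (γ t - q i t) (φ t))) +
          m i * (ε ^ 2 * (‖φ t‖ ^ 2 / κ ^ 3)))) := by
      refine Finset.sum_le_sum fun i _ => ?_
      have := one_div_norm_add_le (y := ε * φ t) hκ (hγ i) (hn.le.trans hε)
      rw [hn, mul_pow, sq_abs, ← Complex.real_smul, real_inner_smul_right] at this
      have h3 := mul_le_mul_of_nonneg_left this (hm i).le
      have e : γ t + ε * φ t - q i t = γ t - q i t + ε • φ t := by rw [Complex.real_smul]; ring
      rw [e]
      calc m i / ‖γ t - q i t + ε • φ t‖ = m i * (1 / ‖γ t - q i t + ε • φ t‖) := by ring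
        _ ≤ _ := h3
        _ = _ := by ring
    have e3 : inner ℝ (force m q γ t) (φ t) =
        -∑ i, m i / ‖γ t - q i t‖ ^ 3 * inner ℝ (γ t - q i t) (φ t) := by
      rw [force, inner_neg_left, sum_inner]
      simp_rw [real_inner_smul_left]
    rw [Finset.sum_add_distrib, Finset.sum_add_distrib, Finset.sum_neg_distrib, ← Finset.mul_sum,
      ← Finset.sum_mul] at e2
    rw [e1, e3]
    nlinarith [e2]

/-- On an interval without collisions, a path which is minimal among the nearby ones solves the
equation of motion. -/
lemma solves_of_minimal (hm : ∀ i, 0 < m i) (hq : ∀ i, Continuous (q i)) {γ : ℝ → ℂ}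
    {c d κ ε : ℝ} (hcd : c < d) (hγ : IsH1Path γ c d) (hfin : lagInt m q γ c d ≠ ⊤)
    (hκ : 0 < κ) (hγκ : ∀ t ∈ Icc c d, ∀ i, 2 * κ ≤ ‖γ t - q i t‖) (hε : 0 < ε)
    (hmin : ∀ η : ℝ → ℂ, IsH1Path η c d → η c = γ c → η d = γ d →
      h1Norm (fun t => η t - γ t) c d ≤ ε → lagInt m q γ c d ≤ lagInt m q η c d) :
    ∀ t ∈ Ioo c d, SolvesRestrictedAt m q γ t := by
  have hFc : ContinuousOn (force m q γ) (Icc c d) := by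
    unfold force
    refine ContinuousOn.neg (continuousOn_finsetSum _ fun i _ => ?_)
    have h1 : ContinuousOn (fun t => γ t - q i t) (Icc c d) :=
      hγ.continuousOn.sub (hq i).continuousOn
    refine ContinuousOn.smul (continuousOn_const.div (h1.norm.pow 3) fun t ht => ?_) h1
    have := hγκ t ht i
    have : 0 < ‖γ t - q i t‖ := by linarith
    exact (pow_pos this 3).ne'
  -- Extending the force continuously makes its primitives differentiable everywhere, including at
  -- the ends of the interval.
  set F : ℝ → ℂ := IccExtend hcd.le ((Icc c d).domRestrict (force m q γ)) with hFdef
  have hF : Continuous F := (continuousOn_iff_continuous_domRestrict.1 hFc).Icc_extend'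
  have hFe : ∀ t ∈ Icc c d, F t = force m q γ t := fun t ht => by
    rw [hFdef, IccExtend_of_mem _ _ ht]; rfl
  set Φ : ℝ → ℂ := fun t => ∫ x in c..t, F x with hΦ
  have hΦd : ∀ t, HasDerivAt Φ (F t) t := fun t => hF.integral_hasStrictDerivAt c t |>.hasDerivAt
  have hΦc : Continuous Φ := continuous_iff_continuousAt.2 fun t => (hΦd t).continuousAt
  set P : ℝ → ℂ := fun t => ∫ x in c..t, Φ x with hP
  have hPd : ∀ t, HasDerivAt P (Φ t) t := fun t => hΦc.integral_hasStrictDerivAt c t |>.hasDerivAt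
  have hΦH : IsH1Path Φ c d := isH1Path_of_hasDerivAt hcd.le (fun t _ => hΦd t) hF.continuousOn
  -- The slope for which the second primitive `R` of the force agrees with `γ` at `d` as well as at
  -- `c`. The test function `φ` is the difference `γ - R`; the aim is to show that it vanishes.
  set k : ℂ := (γ d - γ c - P d) / (d - c) with hk
  set R : ℝ → ℂ := fun t => γ c + P t + k * (t - c) with hR
  have hRd : ∀ t, HasDerivAt R (Φ t + k) t := fun t => by
    have h1 : HasDerivAt (fun t : ℝ => ((t : ℂ) - c)) 1 t :=
      (Complex.ofRealCLM.hasDerivAt (x := t)).sub_const _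
    have := ((hPd t).const_add (γ c)).add (h1.const_mul k)
    rwa [mul_one] at this
  have hRH : IsH1Path R c d := isH1Path_of_hasDerivAt hcd.le (fun t _ => hRd t)
    (hΦc.add continuous_const).continuousOn
  set φ : ℝ → ℂ := fun t => γ t - R t with hφ
  have hφH : IsH1Path φ c d := hγ.sub hRH
  have hφc : φ c = 0 := by simp [hφ, hR, hP]
  have hφd : φ d = 0 := by
    have : (d : ℂ) - c ≠ 0 := by
      rw [← Complex.ofReal_sub]; exact_mod_cast (sub_pos.2 hcd).ne'
    simp only [hφ, hR, hk]
    field_simp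
    ring
  have hφ' : ∀ᵐ t, t ∈ Icc c d → deriv φ t = deriv γ t - Φ t - k := by
    filter_upwards [hγ.ae_hasDerivAt] with t h1 ht
    rw [((h1 ht).fun_sub (hRd t)).deriv]; ring
  obtain ⟨D, hD⟩ := isCompact_Icc.exists_bound_of_continuousOn hφH.continuousOn
  have hD' : 0 < max D 1 := lt_max_of_lt_right one_pos
  have hn : 0 ≤ h1Norm φ c d := Real.sqrt_nonneg _
  set A : ℝ → ℝ := fun t => inner ℝ (deriv γ t) (deriv φ t) + inner ℝ (F t) (φ t) with hA
  set B : ℝ → ℝ := fun t => ‖deriv φ t‖ ^ 2 / 2 + (∑ i, m i) * (‖φ t‖ ^ 2 / κ ^ 3) with hB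
  have hFφ : IntegrableOn (fun t => inner ℝ (F t) (φ t)) (Icc c d) :=
    (hF.continuousOn.inner hφH.continuousOn).integrableOn_Icc (μ := volume)
  have hAi : IntegrableOn A (Icc c d) := (hγ.integrableOn_inner hφH).add hFφ
  have hBi : IntegrableOn B (Icc c d) := by
    refine (hφH.integrable_sq.div_const 2).add (Integrable.const_mul ?_ _)
    exact (((hφH.continuousOn.norm.pow 2).div_const _).integrableOn_Icc)
  -- The perturbation `e φ` is admissible for small `e` of either sign, so the first variation in
  -- the direction `φ` vanishes.
  have hA0 : ∫ t in Icc c d, A t = 0 := by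
    refine eq_zero_of_forall_small (B := ∫ t in Icc c d, B t)
      (δ := min (κ / max D 1) (ε / (h1Norm φ c d + 1))) (lt_min (by positivity) (by positivity))
      fun e he => ?_
    have he1 : |e| * max D 1 ≤ κ := by
      rw [← le_div_iff₀ hD']; exact he.trans (min_le_left _ _)
    have he2 : |e| * (h1Norm φ c d + 1) ≤ ε := by
      rw [← le_div_iff₀ (by positivity)]; exact he.trans (min_le_right _ _)
    have hle := hmin (fun t => γ t + e * φ t) (hγ.add (hφH.const_mul _)) (by simp [hφc])
      (by simp [hφd]) (by
        have h1 : h1Norm (fun t => γ t + e * φ t - γ t) c d = |e| * h1Norm φ c d := by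
          unfold h1Norm
          rw [← Real.sqrt_sq_eq_abs, ← Real.sqrt_mul (sq_nonneg _), ← integral_const_mul]
          congr 2
          ext t
          simp only [add_sub_cancel_left]
          rw [deriv_const_mul_field, norm_mul, norm_mul, Complex.norm_real, Real.norm_eq_abs,
            mul_pow, mul_pow, sq_abs]
          ring
        rw [h1]
        nlinarith [abs_nonneg e])
    have hG : IntegrableOn (fun t => e * A t + e ^ 2 * B t) (Icc c d) := by
      have := (hAi.const_mul e).add (hBi.const_mul (e ^ 2))
      exact this
    have := integral_nonneg_of_lagInt_le hm hq hγ.continuousOn hfin hle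
      hG (by
        filter_upwards [hγ.ae_hasDerivAt, hφH.ae_hasDerivAt] with t h1 h2 ht _
        simp only [hA, hB, hFe t ht]
        refine lagReal_add_le hm hκ (hγκ t ht) (h1 ht) (h2 ht) (le_trans ?_ he1)
        gcongr
        exact (hD t ht).trans (le_max_left _ _))
    rwa [integral_add (hAi.const_mul _) (hBi.const_mul _), integral_const_mul,
      integral_const_mul] at this
  have hparts := IsH1Path.integral_inner_deriv hcd.le hΦH hφH
  rw [hφc, hφd, inner_zero_right, inner_zero_right, sub_zero] at hparts
  have hkint : ∫ t in Icc c d, inner ℝ k (deriv φ t) = 0 := by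
    rw [integral_inner (hφH.2.integrable (by norm_num)) k, integral_Icc_eq_integral_Ioc,
      ← intervalIntegral.integral_of_le hcd.le, hφH.integral_deriv hcd.le, hφc, hφd, sub_zero,
      inner_zero_right]
  have hΦφ : IntegrableOn (fun t => inner ℝ (deriv Φ t) (φ t) + inner ℝ (Φ t) (deriv φ t))
      (Icc c d) := by
    refine IntegrableOn.add ?_ ?_
    · refine hFφ.congr_fun (fun t _ => ?_) measurableSet_Icc
      simp only [(hΦd t).deriv]
    · refine integrableOn_inner_of_memLp ?_ hφH.2
      have : ContinuousOn Φ (Icc c d) := hΦc.continuousOn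
      refine (memLp_two_iff_integrable_sq_norm hΦc.aestronglyMeasurable).2 ?_
      exact (this.norm.pow 2).integrableOn_Icc
  have hki : IntegrableOn (fun t => inner ℝ k (deriv φ t)) (Icc c d) :=
    (hφH.2.integrable (by norm_num)).const_inner k
  -- Expanding one factor as γ' - Φ - k leaves the first variation, a total derivative and a
  -- constant paired with φ'. The last two integrate to zero because φ vanishes at both ends.
  have hsq : ∫ t in Icc c d, ‖deriv φ t‖ ^ 2 = 0 := by
    have h1 : ∫ t in Icc c d, ‖deriv φ t‖ ^ 2 = ∫ t in Icc c d, (A t -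
        (inner ℝ (deriv Φ t) (φ t) + inner ℝ (Φ t) (deriv φ t)) - inner ℝ k (deriv φ t)) := by
      refine setIntegral_congr_ae measurableSet_Icc ?_
      filter_upwards [hφ'] with t h1 ht
      simp only [hA]
      rw [(hΦd t).deriv, ← real_inner_self_eq_norm_sq]
      nth_rewrite 1 [h1 ht]
      rw [inner_sub_left, inner_sub_left]
      ring
    rw [h1, integral_sub (f := fun t => A t - (inner ℝ (deriv Φ t) (φ t) +
      inner ℝ (Φ t) (deriv φ t))) (hAi.sub hΦφ) hki, integral_sub hAi hΦφ, hA0, hparts, hkint]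
    ring
  have hφ0 : ∀ᵐ t, t ∈ Icc c d → deriv φ t = 0 := by
    have h1 := (integral_eq_zero_iff_of_nonneg (fun t => sq_nonneg _) hφH.integrable_sq).1 hsq
    rw [EventuallyEq, ae_restrict_iff' measurableSet_Icc] at h1
    filter_upwards [h1] with t h2 ht
    simpa using h2 ht
  have hγR : ∀ t ∈ Icc c d, γ t = R t := by
    intro t ht
    have h1 := hφH.eq_add_integral ht
    rw [intervalIntegral.integral_of_le ht.1, setIntegral_congr_ae measurableSet_Ioc
      (g := fun _ => (0 : ℂ)) (by
        filter_upwards [hφ0] with x h2 hx using h2 ⟨hx.1.le, hx.2.trans ht.2⟩), hφc] at h1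
    simp only [integral_zero, add_zero] at h1
    exact sub_eq_zero.1 h1
  have hev : ∀ t ∈ Ioo c d, γ =ᶠ[𝓝 t] R := fun t ht => by
    filter_upwards [Icc_mem_nhds ht.1 ht.2] with x hx using hγR x hx
  have hd1 : ∀ t ∈ Ioo c d, HasDerivAt γ (Φ t + k) t := fun t ht =>
    (hRd t).congr_of_eventuallyEq (hev t ht)
  intro t ht
  refine ⟨(hd1 t ht).differentiableAt, ?_⟩
  have h2 : deriv γ =ᶠ[𝓝 t] fun t => Φ t + k := by
    filter_upwards [Ioo_mem_nhds ht.1 ht.2] with x hx using (hd1 x hx).deriv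
  have h3 := ((hΦd t).add_const k).congr_of_eventuallyEq h2
  rwa [hFe t (Ioo_subset_Icc_self ht)] at h3

/-- A local minimizer solves the equation of motion at the times without collision. -/
lemma IsFixedEndLocalMinimizer.solvesRestrictedAt (hm : ∀ i, 0 < m i)
    (hq : ∀ i, Continuous (q i)) {h a b : ℝ} {x y : ℂ} {γ : ℝ → ℂ}
    (hγ : IsFixedEndLocalMinimizer m q h a b x y γ) {t : ℝ} (ht : t ∈ Ioo a b)
    (hcf : CollisionFreeAt q γ t) : SolvesRestrictedAt m q γ t := by
  have hfin := hγ.lagInt_ne_top hq (ht.1.trans ht.2)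
  obtain ⟨ε, hε, hmin⟩ := hγ.localize hfin
  have hH := hγ.1.1
  have hct : ContinuousAt γ t := hH.continuousOn.continuousAt (Icc_mem_nhds ht.1 ht.2)
  obtain ⟨κ, hκ, hκ0⟩ : ∃ κ : ℝ, (∀ i, 2 * κ < ‖γ t - q i t‖) ∧ 0 < κ := by
    have h1 : ∀ᶠ κ : ℝ in 𝓝[>] 0, ∀ i, 2 * κ < ‖γ t - q i t‖ := by
      refine eventually_all.2 fun i => ?_
      have h2 : Tendsto (fun κ : ℝ => 2 * κ) (𝓝[>] 0) (𝓝 (2 * 0)) :=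
        ((continuous_const.mul continuous_id).tendsto 0).mono_left nhdsWithin_le_nhds
      refine h2.eventually_lt_const ?_
      rw [mul_zero]
      exact norm_pos_iff.2 (sub_ne_zero.2 (hcf i))
    exact (h1.and self_mem_nhdsWithin).exists
  have h3 : ∀ᶠ s in 𝓝 t, s ∈ Ioo a b ∧ ∀ i, 2 * κ < ‖γ s - q i s‖ := by
    have h4 : ∀ᶠ s in 𝓝 t, s ∈ Ioo a b := Ioo_mem_nhds ht.1 ht.2
    refine h4.and (eventually_all.2 fun i => ?_)
    exact (hct.sub (hq i).continuousAt).norm.eventually_const_lt (hκ i)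
  obtain ⟨r, hr, hball⟩ := Metric.eventually_nhds_iff_ball.1 h3
  have hsub : ∀ s ∈ Icc (t - r / 2) (t + r / 2), s ∈ Ioo a b ∧ ∀ i, 2 * κ < ‖γ s - q i s‖ := by
    intro s hs
    refine hball s ?_
    rw [Metric.mem_ball, Real.dist_eq, abs_lt]
    constructor <;> linarith [hs.1, hs.2]
  have hle : t - r / 2 ≤ t + r / 2 := by linarith
  have hac := (hsub _ (left_mem_Icc.2 hle)).1.1.le
  have hdb := (hsub _ (right_mem_Icc.2 hle)).1.2.le
  refine solves_of_minimal hm hq (c := t - r / 2) (d := t + r / 2) (by linarith)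
    (hH.mono hac hle hdb) ?_ hκ0 (fun s hs i => ((hsub s hs).2 i).le) hε
    (fun η h1 h2 h3 h4 => hmin _ _ hac hle hdb η h1 h2 h3 h4) t ⟨by linarith, by linarith⟩
  rw [lagInt_eq_add γ hac hdb] at hfin
  exact fun h => hfin (by rw [h, top_add])

/-! ### Local minimizers have no collisions -/

/-- Applied to f = |w| and g = w, it bounds the radial speed by the speed, also at zeros of w where
the norm happens to be differentiable. -/
lemma norm_deriv_le_of_eventually_le {E F : Type*} [NormedAddCommGroup E] [NormedSpace ℝ E]
    [NormedAddCommGroup F] [NormedSpace ℝ F] {f : ℝ → E} {g : ℝ → F} {f' : E} {g' : F} {t : ℝ}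
    (hf : HasDerivAt f f' t) (hg : HasDerivAt g g' t)
    (h : ∀ᶠ x in 𝓝 t, ‖f x - f t‖ ≤ ‖g x - g t‖) : ‖f'‖ ≤ ‖g'‖ := by
  refine le_of_tendsto_of_tendsto (hasDerivAt_iff_tendsto_slope.1 hf).norm
    (hasDerivAt_iff_tendsto_slope.1 hg).norm ?_
  filter_upwards [nhdsWithin_le_nhds h] with x hx
  simp only [slope, norm_smul, vsub_eq_sub]
  gcongr

/-- The difference of the two sides is `b - a` times the integral of the squared deviation of `f`
from its mean. -/
lemma sq_integral_le {f : ℝ → ℝ} {a b : ℝ} (hab : a < b) (hf : IntegrableOn f (Icc a b))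
    (hf2 : IntegrableOn (fun t => f t ^ 2) (Icc a b)) :
    (∫ t in Icc a b, f t) ^ 2 ≤ (b - a) * ∫ t in Icc a b, f t ^ 2 := by
  set c := (∫ t in Icc a b, f t) / (b - a) with hc
  have hba : 0 < b - a := sub_pos.2 hab
  have h1 : 0 ≤ ∫ t in Icc a b, (f t - c) ^ 2 := integral_nonneg fun t => sq_nonneg _
  have h2 : ∫ t in Icc a b, (f t - c) ^ 2 =
      (∫ t in Icc a b, f t ^ 2) - (2 * c) * (∫ t in Icc a b, f t) + (b - a) * c ^ 2 := by
    have h3 : ∀ t, (f t - c) ^ 2 = f t ^ 2 - (2 * c) * f t + c ^ 2 := fun t => by ring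
    have h4 : IntegrableOn (fun t => f t ^ 2 - (2 * c) * f t) (Icc a b) := by
      have := hf2.sub (hf.const_mul (2 * c))
      exact this
    simp_rw [h3]
    rw [integral_add h4 (integrable_const _), integral_sub hf2 (hf.const_mul _),
      integral_const_mul]
    simp [hba.le]
  have h3 : (∫ t in Icc a b, f t) = (b - a) * c := by rw [hc]; field_simp
  rw [h3] at h2 ⊢
  nlinarith

lemma IsH1Path.sq_norm_sub_le {w : ℝ → ℂ} {a b : ℝ} (hab : a < b) (hw : IsH1Path w a b) :
    ‖w b - w a‖ ^ 2 ≤ (b - a) * ∫ t in Icc a b, ‖deriv w t‖ ^ 2 := by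
  refine le_trans ?_ (sq_integral_le hab (hw.2.integrable (by norm_num)).norm hw.integrable_sq)
  rw [← hw.integral_deriv hab.le, intervalIntegral.integral_of_le hab.le,
    ← integral_Icc_eq_integral_Ioc]
  gcongr
  exact norm_integral_le_integral_norm _

/-- The normalized sum bisects the two directions; when they are opposite, a perpendicular works.
This is the direction of the lift. -/
lemma exists_unit_inner_nonneg {u v : ℂ} (hu : ‖u‖ = 1) (hv : ‖v‖ = 1) :
    ∃ e : ℂ, ‖e‖ = 1 ∧ 0 ≤ inner ℝ u e ∧ 0 ≤ inner ℝ v e := by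
  by_cases h : u + v = 0
  · have hvu : v = -u := by linear_combination h
    have h1 : inner ℝ u (Complex.I * u) = 0 := by
      rw [inner_eq_re_im, Complex.mul_re, Complex.mul_im]; simp; ring
    refine ⟨Complex.I * u, by simp [hu], h1.ge, ?_⟩
    rw [hvu, inner_neg_left, h1, neg_zero]
  · have hn : 0 < ‖u + v‖ := norm_pos_iff.2 h
    have h1 := abs_le.1 (abs_real_inner_le_norm u v)
    rw [hu, hv, mul_one] at h1
    refine ⟨(‖u + v‖⁻¹ : ℝ) • (u + v), ?_, ?_, ?_⟩
    · rw [norm_smul, norm_inv, norm_norm, inv_mul_cancel₀ hn.ne']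
    · rw [real_inner_smul_right, inner_add_right, real_inner_self_eq_norm_sq, hu]
      exact mul_nonneg (by positivity) (by linarith)
    · rw [real_inner_smul_right, inner_add_right, real_inner_self_eq_norm_sq, hv,
        real_inner_comm]
      exact mul_nonneg (by positivity) (by linarith)

lemma exists_unit_mul_norm (z : ℂ) : ∃ σ : ℂ, ‖σ‖ = 1 ∧ (‖z‖ : ℂ) * σ = z := by
  by_cases h : z = 0
  · exact ⟨1, by simp, by simp [h]⟩
  · have hn : (‖z‖ : ℂ) ≠ 0 := by exact_mod_cast norm_ne_zero_iff.2 h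
    refine ⟨z / ‖z‖, ?_, by field_simp⟩
    rw [norm_div, Complex.norm_real, norm_norm, div_self (norm_ne_zero_iff.2 h)]

lemma IsH1Path.ae_hasDerivAt_norm {w : ℝ → ℂ} {a b : ℝ} (hw : IsH1Path w a b) :
    ∀ᵐ t, t ∈ Icc a b → HasDerivAt (fun t => ‖w t‖) (deriv (fun t => ‖w t‖) t) t ∧
      |deriv (fun t => ‖w t‖) t| ≤ ‖deriv w t‖ := by
  filter_upwards [hw.ae_hasDerivAt, ac_ae_hasDerivAt_real (ac_norm hw.1)] with t h1 h2 ht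
  have h3 := h2 (Icc_subset_uIcc ht)
  refine ⟨h3, norm_deriv_le_of_eventually_le h3 (h1 ht) (Eventually.of_forall fun x => ?_)⟩
  exact abs_norm_sub_norm_le _ _

lemma hasDerivAt_ofReal {f : ℝ → ℝ} {f' t : ℝ} (h : HasDerivAt f f' t) :
    HasDerivAt (fun t => (f t : ℂ)) (f' : ℂ) t :=
  Complex.ofRealCLM.hasFDerivAt.comp_hasDerivAt t h

lemma IsH1Path.norm {w : ℝ → ℂ} {a b : ℝ} (hw : IsH1Path w a b) :
    IsH1Path (fun t => (‖w t‖ : ℂ)) a b := by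
  refine ⟨ac_ofReal (ac_norm hw.1), hw.2.mono (stronglyMeasurable_deriv _).aestronglyMeasurable ?_⟩
  rw [ae_restrict_iff' measurableSet_Icc]
  filter_upwards [hw.ae_hasDerivAt_norm] with t h1 ht
  obtain ⟨h2, h3⟩ := h1 ht
  rwa [(hasDerivAt_ofReal h2).deriv, Complex.norm_real]

/-- Half of the comparison path: a radial motion in the direction `σ` with the same distance from
the origin as `w`, lifted in the direction `e` with the affine profile `φ`. -/
lemma isH1Path_lift {w : ℝ → ℂ} {a b : ℝ} (hab : a ≤ b) (hw : IsH1Path w a b) {σ e : ℂ}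
    (hσ : ‖σ‖ = 1) (he : ‖e‖ = 1) (x y : ℝ) :
    IsH1Path (fun t => ‖w t‖ * σ + ((x + y * t : ℝ) : ℂ) * e) a b ∧
    ∀ᵐ t, t ∈ Icc a b →
      HasDerivAt (fun t => ‖w t‖ * σ + ((x + y * t : ℝ) : ℂ) * e)
        (((deriv (fun t => ‖w t‖) t : ℝ) : ℂ) * σ + (y : ℂ) * e) t ∧
      ‖((deriv (fun t => ‖w t‖) t : ℝ) : ℂ) * σ + (y : ℂ) * e‖ ≤ ‖deriv w t‖ + |y| ∧
      ‖((deriv (fun t => ‖w t‖) t : ℝ) : ℂ) * σ + (y : ℂ) * e‖ ^ 2 / 2 ≤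
        ‖deriv w t‖ ^ 2 / 2 + y ^ 2 / 2 + y * inner ℝ σ e * deriv (fun t => ‖w t‖) t := by
  have hlin : ∀ t : ℝ, HasDerivAt (fun t => ((x + y * t : ℝ) : ℂ) * e) ((y : ℂ) * e) t := fun t => by
    have h1 : HasDerivAt (fun t : ℝ => x + y * t) y t := by
      simpa using ((hasDerivAt_id t).const_mul y).const_add x
    exact (hasDerivAt_ofReal h1).mul_const e
  have hr : ∀ z : ℝ, ‖(z : ℂ)‖ = |z| := fun z => by rw [Complex.norm_real, Real.norm_eq_abs]
  refine ⟨IsH1Path.add ?_ (isH1Path_of_hasDerivAt hab (fun t _ => hlin t) continuousOn_const), ?_⟩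
  · exact (hw.norm.const_mul σ).congr hab fun t _ => mul_comm _ _
  filter_upwards [hw.ae_hasDerivAt_norm] with t h1 ht
  obtain ⟨h2, h3⟩ := h1 ht
  refine ⟨((hasDerivAt_ofReal h2).mul_const σ).fun_add (hlin t), ?_, ?_⟩
  · refine (norm_add_le _ _).trans ?_
    rw [norm_mul, norm_mul, hσ, he, hr, hr]
    linarith
  · rw [← Complex.real_smul, ← Complex.real_smul, norm_add_sq_real, real_inner_smul_left,
      real_inner_smul_right, norm_smul, norm_smul, hσ, he, Real.norm_eq_abs, Real.norm_eq_abs,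
      mul_one, mul_one, sq_abs, sq_abs]
    have : deriv (fun t => ‖w t‖) t ^ 2 ≤ ‖deriv w t‖ ^ 2 := sq_le_sq' (by linarith [abs_le.1 h3])
      (abs_le.1 h3).2
    linarith

lemma IsH1Path.integral_deriv_norm {w : ℝ → ℂ} {a b : ℝ} (hab : a ≤ b) (hw : IsH1Path w a b) :
    IntegrableOn (deriv (fun t => ‖w t‖)) (Icc a b) ∧
      ∫ t in Icc a b, deriv (fun t => ‖w t‖) t = ‖w b‖ - ‖w a‖ := by
  have h1 := ac_norm hw.1
  refine ⟨(intervalIntegrable_iff_integrableOn_Icc_of_le hab).1 h1.intervalIntegrable_deriv, ?_⟩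
  rw [← h1.integral_deriv_eq_sub, intervalIntegral.integral_of_le hab,
    integral_Icc_eq_integral_Ioc]

/-- The norm of a lifted radial position. -/
lemma sq_norm_lift {σ e : ℂ} (hσ : ‖σ‖ = 1) (he : ‖e‖ = 1) (hσe : 0 ≤ inner ℝ σ e) {r z : ℝ}
    (hr : 0 ≤ r) (hz : 0 ≤ z) :
    r ^ 2 + z ^ 2 ≤ ‖(r : ℂ) * σ + (z : ℂ) * e‖ ^ 2 ∧ ‖(r : ℂ) * σ + (z : ℂ) * e‖ ≤ r + z := by
  rw [← Complex.real_smul, ← Complex.real_smul]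
  constructor
  · rw [norm_add_sq_real, real_inner_smul_left, real_inner_smul_right, norm_smul, norm_smul, hσ, he,
      Real.norm_of_nonneg hr, Real.norm_of_nonneg hz]
    have := mul_nonneg hr (mul_nonneg hz hσe)
    linarith
  · refine (norm_add_le _ _).trans ?_
    rw [norm_smul, norm_smul, hσ, he, Real.norm_of_nonneg hr, Real.norm_of_nonneg hz]
    linarith

/-- A path through the origin can be lifted off it at a kinetic cost `δ ^ 2 / s`. -/
lemma exists_lifted_path {w : ℝ → ℂ} {t₀ s δ : ℝ} (hs : 0 < s) (hδ : 0 < δ)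
    (hw : IsH1Path w (t₀ - s) (t₀ + s)) (h0 : w t₀ = 0) :
    ∃ u : ℝ → ℂ, IsH1Path u (t₀ - s) (t₀ + s) ∧ u (t₀ - s) = w (t₀ - s) ∧
      u (t₀ + s) = w (t₀ + s) ∧
      (∀ t ∈ Icc (t₀ - s) (t₀ + s),
        ‖w t‖ ^ 2 + (δ * (1 - |t - t₀| / s)) ^ 2 ≤ ‖u t‖ ^ 2 ∧ ‖u t‖ ≤ ‖w t‖ + δ) ∧
      ∃ J : ℝ → ℝ, IntegrableOn J (Icc (t₀ - s) (t₀ + s)) ∧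
        ∫ t in Icc (t₀ - s) (t₀ + s), J t ≤ 0 ∧
        ∀ᵐ t, t ∈ Icc (t₀ - s) (t₀ + s) → ‖deriv u t‖ ≤ ‖deriv w t‖ + δ / s ∧
          ‖deriv u t‖ ^ 2 / 2 ≤ ‖deriv w t‖ ^ 2 / 2 + (δ / s) ^ 2 / 2 + J t := by
  obtain ⟨σm, hσm, hwm⟩ := exists_unit_mul_norm (w (t₀ - s))
  obtain ⟨σp, hσp, hwp⟩ := exists_unit_mul_norm (w (t₀ + s))
  obtain ⟨e, he, hem, hep⟩ := exists_unit_inner_nonneg hσm hσp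
  have hl : t₀ - s ≤ t₀ := by linarith
  have hr : t₀ ≤ t₀ + s := by linarith
  have hδs : 0 < δ / s := by positivity
  have hwl := hw.mono le_rfl hl hr
  have hwr := hw.mono hl hr le_rfl
  set f : ℝ → ℂ := fun t => ‖w t‖ * σm + ((δ - δ / s * t₀ + δ / s * t : ℝ) : ℂ) * e with hf
  set g : ℝ → ℂ := fun t => ‖w t‖ * σp + ((δ + δ / s * t₀ + (-(δ / s)) * t : ℝ) : ℂ) * e with hg
  obtain ⟨hfH, hfd⟩ := isH1Path_lift hl hwl hσm he (δ - δ / s * t₀) (δ / s)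
  obtain ⟨hgH, hgd⟩ := isH1Path_lift hr hwr hσp he (δ + δ / s * t₀) (-(δ / s))
  -- The two halves fit at `t₀` because `w t₀ = 0` removes the radial parts and both profiles have
  -- height `δ` there.
  set u : ℝ → ℂ := fun t => if t ≤ t₀ then f t else g t with hu
  have hul : ∀ t ≤ t₀, u t = f t := fun t ht => if_pos ht
  have hur : ∀ t, t₀ ≤ t → u t = g t := fun t ht => by
    rcases ht.lt_or_eq with h | rfl
    · exact if_neg (not_le.2 h)
    · rw [hul _ le_rfl]
      simp only [hf, hg, h0, norm_zero]
      push_cast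
      ring
  have hder : ∀ t, t < t₀ → deriv u t = deriv f t := fun t ht => by
    refine EventuallyEq.deriv_eq ?_
    filter_upwards [Iio_mem_nhds ht] with x hx using hul x (le_of_lt hx)
  have hder' : ∀ t, t₀ < t → deriv u t = deriv g t := fun t ht => by
    refine EventuallyEq.deriv_eq ?_
    filter_upwards [Ioi_mem_nhds ht] with x hx using hur x (le_of_lt hx)
  set ρ' : ℝ → ℝ := deriv (fun t => ‖w t‖) with hρ'
  -- The cross term between radial velocity and lift. The lift rises while |w| goes from its end
  -- value to 0 and descends while it goes back, so both halves contribute a nonpositive integral.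
  set J : ℝ → ℝ := fun t => if t ≤ t₀ then δ / s * inner ℝ σm e * ρ' t
    else -(δ / s) * inner ℝ σp e * ρ' t with hJ
  obtain ⟨hli, hlint⟩ := hwl.integral_deriv_norm hl
  obtain ⟨hri, hrint⟩ := hwr.integral_deriv_norm hr
  have hJl : EqOn J (fun t => δ / s * inner ℝ σm e * ρ' t) (Icc (t₀ - s) t₀) :=
    fun t ht => if_pos ht.2
  have hJr : EqOn J (fun t => -(δ / s) * inner ℝ σp e * ρ' t) (Ioc t₀ (t₀ + s)) :=
    fun t ht => if_neg (not_le.2 ht.1)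
  have hJli : IntegrableOn J (Icc (t₀ - s) t₀) :=
    IntegrableOn.congr_fun (Integrable.const_mul hli _) hJl.symm measurableSet_Icc
  have hJri : IntegrableOn J (Ioc t₀ (t₀ + s)) :=
    IntegrableOn.congr_fun (Integrable.const_mul (hri.mono_set Ioc_subset_Icc_self) _) hJr.symm
      measurableSet_Ioc
  have hunion : Icc (t₀ - s) t₀ ∪ Ioc t₀ (t₀ + s) = Icc (t₀ - s) (t₀ + s) :=
    Icc_union_Ioc_eq_Icc hl hr
  refine ⟨u, ?_, ?_, ?_, fun t ht => ?_, J, ?_, ?_, ?_⟩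
  · exact (hfH.congr hl fun t ht => hul t ht.2).glue hl hr (hgH.congr hr fun t ht => hur t ht.1)
  · rw [hul _ hl]
    simp only [hf]
    rw [hwm, show δ - δ / s * t₀ + δ / s * (t₀ - s) = 0 by field_simp; ring]
    simp
  · rw [hur _ hr]
    simp only [hg]
    rw [hwp, show δ + δ / s * t₀ + -(δ / s) * (t₀ + s) = 0 by field_simp; ring]
    simp
  · have habs : |t - t₀| ≤ s := abs_le.2 ⟨by linarith [ht.1], by linarith [ht.2]⟩
    have h1 : |t - t₀| / s ≤ 1 := by rw [div_le_one hs]; exact habs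
    have h2 : 0 ≤ |t - t₀| / s := by positivity
    have h3 : 0 ≤ δ * (1 - |t - t₀| / s) := mul_nonneg hδ.le (by linarith)
    have h4 : δ * (1 - |t - t₀| / s) ≤ δ := by nlinarith
    rcases le_total t t₀ with h | h
    · have := sq_norm_lift hσm he hem (norm_nonneg (w t)) h3
      have h5 : u t = (‖w t‖ : ℂ) * σm + ((δ * (1 - |t - t₀| / s) : ℝ) : ℂ) * e := by
        rw [hul t h, abs_of_nonpos (by linarith)]
        simp only [hf]
        congr 3
        field_simp
        ring
      rw [h5]
      exact ⟨this.1, this.2.trans (by linarith)⟩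
    · have := sq_norm_lift hσp he hep (norm_nonneg (w t)) h3
      have h5 : u t = (‖w t‖ : ℂ) * σp + ((δ * (1 - |t - t₀| / s) : ℝ) : ℂ) * e := by
        rw [hur t h, abs_of_nonneg (by linarith)]
        simp only [hg]
        congr 3
        field_simp
        ring
      rw [h5]
      exact ⟨this.1, this.2.trans (by linarith)⟩
  · rw [← hunion]; exact hJli.union hJri
  · rw [← hunion, setIntegral_union (by
      rw [Set.disjoint_left]; intro x hx hx'; exact absurd hx.2 (not_le.2 hx'.1))
      measurableSet_Ioc hJli hJri, setIntegral_congr_fun measurableSet_Icc hJl,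
      setIntegral_congr_fun measurableSet_Ioc hJr, integral_const_mul, integral_const_mul,
      ← integral_Icc_eq_integral_Ioc, hlint, hrint, h0, norm_zero]
    have e1 := mul_nonneg (mul_nonneg hδs.le hem) (norm_nonneg (w (t₀ - s)))
    have e2 := mul_nonneg (mul_nonneg hδs.le hep) (norm_nonneg (w (t₀ + s)))
    linarith
  · have hne : ∀ᵐ x : ℝ, x ≠ t₀ := by simp [ae_iff, measure_singleton]
    filter_upwards [hfd, hgd, hne] with t h1 h2 h3 ht
    rcases lt_or_gt_of_ne h3 with h | h
    · obtain ⟨h4, h5, h6⟩ := h1 ⟨ht.1, h.le⟩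
      rw [hder t h, h4.deriv]
      rw [abs_of_pos hδs] at h5
      refine ⟨h5, ?_⟩
      rwa [hJl ⟨ht.1, h.le⟩]
    · obtain ⟨h4, h5, h6⟩ := h2 ⟨h.le, ht.2⟩
      rw [hder' t h, h4.deriv]
      rw [abs_neg, abs_of_pos hδs] at h5
      refine ⟨h5, ?_⟩
      rwa [hJr ⟨h, ht.2⟩, ← neg_sq (δ / s)]

-- Regularity of the motion of the primaries

namespace IsCollisionFreePeriodic

lemma hasDerivAt (hq : IsCollisionFreePeriodic m q) (i : Fin N) (t : ℝ) :
    HasDerivAt (q i) (deriv (q i) t) t := (hq.solves i t).1.hasDerivAt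

lemma continuous (hq : IsCollisionFreePeriodic m q) (i : Fin N) : Continuous (q i) :=
  continuous_iff_continuousAt.2 fun t => (hq.hasDerivAt i t).continuousAt

lemma continuous_deriv (hq : IsCollisionFreePeriodic m q) (i : Fin N) :
    Continuous (deriv (q i)) :=
  continuous_iff_continuousAt.2 fun t => (hq.solves i t).2.continuousAt

lemma isH1Path (hq : IsCollisionFreePeriodic m q) (i : Fin N) {a b : ℝ} (hab : a ≤ b) :
    IsH1Path (q i) a b :=
  isH1Path_of_hasDerivAt hab (fun t _ => hq.hasDerivAt i t) (hq.continuous_deriv i).continuousOn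

/-- The accelerations of the primaries are bounded. -/
lemma exists_acceleration_le (hq : IsCollisionFreePeriodic m q) (i : Fin N) :
    ∃ L : ℝ, 0 ≤ L ∧ ∀ t, ‖deriv (deriv (q i)) t‖ ≤ L := by
  obtain ⟨ρ, hρ, hsep⟩ := hq.separated
  refine ⟨∑ j ∈ Finset.univ.erase i, |m j| / ρ ^ 2, by positivity, fun t => ?_⟩
  rw [(hq.solves i t).2.deriv, norm_neg]
  refine (norm_sum_le _ _).trans (Finset.sum_le_sum fun j hj => ?_)
  have h1 := hsep t i j (Finset.ne_of_mem_erase hj).symm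
  have h2 : 0 < ‖q i t - q j t‖ := hρ.trans_le h1
  rw [norm_smul, norm_div, norm_pow, norm_norm, Real.norm_eq_abs]
  calc |m j| / ‖q i t - q j t‖ ^ 3 * ‖q i t - q j t‖ = |m j| / ‖q i t - q j t‖ ^ 2 := by
        field_simp
    _ ≤ _ := by gcongr

lemma exists_lipschitz_deriv (hq : IsCollisionFreePeriodic m q) (i : Fin N) :
    ∃ L : ℝ, 0 ≤ L ∧ ∀ t s, ‖deriv (q i) t - deriv (q i) s‖ ≤ L * |t - s| := by
  obtain ⟨L, hL, h⟩ := hq.exists_acceleration_le i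
  refine ⟨L, hL, fun t s => ?_⟩
  exact convex_univ.norm_image_sub_le_of_norm_deriv_le
    (fun x _ => (hq.solves i x).2.differentiableAt) (fun x _ => h x) (mem_univ s) (mem_univ t)

end IsCollisionFreePeriodic

-- Comparison of potentials near a primary, and the cost of a lift

lemma inv_norm_sub_le {x y : ℂ} {r : ℝ} (hr : 0 < r) (hx : r ≤ ‖x‖) (hy : r ≤ ‖y‖) :
    1 / ‖x‖ ≤ 1 / ‖y‖ + ‖x - y‖ / r ^ 2 := by
  have hx0 : 0 < ‖x‖ := hr.trans_le hx
  have hy0 : 0 < ‖y‖ := hr.trans_le hy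
  have h1 : 1 / ‖x‖ - 1 / ‖y‖ = (‖y‖ - ‖x‖) / (‖x‖ * ‖y‖) := by field_simp
  have h2 : (‖y‖ - ‖x‖) / (‖x‖ * ‖y‖) ≤ ‖x - y‖ / r ^ 2 := by
    have h3 : ‖y‖ - ‖x‖ ≤ ‖x - y‖ := by
      rw [norm_sub_rev]; exact norm_sub_norm_le _ _
    have h4 : r ^ 2 ≤ ‖x‖ * ‖y‖ := by rw [sq]; gcongr
    calc _ ≤ ‖x - y‖ / (‖x‖ * ‖y‖) := by gcongr
      _ ≤ _ := by gcongr
  linarith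

/-- Comparison of the potential at two positions near the primary `i`. -/
lemma sum_div_norm_le (hm : ∀ i, 0 < m i) {i : Fin N} {t ρ : ℝ} (hρ : 0 < ρ)
    (hsep : ∀ j, i ≠ j → ρ ≤ ‖q i t - q j t‖) {x y : ℂ} (hx : ‖x‖ ≤ ρ / 2) (hy : ‖y‖ ≤ ρ / 2) :
    (∀ j, i ≠ j → q i t + x ≠ q j t) ∧
    ∑ j, m j / ‖q i t + x - q j t‖ ≤ ∑ j, m j / ‖q i t + y - q j t‖ +
      (m i / ‖x‖ - m i / ‖y‖) + (∑ j, m j) * (4 / ρ ^ 2) * ‖x - y‖ := by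
  have far : ∀ z : ℂ, ‖z‖ ≤ ρ / 2 → ∀ j, i ≠ j → ρ / 2 ≤ ‖q i t + z - q j t‖ := by
    intro z hz j hj
    have h1 := norm_sub_norm_le (q i t - q j t) (-z)
    rw [norm_neg, sub_neg_eq_add, show q i t - q j t + z = q i t + z - q j t by ring] at h1
    linarith [hsep j hj]
  refine ⟨fun j hj h => ?_, ?_⟩
  · have := far x hx j hj
    rw [h, sub_self, norm_zero] at this
    linarith
  · rw [← Finset.add_sum_erase _ _ (Finset.mem_univ i), ← Finset.add_sum_erase (f := fun j =>
      m j / ‖q i t + y - q j t‖) _ (Finset.mem_univ i), add_sub_cancel_left, add_sub_cancel_left]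
    have h1 : ∑ j ∈ Finset.univ.erase i, m j / ‖q i t + x - q j t‖ ≤
        ∑ j ∈ Finset.univ.erase i, (m j / ‖q i t + y - q j t‖ + m j * ((4 / ρ ^ 2) * ‖x - y‖)) := by
      refine Finset.sum_le_sum fun j hj => ?_
      have hij := (Finset.ne_of_mem_erase hj).symm
      have h2 := inv_norm_sub_le (half_pos hρ) (far x hx j hij) (far y hy j hij)
      rw [show q i t + x - q j t - (q i t + y - q j t) = x - y by ring] at h2
      have h3 := mul_le_mul_of_nonneg_left h2 (hm j).le
      calc _ = m j * (1 / ‖q i t + x - q j t‖) := by ring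
        _ ≤ _ := h3
        _ = _ := by ring
    rw [Finset.sum_add_distrib, ← Finset.sum_mul] at h1
    have h4 : ∑ j ∈ Finset.univ.erase i, m j ≤ ∑ j, m j :=
      Finset.sum_le_sum_of_subset_of_nonneg (Finset.erase_subset _ _) fun j _ _ => (hm j).le
    have h5 := mul_le_mul_of_nonneg_right h4 (by positivity : 0 ≤ 4 / ρ ^ 2 * ‖x - y‖)
    linarith

/-- The gain in the potential when a position at distance `r ≤ δ / 2` is lifted by `δ / 2`. -/
lemma div_norm_gain {M r δ n φ : ℝ} (hM : 0 < M) (hr : 0 < r) (hn : 0 ≤ n) (hδ : 0 < δ)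
    (hφ : r ^ 2 + φ ^ 2 ≤ n ^ 2) :
    M / n - M / r ≤ 0 ∧ (r ≤ δ / 2 → δ / 2 ≤ φ → M / n - M / r ≤ -(M / (2 * δ))) := by
  have hrn : r ≤ n := by nlinarith [sq_nonneg φ]
  refine ⟨sub_nonpos.2 (by gcongr), fun h1 h2 => ?_⟩
  -- Here r ≤ δ/2 ≤ φ gives n² ≥ 2r², and (4/3)² < 2.
  have h3 : (4 / 3 : ℝ) * r ≤ n := by nlinarith
  have h4 : M / n ≤ M / (4 / 3 * r) := by gcongr
  have h5 : M / (4 / 3 * r) - M / r = -(M / (4 * r)) := by field_simp; ring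
  have h6 : M / (2 * δ) ≤ M / (4 * r) :=
    div_le_div_of_nonneg_left hM.le (by positivity) (by linarith)
  linarith

/-- The choice of the height of the lift. -/
lemma exists_lift_height {M C L : ℝ} (hM : 0 < M) (hC : 0 ≤ C) (hL : 0 ≤ L) :
    ∃ κ₀ : ℝ, 0 < κ₀ ∧ ∀ s K X : ℝ, 0 < s → s ≤ K → K ≤ κ₀ → 0 ≤ X → X ^ 2 = K * s →
      ∃ δ : ℝ, 0 < δ ∧ δ ≤ X ∧
        δ ^ 2 / s + L * s * (4 * X + 2 * δ) + 2 * s * (C * (2 * X + δ)) <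
          δ ^ 2 / (2 * K) * (M / (2 * δ)) := by
  set D := 6 * L + 6 * C + 1 with hD
  have hD0 : 0 < D := by positivity
  refine ⟨min 1 (min (M / (32 * D)) (M ^ 2 / (512 * D))), by positivity,
    fun s K X hs hsK hK hX0 hX => ?_⟩
  have hK0 : 0 < K := hs.trans_le hsK
  have hXp : 0 < X := by
    rcases hX0.lt_or_eq with h | h
    · exact h
    · rw [← h] at hX
      nlinarith [mul_pos hK0 hs]
  have hK1 : K ≤ 1 := hK.trans (min_le_left _ _)
  have hK2 : K * (32 * D) ≤ M := by
    have := hK.trans ((min_le_right _ _).trans (min_le_left _ _))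
    rwa [le_div_iff₀ (by positivity)] at this
  have hK3 : K * (512 * D) ≤ M ^ 2 := by
    have := hK.trans ((min_le_right _ _).trans (min_le_right _ _))
    rwa [le_div_iff₀ (by positivity)] at this
  have hsX : s ≤ X := by nlinarith
  -- With δ = κX and X² = Ks the cost δ²/s is κ²K and the gain is MκX/(4K). The second bound on κ
  -- makes the cost at most a quarter of the gain. The remaining terms are at most DsX, which `hκ3`
  -- and the bounds on `K` make at most an eighth of it.
  set κ := min 1 (M * X / (16 * K ^ 2)) with hκ
  have hκ0 : 0 < κ := lt_min one_pos (by positivity)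
  have hκ1 : κ ≤ 1 := min_le_left _ _
  have hκ2 : κ * (16 * K ^ 2) ≤ M * X := by
    have : κ ≤ M * X / (16 * K ^ 2) := min_le_right _ _
    rwa [le_div_iff₀ (by positivity)] at this
  have hκ3 : 32 * D * s * K ≤ M * κ := by
    rcases min_choice 1 (M * X / (16 * K ^ 2)) with h | h
    · rw [hκ, h]
      have : 32 * D * K * s ≤ 32 * D * K * 1 := by gcongr; linarith
      nlinarith
    · rw [hκ, h, mul_div_assoc', le_div_iff₀ (by positivity)]
      have h1 : 512 * D * K ^ 3 ≤ M ^ 2 := by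
        have : K ^ 3 ≤ K := by nlinarith [mul_pos hK0 hK0]
        calc 512 * D * K ^ 3 ≤ 512 * D * K := by gcongr
          _ ≤ M ^ 2 := by linarith
      calc 32 * D * s * K * (16 * K ^ 2) = s * (512 * D * K ^ 3) := by ring
        _ ≤ X * M ^ 2 := by gcongr
        _ = M * (M * X) := by ring
  refine ⟨κ * X, by positivity, by nlinarith, ?_⟩
  have e1 : (κ * X) ^ 2 / s = κ ^ 2 * K := by
    rw [mul_pow, hX]; field_simp
  have e2 : (κ * X) ^ 2 / (2 * K) * (M / (2 * (κ * X))) = M * κ * X / (4 * K) := by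
    field_simp; ring
  rw [e1, e2]
  have e3 : κ ^ 2 * K ≤ M * κ * X / (16 * K) := by
    rw [le_div_iff₀ (by positivity)]
    nlinarith
  have e4 : L * s * (4 * X + 2 * (κ * X)) + 2 * s * (C * (2 * X + κ * X)) ≤ D * s * X := by
    have h1 : κ * X ≤ X := by nlinarith
    have h2 : L * s * (4 * X + 2 * (κ * X)) ≤ L * s * (4 * X + 2 * X) := by gcongr
    have h3 : 2 * s * (C * (2 * X + κ * X)) ≤ 2 * s * (C * (2 * X + X)) := by gcongr
    have h4 : 0 ≤ s * X := by positivity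
    rw [hD]
    nlinarith
  have e5 : D * s * X ≤ M * κ * X / (32 * K) := by
    rw [le_div_iff₀ (by positivity)]
    calc D * s * X * (32 * K) = (32 * D * s * K) * X := by ring
      _ ≤ M * κ * X := by gcongr
  have e6 : 0 < M * κ * X / (32 * K) := by positivity
  have e7 : M * κ * X / (16 * K) = 2 * (M * κ * X / (32 * K)) := by field_simp; ring
  have e8 : M * κ * X / (4 * K) = 8 * (M * κ * X / (32 * K)) := by field_simp; ring
  rw [e7] at e3
  rw [e8]
  linarith

/-- Continuity of the primitive at `t₀`. It makes the kinetic energy near a collision as small as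
the lift requires. -/
lemma tendsto_setIntegral_shrink {f : ℝ → ℝ} {t₀ s₀ : ℝ} (hs₀ : 0 < s₀)
    (hf : IntegrableOn f (Icc (t₀ - s₀) (t₀ + s₀))) :
    Tendsto (fun s => ∫ t in Icc (t₀ - s) (t₀ + s), f t) (𝓝[>] 0) (𝓝 0) := by
  have hle : t₀ - s₀ ≤ t₀ + s₀ := by linarith
  set F : ℝ → ℝ := fun x => ∫ t in (t₀ - s₀)..x, f t with hF
  have hi : IntervalIntegrable f volume (t₀ - s₀) (t₀ + s₀) :=
    (intervalIntegrable_iff_integrableOn_Icc_of_le hle).2 hf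
  have hFc : ContinuousAt F t₀ := by
    have : ContinuousOn F (uIcc (t₀ - s₀) (t₀ + s₀)) :=
      intervalIntegral.continuousOn_primitive_interval (by rwa [uIcc_of_le hle])
    rw [uIcc_of_le hle] at this
    exact this.continuousAt (Icc_mem_nhds (by linarith) (by linarith))
  have h1 : Tendsto (fun s => F (t₀ + s) - F (t₀ - s)) (𝓝[>] 0) (𝓝 0) := by
    have e1 : Tendsto (fun s => t₀ + s) (𝓝[>] 0) (𝓝 t₀) := by
      have : Tendsto (fun s => t₀ + s) (𝓝 0) (𝓝 (t₀ + 0)) :=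
        (continuous_const.add continuous_id).tendsto 0
      rw [add_zero] at this
      exact this.mono_left nhdsWithin_le_nhds
    have e2 : Tendsto (fun s => t₀ - s) (𝓝[>] 0) (𝓝 t₀) := by
      have : Tendsto (fun s => t₀ - s) (𝓝 0) (𝓝 (t₀ - 0)) :=
        (continuous_const.sub continuous_id).tendsto 0
      rw [sub_zero] at this
      exact this.mono_left nhdsWithin_le_nhds
    have := (hFc.tendsto.comp e1).sub (hFc.tendsto.comp e2)
    rwa [sub_self] at this
  refine h1.congr' ?_
  filter_upwards [Ioc_mem_nhdsGT hs₀] with s hs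
  obtain ⟨h0, h2⟩ := hs
  rw [integral_Icc_eq_integral_Ioc, ← intervalIntegral.integral_of_le (by linarith)]
  refine intervalIntegral.integral_interval_sub_left (hi.mono_set ?_) (hi.mono_set ?_)
  · rw [uIcc_of_le hle, uIcc_of_le (by linarith)]
    exact Icc_subset_Icc le_rfl (by linarith)
  · rw [uIcc_of_le hle, uIcc_of_le (by linarith)]
    exact Icc_subset_Icc le_rfl (by linarith)

/-- Hölder continuity of a Sobolev path at a zero. -/
lemma IsH1Path.sq_norm_le_of_zero {w : ℝ → ℂ} {t₀ s : ℝ}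
    (hw : IsH1Path w (t₀ - s) (t₀ + s)) (h0 : w t₀ = 0) {t : ℝ}
    (ht : t ∈ Icc (t₀ - s) (t₀ + s)) :
    ‖w t‖ ^ 2 ≤ |t - t₀| * ∫ x in Icc (t₀ - s) (t₀ + s), ‖deriv w x‖ ^ 2 := by
  have key : ∀ c d : ℝ, t₀ - s ≤ c → c < d → d ≤ t₀ + s → ‖w d - w c‖ ^ 2 ≤
      (d - c) * ∫ x in Icc (t₀ - s) (t₀ + s), ‖deriv w x‖ ^ 2 := by
    intro c d hc hcd hd
    refine ((hw.mono hc hcd.le hd).sq_norm_sub_le hcd).trans ?_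
    refine mul_le_mul_of_nonneg_left ?_ (by linarith)
    exact setIntegral_mono_set hw.integrable_sq (Eventually.of_forall fun x => sq_nonneg _)
      (Icc_subset_Icc hc hd).eventuallyLE
  rcases lt_trichotomy t t₀ with h | rfl | h
  · have := key t t₀ ht.1 h (by linarith [ht.1, ht.2])
    rwa [h0, zero_sub, norm_neg, ← abs_of_pos (sub_pos.2 h), abs_sub_comm] at this
  · simp [h0]
  · have := key t₀ t (by linarith [ht.1, ht.2]) h ht.2
    rwa [h0, sub_zero, ← abs_of_pos (sub_pos.2 h)] at this

/-- The change of the Lagrangian when the position relative to the primary `i` is changed. -/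
lemma lagReal_add_primary_le (hm : ∀ i, 0 < m i) (hq : IsCollisionFreePeriodic m q) (i : Fin N)
    {γ u : ℝ → ℂ} {t ρ : ℝ} {γ' u' : ℂ} (hρ : 0 < ρ)
    (hsep : ∀ j, i ≠ j → ρ ≤ ‖q i t - q j t‖) (hγ : HasDerivAt γ γ' t) (hu : HasDerivAt u u' t)
    (hγρ : ‖γ t - q i t‖ ≤ ρ / 2) (huρ : ‖u t‖ ≤ ρ / 2) (hu0 : u t ≠ 0) :
    CollisionFreeAt q (fun t => q i t + u t) t ∧
    lagReal m q (fun t => q i t + u t) t ≤ lagReal m q γ t +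
      (‖u'‖ ^ 2 / 2 - ‖γ' - deriv (q i) t‖ ^ 2 / 2 +
        inner ℝ (deriv (q i) t) (u' - (γ' - deriv (q i) t)) +
        (m i / ‖u t‖ - m i / ‖γ t - q i t‖) +
        (∑ j, m j) * (4 / ρ ^ 2) * ‖u t - (γ t - q i t)‖) := by
  obtain ⟨h1, h2⟩ := sum_div_norm_le (q := q) hm hρ hsep huρ hγρ
  refine ⟨fun j => ?_, ?_⟩
  · by_cases hij : i = j
    · rw [← hij]
      intro h
      exact hu0 (by simpa using h)
    · exact h1 j hij
  · have e1 : deriv (fun t => q i t + u t) t = deriv (q i) t + u' :=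
      ((hq.hasDerivAt i t).fun_add hu).deriv
    have e2 : ‖deriv (q i) t + u'‖ ^ 2 = ‖deriv (q i) t + (γ' - deriv (q i) t)‖ ^ 2 +
        (‖u'‖ ^ 2 - ‖γ' - deriv (q i) t‖ ^ 2) +
        2 * inner ℝ (deriv (q i) t) (u' - (γ' - deriv (q i) t)) := by
      rw [norm_add_sq_real, norm_add_sq_real]; simp only [inner_sub_right]; ring
    have e3 : ∀ j, q i t + (γ t - q i t) - q j t = γ t - q j t := fun j => by ring
    simp only [e3] at h2
    unfold lagReal
    rw [e1, e2, hγ.deriv, add_sub_cancel]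
    linarith

set_option maxHeartbeats 1000000 in
/-- A path which is minimal among the nearby ones does not collide. -/
lemma ne_of_minimal (hm : ∀ i, 0 < m i) (hq : IsCollisionFreePeriodic m q) (i : Fin N)
    {γ : ℝ → ℂ} {t₀ s₀ ε : ℝ} (hs₀ : 0 < s₀) (hε : 0 < ε)
    (hγ : IsH1Path γ (t₀ - s₀) (t₀ + s₀)) (hfin : lagInt m q γ (t₀ - s₀) (t₀ + s₀) ≠ ⊤)
    (hmin : ∀ s, 0 < s → s ≤ s₀ → ∀ η : ℝ → ℂ, IsH1Path η (t₀ - s) (t₀ + s) →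
      η (t₀ - s) = γ (t₀ - s) → η (t₀ + s) = γ (t₀ + s) →
      h1Norm (fun t => η t - γ t) (t₀ - s) (t₀ + s) ≤ ε →
      lagInt m q γ (t₀ - s) (t₀ + s) ≤ lagInt m q η (t₀ - s) (t₀ + s)) :
    γ t₀ ≠ q i t₀ := by
  intro hcol
  obtain ⟨ρ, hρ, hsep⟩ := hq.separated
  obtain ⟨L, hL, hLip⟩ := hq.exists_lipschitz_deriv i
  set C : ℝ := (∑ j, m j) * (4 / ρ ^ 2) with hC
  have hC0 : 0 ≤ C := mul_nonneg (Finset.sum_nonneg fun j _ => (hm j).le) (by positivity)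
  obtain ⟨κ₀, hκ₀, hheight⟩ := exists_lift_height (hm i) hC0 hL
  set w₀ : ℝ → ℂ := fun t => γ t - q i t with hw₀
  have hw₀H : IsH1Path w₀ (t₀ - s₀) (t₀ + s₀) := hγ.sub (hq.isH1Path i (by linarith))
  have hw₀0 : w₀ t₀ = 0 := sub_eq_zero.2 hcol
  -- choice of the time scale
  have hKlim : Tendsto (fun s => (∫ t in Icc (t₀ - s) (t₀ + s), ‖deriv w₀ t‖ ^ 2) + s)
      (𝓝[>] 0) (𝓝 0) := by
    have := (tendsto_setIntegral_shrink hs₀ hw₀H.integrable_sq).add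
      (tendsto_id.mono_left (nhdsWithin_le_nhds (s := Ioi (0 : ℝ)) (a := 0)))
    rwa [add_zero] at this
  -- The bound `κ₀` serves the choice of the height. The bound (ρ/4)² keeps both relative positions
  -- within ρ/2 of the primary. The bound ε²/30 controls the H¹ distance, whose square turns out to
  -- be at most 18K + 8K + 4K. Adding `s` to the energy ensures K > 0 and s ≤ K.
  obtain ⟨s, hKs, hss₀⟩ := ((hKlim.eventually_lt_const (lt_min hκ₀ (lt_min one_pos
    (lt_min (by positivity : 0 < (ρ / 4) ^ 2) (by positivity : 0 < ε ^ 2 / 30))))).and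
    (Ioc_mem_nhdsGT hs₀)).exists
  obtain ⟨hs, hss₀⟩ := hss₀
  set I := Icc (t₀ - s) (t₀ + s) with hI
  have hlt : t₀ - s < t₀ + s := by linarith
  have hγs : IsH1Path γ (t₀ - s) (t₀ + s) := hγ.mono (by linarith) hlt.le (by linarith)
  have hw : IsH1Path w₀ (t₀ - s) (t₀ + s) := hw₀H.mono (by linarith) hlt.le (by linarith)
  have hfins : lagInt m q γ (t₀ - s) (t₀ + s) ≠ ⊤ := by
    rw [lagInt_eq_add (c := t₀ - s) (d := t₀ + s) γ (by linarith) (by linarith)] at hfin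
    exact fun h => hfin (by rw [h, top_add])
  set E := ∫ t in I, ‖deriv w₀ t‖ ^ 2 with hE
  have hE0 : 0 ≤ E := integral_nonneg fun t => sq_nonneg _
  set K := E + s with hK
  have hK1 : K ≤ κ₀ := hKs.le.trans (min_le_left _ _)
  have hK2 : K ≤ 1 := hKs.le.trans ((min_le_right _ _).trans (min_le_left _ _))
  have hK3 : K ≤ (ρ / 4) ^ 2 :=
    hKs.le.trans ((min_le_right _ _).trans ((min_le_right _ _).trans (min_le_left _ _)))
  have hK4 : K ≤ ε ^ 2 / 30 :=
    hKs.le.trans ((min_le_right _ _).trans ((min_le_right _ _).trans (min_le_right _ _)))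
  have hK0 : 0 < K := by linarith
  have hEK : E ≤ K := by linarith
  set X := Real.sqrt (K * s) with hX
  have hX0 : 0 ≤ X := Real.sqrt_nonneg _
  have hX2 : X ^ 2 = K * s := Real.sq_sqrt (by positivity)
  have hs1 : s ≤ 1 := by linarith
  have hXρ : X ≤ ρ / 4 := abs_le_of_sq_le_sq' (by
    rw [hX2]
    linarith [mul_le_mul_of_nonneg_left hs1 hK0.le]) (by positivity) |>.2
  obtain ⟨δ, hδ, hδX, hineq⟩ := hheight s K X hs (by linarith) hK1 hX0 hX2
  obtain ⟨u, huH, hul, hur, hun, J, hJi, hJint, hud⟩ := exists_lifted_path hs hδ hw hw₀0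
  -- the competitor
  set η : ℝ → ℂ := fun t => q i t + u t with hη
  have hηH : IsH1Path η (t₀ - s) (t₀ + s) := (hq.isH1Path i hlt.le).add huH
  set D : ℝ → ℂ := fun t => u t - w₀ t with hD
  have hDH : IsH1Path D (t₀ - s) (t₀ + s) := huH.sub hw
  have hDη : (fun t => η t - γ t) = D := by
    ext t; simp only [hη, hD, hw₀]; ring
  have hwX : ∀ t ∈ I, ‖w₀ t‖ ≤ X := by
    intro t ht
    refine abs_le_of_sq_le_sq' ?_ hX0 |>.2
    rw [hX2]
    have h1 : |t - t₀| ≤ s := abs_le.2 ⟨by linarith [ht.1], by linarith [ht.2]⟩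
    calc _ ≤ |t - t₀| * E := hw.sq_norm_le_of_zero hw₀0 ht
      _ ≤ s * K := by gcongr
      _ = K * s := mul_comm _ _
  have hDX : ∀ t ∈ I, ‖D t‖ ≤ 2 * X + δ := by
    intro t ht
    have h1 := norm_sub_le (u t) (w₀ t)
    linarith [hwX t ht, (hun t ht).2]
  have hD' : ∀ᵐ t, t ∈ I → deriv D t = deriv u t - deriv w₀ t ∧
      ‖deriv D t‖ ≤ 2 * ‖deriv w₀ t‖ + δ / s := by
    filter_upwards [huH.ae_hasDerivAt, hw.ae_hasDerivAt, hud] with t h1 h2 h3 ht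
    have h4 : deriv D t = deriv u t - deriv w₀ t := ((h1 ht).fun_sub (h2 ht)).deriv
    refine ⟨h4, ?_⟩
    rw [h4]
    have := norm_sub_le (deriv u t) (deriv w₀ t)
    linarith [(h3 ht).1]
  have hvol : volume.real I = 2 * s := by
    rw [hI, Real.volume_real_Icc_of_le hlt.le]; ring
  have hnorm : h1Norm (fun t => η t - γ t) (t₀ - s) (t₀ + s) ≤ ε := by
    rw [hDη]
    unfold h1Norm
    rw [Real.sqrt_le_left hε.le]
    have hint8 : IntegrableOn (fun t => 8 * ‖deriv w₀ t‖ ^ 2 + 2 * (δ / s) ^ 2) I := by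
      have := (hw.integrable_sq.const_mul 8).add (integrable_const (2 * (δ / s) ^ 2))
      exact this
    have hint : IntegrableOn (fun t => (2 * X + δ) ^ 2 + (8 * ‖deriv w₀ t‖ ^ 2 + 2 * (δ / s) ^ 2))
        I := by
      have := (integrable_const ((2 * X + δ) ^ 2)).add hint8
      exact this
    have h1 : ∫ t in I, (‖D t‖ ^ 2 + ‖deriv D t‖ ^ 2) ≤
        ∫ t in I, ((2 * X + δ) ^ 2 + (8 * ‖deriv w₀ t‖ ^ 2 + 2 * (δ / s) ^ 2)) := by
      refine integral_mono_of_nonneg (Eventually.of_forall fun t => by positivity) hint ?_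
      rw [EventuallyLE, ae_restrict_iff' measurableSet_Icc]
      filter_upwards [hD'] with t h2 ht
      have h3 := pow_le_pow_left₀ (norm_nonneg _) (hDX t ht) 2
      have h4 := pow_le_pow_left₀ (norm_nonneg _) (h2 ht).2 2
      linarith [sq_nonneg (2 * ‖deriv w₀ t‖ - δ / s)]
    have h2 : ∫ t in I, ((2 * X + δ) ^ 2 + (8 * ‖deriv w₀ t‖ ^ 2 + 2 * (δ / s) ^ 2)) =
        2 * s * (2 * X + δ) ^ 2 + (8 * E + 2 * s * (2 * (δ / s) ^ 2)) := by
      rw [integral_add (integrable_const _) hint8, integral_add (hw.integrable_sq.const_mul 8) (integrable_const _),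
        integral_const_mul, setIntegral_const, setIntegral_const, hvol, smul_eq_mul, smul_eq_mul]
    have h3 : (2 * X + δ) ^ 2 ≤ 9 * K * s := by
      calc (2 * X + δ) ^ 2 ≤ (2 * X + X) ^ 2 := by gcongr
        _ = 9 * X ^ 2 := by ring
        _ = _ := by rw [hX2]; ring
    have h4 : 2 * s * (2 * (δ / s) ^ 2) ≤ 4 * K := by
      have : 2 * s * (2 * (δ / s) ^ 2) = 4 * δ ^ 2 / s := by field_simp; ring
      rw [this, div_le_iff₀ hs]
      have : δ ^ 2 ≤ X ^ 2 := by gcongr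
      rw [hX2] at this
      linarith
    have h5 : 2 * s * (2 * X + δ) ^ 2 ≤ 2 * 1 * (9 * K * 1) := by
      calc 2 * s * (2 * X + δ) ^ 2 ≤ 2 * s * (9 * K * s) := by gcongr
        _ ≤ 2 * 1 * (9 * K * 1) := by gcongr
    rw [h2] at h1
    refine h1.trans ?_
    linarith
  have hle := hmin s hs hss₀ η hηH (by simp only [hη, hul, hw₀]; ring)
    (by simp only [hη, hur, hw₀]; ring) hnorm
  -- the change of the Lagrangian
  set μ := δ ^ 2 / (4 * K) with hμ
  have hμ0 : 0 < μ := by positivity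
  -- On |t - t₀| ≤ μ the Hölder bound gives |w|² ≤ μK = (δ/2)², while μ ≤ s/2 keeps the lift at
  -- height at least δ/2. There the gain in potential is at least m/(2δ).
  have hμs : μ ≤ s / 2 := by
    rw [hμ, div_le_iff₀ (by positivity)]
    have : δ ^ 2 ≤ X ^ 2 := by gcongr
    rw [hX2] at this
    linarith [mul_pos hK0 hs]
  set S := Icc (t₀ - μ) (t₀ + μ) with hS
  have hSI : S ⊆ I := Icc_subset_Icc (by linarith) (by linarith)
  set gain : ℝ → ℝ := S.indicator fun _ => m i / (2 * δ) with hgain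
  -- The term pairing the velocity of the primary with D' has first order. Freezing that velocity at
  -- `t₀` leaves a total derivative of a function vanishing at both ends, and the error is
  -- controlled by the Lipschitz constant `L` times `s`.
  set p₀ := deriv (q i) t₀ with hp₀
  set G₁ : ℝ → ℝ := fun t => (δ / s) ^ 2 / 2 + C * (2 * X + δ) + L * s * (δ / s) with hG₁
  set G₂ : ℝ → ℝ := fun t => L * s * (2 * ‖deriv w₀ t‖) with hG₂
  set G₃ : ℝ → ℝ := fun t => inner ℝ p₀ (deriv D t) with hG₃
  have hG₁i : IntegrableOn G₁ I := by
    simp only [hG₁]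
    exact integrable_const _
  have hw1 : IntegrableOn (fun t => ‖deriv w₀ t‖) I := (hw.2.integrable (by norm_num)).norm
  have hG₂i : IntegrableOn G₂ I := (hw1.const_mul 2).const_mul _
  have hG₃i : IntegrableOn G₃ I := (hDH.2.integrable (by norm_num)).const_inner p₀
  have hgi : IntegrableOn gain I := (integrable_const _).indicator measurableSet_Icc
  have hGi : IntegrableOn (fun t => G₁ t + G₂ t + G₃ t + J t - gain t) I := by
    have := (((hG₁i.add hG₂i).add hG₃i).add hJi).sub hgi
    exact this
  have hnn := integral_nonneg_of_lagInt_le hm hq.continuous hγs.continuousOn hfins hle hGi (by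
    filter_upwards [hud, hD', hw.ae_hasDerivAt, huH.ae_hasDerivAt] with t h1 h2 h3 h4 ht hcf
    obtain ⟨h5, h6⟩ := h1 ht
    obtain ⟨h7, h8⟩ := h2 ht
    have hu1 := hun t ht
    have hw0 : 0 < ‖w₀ t‖ := norm_pos_iff.2 (sub_ne_zero.2 (hcf i))
    have hu0 : u t ≠ 0 := by
      intro h
      have h9 := hu1.1
      rw [h, norm_zero] at h9
      linarith [pow_pos hw0 2, sq_nonneg (δ * (1 - |t - t₀| / s))]
    have hγd : HasDerivAt γ (deriv (q i) t + deriv w₀ t) t := by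
      refine ((hq.hasDerivAt i t).fun_add (h3 ht)).congr_of_eventuallyEq
        (Eventually.of_forall fun x => ?_)
      simp only [hw₀]; ring
    obtain ⟨h9, h10⟩ := lagReal_add_primary_le hm hq i hρ (hsep t i) hγd (h4 ht)
      (by linarith [hwX t ht]) (by linarith [hwX t ht, hu1.2]) hu0
    refine ⟨h9, h10.trans ?_⟩
    · rw [add_sub_cancel_left, ← h7]
      have hcross : inner ℝ (deriv (q i) t) (deriv D t) ≤ G₃ t + L * s * ‖deriv D t‖ := by
        have e1 : inner ℝ (deriv (q i) t) (deriv D t) = G₃ t +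
            inner ℝ (deriv (q i) t - p₀) (deriv D t) := by
          simp only [hG₃]; rw [inner_sub_left]; ring
        rw [e1]
        refine add_le_add le_rfl ((real_inner_le_norm _ _).trans ?_)
        gcongr
        refine (hLip t t₀).trans ?_
        gcongr
        exact abs_le.2 ⟨by linarith [ht.1], by linarith [ht.2]⟩
      have hDb : L * s * ‖deriv D t‖ ≤ G₂ t + L * s * (δ / s) := by
        simp only [hG₂]
        rw [← mul_add]
        gcongr
      have hpot : m i / ‖u t‖ - m i / ‖w₀ t‖ ≤ -gain t := by
        obtain ⟨e1, e2⟩ := div_norm_gain (hm i) hw0 (norm_nonneg (u t)) hδ hu1.1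
        by_cases htS : t ∈ S
        · rw [hgain, indicator_of_mem htS]
          have hta : |t - t₀| ≤ μ := abs_le.2 ⟨by linarith [htS.1], by linarith [htS.2]⟩
          refine e2 (abs_le_of_sq_le_sq' ?_ (by positivity)).2 ?_
          · calc _ ≤ |t - t₀| * E := hw.sq_norm_le_of_zero hw₀0 ht
              _ ≤ μ * K := by gcongr
              _ = (δ / 2) ^ 2 := by rw [hμ]; field_simp; norm_num
          · have : |t - t₀| / s ≤ 1 / 2 := by
              rw [div_le_iff₀ hs]; linarith
            linarith [mul_le_mul_of_nonneg_left this hδ.le]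
        · rw [hgain, indicator_of_notMem htS, neg_zero]
          exact e1
      have hDt : C * ‖u t - w₀ t‖ ≤ C * (2 * X + δ) := by
        gcongr
        exact hDX t ht
      change C * ‖u t - (γ t - q i t)‖ ≤ _ at hDt
      change m i / ‖u t‖ - m i / ‖γ t - q i t‖ ≤ _ at hpot
      simp only [hG₁]
      linarith)
  have hG₃int : ∫ t in I, G₃ t = 0 := by
    simp only [hG₃]
    rw [integral_inner (hDH.2.integrable (by norm_num)) p₀, integral_Icc_eq_integral_Ioc,
      ← intervalIntegral.integral_of_le hlt.le, hDH.integral_deriv hlt.le]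
    simp only [hD, hul, hur, sub_self, inner_zero_right]
  have hgint : ∫ t in I, gain t = δ ^ 2 / (2 * K) * (m i / (2 * δ)) := by
    rw [hgain, setIntegral_indicator measurableSet_Icc, inter_eq_right.2 hSI, setIntegral_const,
      smul_eq_mul, hS, Real.volume_real_Icc_of_le (by linarith), hμ]
    congr 1
    field_simp
    ring
  have hw1int : ∫ t in I, ‖deriv w₀ t‖ ≤ 2 * X := by
    refine abs_le_of_sq_le_sq' ?_ (by positivity) |>.2
    have h1 := sq_integral_le hlt hw1 hw.integrable_sq
    refine h1.trans ?_
    rw [mul_pow, hX2, show t₀ + s - (t₀ - s) = 2 * s by ring]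
    linarith [mul_le_mul_of_nonneg_left hEK hs.le, mul_pos hK0 hs]
  have hG₁int : ∫ t in I, G₁ t = 2 * s * ((δ / s) ^ 2 / 2 + C * (2 * X + δ) + L * s * (δ / s)) := by
    simp only [hG₁]
    rw [setIntegral_const, hvol, smul_eq_mul]
  have hG₂int : ∫ t in I, G₂ t ≤ L * s * (2 * (2 * X)) := by
    simp only [hG₂]
    rw [integral_const_mul, integral_const_mul]
    gcongr
  have hsplit : ∫ t in I, (G₁ t + G₂ t + G₃ t + J t - gain t) = (∫ t in I, G₁ t) +
      (∫ t in I, G₂ t) + (∫ t in I, G₃ t) + (∫ t in I, J t) - ∫ t in I, gain t := by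
    have i1 : IntegrableOn (fun t => G₁ t + G₂ t) I := by
      have := hG₁i.add hG₂i
      exact this
    have i2 : IntegrableOn (fun t => G₁ t + G₂ t + G₃ t) I := by
      have := i1.add hG₃i
      exact this
    have i3 : IntegrableOn (fun t => G₁ t + G₂ t + G₃ t + J t) I := by
      have := i2.add hJi
      exact this
    rw [integral_sub i3 hgi, integral_add i2 hJi, integral_add i1 hG₃i, integral_add hG₁i hG₂i]
  rw [hsplit, hG₁int, hG₃int, hgint] at hnn
  have e1 : 2 * s * ((δ / s) ^ 2 / 2 + C * (2 * X + δ) + L * s * (δ / s)) =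
      δ ^ 2 / s + 2 * s * (C * (2 * X + δ)) + L * s * (2 * δ) := by
    field_simp
  rw [e1] at hnn
  linarith

/-- Local minimizers are collision-free solutions. -/
lemma IsFixedEndLocalMinimizer.collisionFree_and_solves (hm : ∀ i, 0 < m i)
    (hq : IsCollisionFreePeriodic m q) {h a b : ℝ} {x y : ℂ} {γ : ℝ → ℂ}
    (hγ : IsFixedEndLocalMinimizer m q h a b x y γ) {t : ℝ} (ht : t ∈ Ioo a b) :
    CollisionFreeAt q γ t ∧ SolvesRestrictedAt m q γ t := by
  have hfin := hγ.lagInt_ne_top hq.continuous (ht.1.trans ht.2)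
  obtain ⟨ε, hε, hmin⟩ := hγ.localize hfin
  set s₀ := min (t - a) (b - t) with hs₀
  have hs₀0 : 0 < s₀ := lt_min (by linarith [ht.1]) (by linarith [ht.2])
  have h1 : s₀ ≤ t - a := min_le_left _ _
  have h2 : s₀ ≤ b - t := min_le_right _ _
  have hcf : CollisionFreeAt q γ t := fun i => by
    refine ne_of_minimal hm hq i hs₀0 hε
      (hγ.1.1.mono (by linarith) (by linarith) (by linarith)) ?_ fun s hs hss η h3 h4 h5 h6 =>
        hmin _ _ (by linarith) (by linarith) (by linarith) η h3 h4 h5 h6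
    rw [lagInt_eq_add (c := t - s₀) (d := t + s₀) γ (by linarith) (by linarith)] at hfin
    exact fun h => hfin (by rw [h, top_add])
  exact ⟨hcf, hγ.solvesRestrictedAt hm hq.continuous ht hcf⟩

/-! ### Asymptotics of an ejection -/

/-- `w` is an ejection from the origin at time `0` in a perturbed Kepler problem: it solves
`w'' = -M w / |w|³ + F` on `(0, τ)` with a bounded perturbation `F`, it tends to `0` as `t → 0`
and it has finite length. -/
structure IsEjection (M B τ : ℝ) (w v F : ℝ → ℂ) : Prop where
  mass_pos : 0 < M
  bound_nonneg : 0 ≤ B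
  time_pos : 0 < τ
  hasDerivAt : ∀ t ∈ Ioo 0 τ, HasDerivAt w (v t) t
  hasDerivAt_velocity : ∀ t ∈ Ioo 0 τ, HasDerivAt v (-((M / ‖w t‖ ^ 3) • w t) + F t) t
  norm_le : ∀ t ∈ Ioo 0 τ, ‖F t‖ ≤ B
  ne_zero : ∀ t ∈ Ioo 0 τ, w t ≠ 0
  tendsto_zero : Tendsto w (𝓝[>] 0) (𝓝 0)
  integrable : IntegrableOn (fun t => ‖v t‖) (Ioo 0 τ)

lemma hasDerivAt_inner {f g : ℝ → ℂ} {f' g' : ℂ} {t : ℝ} (hf : HasDerivAt f f' t)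
    (hg : HasDerivAt g g' t) :
    HasDerivAt (fun t => inner ℝ (f t) (g t)) (inner ℝ (f t) g' + inner ℝ f' (g t)) t :=
  hf.inner ℝ hg

/-- The two-dimensional cross product. -/
def cross (x y : ℂ) : ℝ := x.re * y.im - x.im * y.re

lemma hasDerivAt_cross {f g : ℝ → ℂ} {f' g' : ℂ} {t : ℝ} (hf : HasDerivAt f f' t)
    (hg : HasDerivAt g g' t) :
    HasDerivAt (fun t => cross (f t) (g t)) (cross f' (g t) + cross (f t) g') t := by
  have := ((hasDerivAt_re hf).fun_mul (hasDerivAt_im hg)).fun_sub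
    ((hasDerivAt_im hf).fun_mul (hasDerivAt_re hg))
  refine this.congr_deriv ?_
  simp only [cross]; ring

lemma sq_inner_add_sq_cross (x y : ℂ) :
    (inner ℝ x y) ^ 2 + cross x y ^ 2 = ‖x‖ ^ 2 * ‖y‖ ^ 2 := by
  rw [inner_eq_re_im, cross, ← Complex.normSq_eq_norm_sq, ← Complex.normSq_eq_norm_sq,
    Complex.normSq_apply, Complex.normSq_apply]
  ring

lemma abs_cross_le (x y : ℂ) : |cross x y| ≤ ‖x‖ * ‖y‖ := by
  refine abs_le_of_sq_le_sq ?_ (by positivity)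
  rw [mul_pow, ← sq_inner_add_sq_cross]
  linarith [sq_nonneg (inner ℝ x y)]

lemma cross_self (x : ℂ) : cross x x = 0 := by rw [cross]; ring

namespace IsEjection

variable {M B τ : ℝ} {w v F : ℝ → ℂ}

lemma norm_pos (h : IsEjection M B τ w v F) {t : ℝ} (ht : t ∈ Ioo 0 τ) : 0 < ‖w t‖ :=
  norm_pos_iff.2 (h.ne_zero t ht)

lemma eventually_mem (h : IsEjection M B τ w v F) : ∀ᶠ t in 𝓝[>] 0, t ∈ Ioo 0 τ :=
  Ioo_mem_nhdsGT h.time_pos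

lemma tendsto_norm (h : IsEjection M B τ w v F) : Tendsto (fun t => ‖w t‖) (𝓝[>] 0) (𝓝 0) := by
  simpa using h.tendsto_zero.norm

lemma hasDerivAt_sq_norm (h : IsEjection M B τ w v F) {t : ℝ} (ht : t ∈ Ioo 0 τ) :
    HasDerivAt (fun t => ‖w t‖ ^ 2) (2 * inner ℝ (w t) (v t)) t := by
  have h1 := hasDerivAt_inner (h.hasDerivAt t ht) (h.hasDerivAt t ht)
  simp only [real_inner_self_eq_norm_sq] at h1
  refine h1.congr_deriv ?_
  rw [real_inner_comm (w t) (v t)]; ring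

lemma hasDerivAt_norm (h : IsEjection M B τ w v F) {t : ℝ} (ht : t ∈ Ioo 0 τ) :
    HasDerivAt (fun t => ‖w t‖) (inner ℝ (w t) (v t) / ‖w t‖) t := by
  have h0 := h.norm_pos ht
  have h1 := (h.hasDerivAt_sq_norm ht).sqrt (by positivity)
  simp only [Real.sqrt_sq (norm_nonneg _)] at h1
  refine h1.congr_deriv ?_
  field_simp

/-- The energy is bounded. -/
lemma exists_energy_le (h : IsEjection M B τ w v F) :
    ∃ E₀ : ℝ, 0 ≤ E₀ ∧ ∃ τ', 0 < τ' ∧ τ' ≤ τ ∧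
      ∀ t ∈ Ioo 0 τ', |‖v t‖ ^ 2 / 2 - M / ‖w t‖| ≤ E₀ := by
  have hτ := h.time_pos
  set E : ℝ → ℝ := fun t => ‖v t‖ ^ 2 / 2 - M / ‖w t‖ with hE
  have hd : ∀ t ∈ Ioo 0 τ, HasDerivAt E (inner ℝ (v t) (F t)) t := by
    intro t ht
    have h0 := h.norm_pos ht
    have h1 := hasDerivAt_inner (h.hasDerivAt_velocity t ht) (h.hasDerivAt_velocity t ht)
    simp only [real_inner_self_eq_norm_sq] at h1
    have h2 := (h1.div_const 2).sub (((h.hasDerivAt_norm ht).inv h0.ne').const_mul M)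
    refine (h2.congr_of_eventuallyEq (Eventually.of_forall fun x => ?_)).congr_deriv ?_
    · simp only [hE, Pi.sub_apply, div_eq_mul_inv]
      rfl
    · rw [real_inner_comm (v t) (-((M / ‖w t‖ ^ 3) • w t) + F t), inner_add_right,
        inner_neg_right, real_inner_smul_right, real_inner_comm (w t) (v t)]
      field_simp
      ring
  set t₁ := τ / 2 with ht₁
  refine ⟨|E t₁| + B * ∫ t in Ioo 0 τ, ‖v t‖, ?_, t₁, by positivity, by linarith, fun t ht => ?_⟩
  · exact add_nonneg (abs_nonneg _) (mul_nonneg h.bound_nonneg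
      (integral_nonneg fun _ => norm_nonneg _))
  · have hsub : Icc t t₁ ⊆ Ioo 0 τ := fun x hx => ⟨ht.1.trans_le hx.1, by linarith [hx.2]⟩
    have hi : IntegrableOn (fun t => B * ‖v t‖) (Ioc t t₁) :=
      (h.integrable.mono_set (Ioc_subset_Icc_self.trans hsub)).const_mul B
    -- The energy changes only through the power ⟨v, F⟩, so its variation is at most `B` times the
    -- length of the path. Finite length is what keeps it bounded up to the collision.
    have h1 := norm_sub_le_integral_of_norm_deriv_le_of_le (f := E) (B := fun t => B * ‖v t‖)
      ht.2.le (fun x hx => (hd x (hsub hx)).continuousAt.continuousWithinAt)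
      (fun x hx => (hd x (hsub (Ioo_subset_Icc_self hx))).differentiableAt.differentiableWithinAt)
      (Eventually.of_forall fun x hx => by
        have hx' := hsub (Ioo_subset_Icc_self hx)
        rw [(hd x hx').deriv]
        refine (norm_inner_le_norm _ _).trans ?_
        rw [mul_comm]
        gcongr
        exact h.norm_le x hx')
      ((intervalIntegrable_iff_integrableOn_Ioc_of_le ht.2.le).2 hi)
    rw [intervalIntegral.integral_of_le ht.2.le, integral_const_mul] at h1
    have h2 : ∫ t in Ioc t t₁, ‖v t‖ ≤ ∫ t in Ioo 0 τ, ‖v t‖ :=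
      setIntegral_mono_set h.integrable (Eventually.of_forall fun x => norm_nonneg _)
        (Ioc_subset_Icc_self.trans hsub).eventuallyLE
    have h3 := mul_le_mul_of_nonneg_left h2 h.bound_nonneg
    have h4 : |E t| - |E t₁| ≤ ‖E t₁ - E t‖ := by
      rw [Real.norm_eq_abs, abs_sub_comm (E t₁) (E t)]; exact abs_sub_abs_le_abs_sub (E t) (E t₁)
    change |E t| ≤ _
    linarith

/-- The distance from the origin is increasing near the ejection. -/
lemma exists_inner_pos (h : IsEjection M B τ w v F) :
    ∃ τ', 0 < τ' ∧ τ' ≤ τ ∧ ∀ t ∈ Ioo 0 τ', 0 < inner ℝ (w t) (v t) := by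
  obtain ⟨E₀, hE₀, τ₁, hτ₁, hτ₁τ, hE⟩ := h.exists_energy_le
  have hM := h.mass_pos
  have hd : ∀ t ∈ Ioo 0 τ, HasDerivAt (fun t => inner ℝ (w t) (v t))
      (‖v t‖ ^ 2 - M / ‖w t‖ + inner ℝ (w t) (F t)) t := by
    intro t ht
    have h0 := h.norm_pos ht
    refine (hasDerivAt_inner (h.hasDerivAt t ht) (h.hasDerivAt_velocity t ht)).congr_deriv ?_
    rw [inner_add_right, inner_neg_right, real_inner_smul_right, real_inner_self_eq_norm_sq,
      real_inner_self_eq_norm_sq]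
    field_simp
    ring
  have hsmall : ∀ᶠ t in 𝓝[>] 0, ‖w t‖ < min 1 (M / (2 * E₀ + B + 1)) :=
    h.tendsto_norm.eventually_lt_const (lt_min one_pos (by have := h.bound_nonneg; positivity))
  obtain ⟨τ₂, hτ₂, hsm⟩ := mem_nhdsGT_iff_exists_Ioo_subset.1 hsmall
  have hτ₂0 : (0 : ℝ) < τ₂ := hτ₂
  set τ' := min τ₁ τ₂ with hτ'
  have hτ'0 : 0 < τ' := lt_min hτ₁ hτ₂0
  have hsub : Ioo 0 τ' ⊆ Ioo 0 τ := Ioo_subset_Ioo le_rfl ((min_le_left _ _).trans hτ₁τ)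
  -- The Lagrange-Jacobi identity: the first two terms are twice the energy plus M/|w|, and M/|w|
  -- dominates near the origin.
  have hpos : ∀ t ∈ Ioo 0 τ', 0 < ‖v t‖ ^ 2 - M / ‖w t‖ + inner ℝ (w t) (F t) := by
    intro t ht
    have h0 := h.norm_pos (hsub ht)
    have h1 := hE t ⟨ht.1, ht.2.trans_le (min_le_left _ _)⟩
    have h2 : ‖w t‖ < min 1 (M / (2 * E₀ + B + 1)) := hsm ⟨ht.1, ht.2.trans_le (min_le_right _ _)⟩
    have h3 : ‖w t‖ < 1 := h2.trans_le (min_le_left _ _)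
    have hB := h.bound_nonneg
    have h4 : 2 * E₀ + B + 1 < M / ‖w t‖ := by
      rw [lt_div_iff₀ h0]
      have := h2.trans_le (min_le_right _ _)
      rw [lt_div_iff₀ (by positivity)] at this
      linarith
    have h5 : -B ≤ inner ℝ (w t) (F t) := by
      have h6 := (abs_le.1 (abs_real_inner_le_norm (w t) (F t))).1
      have h7 : ‖w t‖ * ‖F t‖ ≤ 1 * B :=
        mul_le_mul h3.le (h.norm_le t (hsub ht)) (norm_nonneg _) zero_le_one
      linarith
    linarith [(abs_le.1 h1).1]
  have hmono : StrictMonoOn (fun t => inner ℝ (w t) (v t)) (Ioo 0 τ') := by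
    refine strictMonoOn_of_hasDerivWithinAt_pos (convex_Ioo 0 τ')
      (f' := fun t => ‖v t‖ ^ 2 - M / ‖w t‖ + inner ℝ (w t) (F t))
      (fun t ht => (hd t (hsub ht)).continuousAt.continuousWithinAt) ?_ ?_
    · intro t ht
      rw [interior_Ioo] at ht ⊢
      exact (hd t (hsub ht)).hasDerivWithinAt
    · intro t ht
      rw [interior_Ioo] at ht
      exact hpos t ht
  refine ⟨τ', hτ'0, (min_le_left _ _).trans hτ₁τ, fun t ht => ?_⟩
  -- Since ⟨w, v⟩ increases, a nonpositive value at `t` makes |w|² decrease on (0, t), which is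
  -- incompatible with |w| tending to 0 at time 0.
  by_contra hneg
  push Not at hneg
  have hsub' : Ioo 0 t ⊆ Ioo 0 τ' := Ioo_subset_Ioo le_rfl ht.2.le
  have hanti : StrictAntiOn (fun t => ‖w t‖ ^ 2) (Ioo 0 t) := by
    refine strictAntiOn_of_hasDerivWithinAt_neg (convex_Ioo 0 t)
      (f' := fun t => 2 * inner ℝ (w t) (v t))
      (fun x hx => (h.hasDerivAt_sq_norm (hsub (hsub' hx))).continuousAt.continuousWithinAt) ?_ ?_
    · intro x hx
      rw [interior_Ioo] at hx ⊢
      exact (h.hasDerivAt_sq_norm (hsub (hsub' hx))).hasDerivWithinAt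
    · intro x hx
      rw [interior_Ioo] at hx
      have : inner ℝ (w x) (v x) < inner ℝ (w t) (v t) := hmono (hsub' hx) ht hx.2
      linarith
  have ht0 : 0 < t := ht.1
  have hhalf : t / 2 ∈ Ioo 0 t := ⟨by linarith, by linarith⟩
  have hlim : Tendsto (fun t => ‖w t‖ ^ 2) (𝓝[>] 0) (𝓝 0) := by
    simpa using h.tendsto_norm.pow 2
  have hge : ‖w (t / 2)‖ ^ 2 ≤ 0 := by
    refine ge_of_tendsto hlim ?_
    filter_upwards [Ioo_mem_nhdsGT (show (0 : ℝ) < t / 2 by linarith)] with x hx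
    exact (hanti ⟨hx.1, by linarith [hx.2]⟩ hhalf hx.2).le
  have := h.norm_pos (hsub (hsub' hhalf))
  linarith [pow_pos this 2]

/-- The angular momentum is small. -/
lemma exists_cross_le (h : IsEjection M B τ w v F) :
    ∃ τ', 0 < τ' ∧ τ' ≤ τ ∧ ∀ t ∈ Ioo 0 τ', 0 < inner ℝ (w t) (v t) ∧
      |cross (w t) (v t)| ≤ B * ‖w t‖ * t := by
  obtain ⟨E₀, hE₀, τ₁, hτ₁, hτ₁τ, hE⟩ := h.exists_energy_le
  obtain ⟨τ₂, hτ₂, hτ₂τ, hpos⟩ := h.exists_inner_pos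
  have hM := h.mass_pos
  -- By bounded energy |w|²|v|² is at most 2E₀|w|² + 2M|w|, which tends to zero.
  have hlim : Tendsto (fun t => cross (w t) (v t)) (𝓝[>] 0) (𝓝 0) := by
    have h1 : Tendsto (fun t => 2 * E₀ * ‖w t‖ ^ 2 + 2 * M * ‖w t‖) (𝓝[>] 0) (𝓝 0) := by
      simpa using ((h.tendsto_norm.pow 2).const_mul (2 * E₀)).add
        (h.tendsto_norm.const_mul (2 * M))
    have h2 : Tendsto (fun t => cross (w t) (v t) ^ 2) (𝓝[>] 0) (𝓝 0) := by
      refine squeeze_zero' (Eventually.of_forall fun t => sq_nonneg _) ?_ h1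
      filter_upwards [Ioo_mem_nhdsGT hτ₁] with t ht
      have h0 := h.norm_pos ⟨ht.1, ht.2.trans_le hτ₁τ⟩
      have h3 := (abs_le.1 (hE t ht)).2
      have h4 : ‖w t‖ ^ 2 * ‖v t‖ ^ 2 ≤ ‖w t‖ ^ 2 * (2 * E₀ + 2 * (M / ‖w t‖)) := by
        gcongr; linarith
      have h5 : ‖w t‖ ^ 2 * (2 * E₀ + 2 * (M / ‖w t‖)) =
          2 * E₀ * ‖w t‖ ^ 2 + 2 * M * ‖w t‖ := by field_simp
      linarith [sq_inner_add_sq_cross (w t) (v t), sq_nonneg (inner ℝ (w t) (v t))]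
    have h3 := h2.sqrt
    simp only [Real.sqrt_sq_eq_abs, Real.sqrt_zero] at h3
    exact (tendsto_zero_iff_abs_tendsto_zero _).2 h3
  have hd : ∀ t ∈ Ioo 0 τ, HasDerivAt (fun t => cross (w t) (v t)) (cross (w t) (F t)) t := by
    intro t ht
    refine (hasDerivAt_cross (h.hasDerivAt t ht) (h.hasDerivAt_velocity t ht)).congr_deriv ?_
    rw [cross_self, zero_add]
    simp only [cross, Complex.add_re, Complex.add_im, Complex.neg_re, Complex.neg_im,
      Complex.smul_re, Complex.smul_im, smul_eq_mul]
    ring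
  have hsub : Ioo 0 τ₂ ⊆ Ioo 0 τ := Ioo_subset_Ioo le_rfl hτ₂τ
  have hmono : StrictMonoOn (fun t => ‖w t‖) (Ioo 0 τ₂) := by
    refine strictMonoOn_of_hasDerivWithinAt_pos (convex_Ioo 0 τ₂)
      (f' := fun t => inner ℝ (w t) (v t) / ‖w t‖)
      (fun t ht => (h.hasDerivAt_norm (hsub ht)).continuousAt.continuousWithinAt) ?_ ?_
    · intro t ht
      rw [interior_Ioo] at ht ⊢
      exact (h.hasDerivAt_norm (hsub ht)).hasDerivWithinAt
    · intro t ht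
      rw [interior_Ioo] at ht
      exact div_pos (hpos t ht) (h.norm_pos (hsub ht))
  refine ⟨τ₂, hτ₂, hτ₂τ, fun t ht => ⟨hpos t ht, ?_⟩⟩
  -- The central force exerts no torque, so the angular momentum has derivative at most B|w|, and
  -- |w| is increasing. The bound follows by integrating from `s` to `t` and letting `s` tend to 0.
  have hlim' : Tendsto (fun s => |cross (w t) (v t) - cross (w s) (v s)|) (𝓝[>] 0)
      (𝓝 |cross (w t) (v t) - 0|) := (tendsto_const_nhds.sub hlim).abs
  rw [sub_zero] at hlim'
  refine le_of_tendsto hlim' ?_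
  filter_upwards [Ioo_mem_nhdsGT ht.1] with s hs
  have hsub' : Icc s t ⊆ Ioo 0 τ₂ := fun x hx => ⟨hs.1.trans_le hx.1, hx.2.trans_lt ht.2⟩
  have h1 := (convex_Icc s t).norm_image_sub_le_of_norm_hasDerivWithin_le
    (f := fun t => cross (w t) (v t)) (f' := fun x => cross (w x) (F x)) (C := B * ‖w t‖)
    (fun x hx => (hd x (hsub (hsub' hx))).hasDerivWithinAt) (fun x hx => by
      refine (abs_cross_le _ _).trans ?_
      rw [mul_comm]
      have e1 : ‖w x‖ ≤ ‖w t‖ := hmono.monotoneOn (hsub' hx) ht hx.2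
      exact mul_le_mul (h.norm_le x (hsub (hsub' hx))) e1 (norm_nonneg _) h.bound_nonneg)
    (left_mem_Icc.2 hs.2.le) (right_mem_Icc.2 hs.2.le)
  rw [Real.norm_eq_abs, Real.norm_of_nonneg (by linarith [hs.2])] at h1
  refine h1.trans ?_
  have := mul_nonneg h.bound_nonneg (norm_nonneg (w t))
  gcongr
  linarith [hs.1]

/-- The distance from the origin is asymptotic to that of a parabolic ejection. -/
lemma tendsto_norm_div_rpow (h : IsEjection M B τ w v F) :
    Tendsto (fun t => ‖w t‖ / t ^ (2 / 3 : ℝ)) (𝓝[>] 0) (𝓝 ((9 * M / 2) ^ (1 / 3 : ℝ))) := by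
  obtain ⟨E₀, hE₀, τ₁, hτ₁, hτ₁τ, hE⟩ := h.exists_energy_le
  obtain ⟨τ₂, hτ₂, hτ₂τ, hcr⟩ := h.exists_cross_le
  have hM := h.mass_pos
  set f : ℝ → ℝ := fun t => ‖w t‖ ^ (3 / 2 : ℝ) with hf
  set f' : ℝ → ℝ := fun t =>
    (inner ℝ (w t) (v t) / ‖w t‖) * (3 / 2 : ℝ) * ‖w t‖ ^ ((3 / 2 : ℝ) - 1) with hf'
  have hsub : Ioo 0 τ₂ ⊆ Ioo 0 τ := Ioo_subset_Ioo le_rfl hτ₂τ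
  have hfd : ∀ t ∈ Ioo 0 τ₂, HasDerivAt f (f' t) t := fun t ht =>
    (h.hasDerivAt_norm (hsub ht)).rpow_const (Or.inl (h.norm_pos (hsub ht)).ne')
  -- The power 3/2 is linear in time for a radial parabolic ejection. In general the square of its
  -- derivative is 9M/2 plus an energy term and an angular momentum term, both of which vanish in
  -- the limit; L'Hôpital's rule then gives the asymptotics.
  have hf'sq : ∀ t ∈ Ioo 0 τ₂, f' t ^ 2 = 9 / 4 * (2 * (‖v t‖ ^ 2 / 2 - M / ‖w t‖) * ‖w t‖ +
      2 * M - cross (w t) (v t) ^ 2 / ‖w t‖) := by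
    intro t ht
    have h0 := h.norm_pos (hsub ht)
    have e1 : (‖w t‖ ^ ((3 / 2 : ℝ) - 1)) ^ 2 = ‖w t‖ := by
      rw [← Real.rpow_mul_natCast h0.le]; norm_num
    have e2 : inner ℝ (w t) (v t) ^ 2 = ‖w t‖ ^ 2 * ‖v t‖ ^ 2 - cross (w t) (v t) ^ 2 := by
      rw [← sq_inner_add_sq_cross]; ring
    simp only [hf']
    rw [mul_pow, mul_pow, e1, div_pow, e2]
    field_simp
    ring
  have hlimsq : Tendsto (fun t => f' t ^ 2) (𝓝[>] 0) (𝓝 (9 * M / 2)) := by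
    have l1 : Tendsto (fun t => 2 * (‖v t‖ ^ 2 / 2 - M / ‖w t‖) * ‖w t‖) (𝓝[>] 0) (𝓝 0) := by
      have : Tendsto (fun t => 2 * E₀ * ‖w t‖) (𝓝[>] 0) (𝓝 0) := by
        simpa using h.tendsto_norm.const_mul (2 * E₀)
      refine squeeze_zero_norm' ?_ this
      filter_upwards [Ioo_mem_nhdsGT hτ₁] with t ht
      rw [norm_mul, norm_mul, norm_norm, Real.norm_eq_abs (_ - _), Real.norm_of_nonneg zero_le_two]
      gcongr
      exact hE t ht
    have l2 : Tendsto (fun t => cross (w t) (v t) ^ 2 / ‖w t‖) (𝓝[>] 0) (𝓝 0) := by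
      have : Tendsto (fun t => B ^ 2 * ‖w t‖ * t ^ 2) (𝓝[>] 0) (𝓝 0) := by
        have e : Tendsto (fun t : ℝ => t) (𝓝[>] 0) (𝓝 0) := nhdsWithin_le_nhds
        simpa using (h.tendsto_norm.const_mul (B ^ 2)).mul (e.pow 2)
      refine squeeze_zero' (Eventually.of_forall fun t => by positivity) ?_ this
      filter_upwards [Ioo_mem_nhdsGT hτ₂] with t ht
      have h0 := h.norm_pos (hsub ht)
      rw [div_le_iff₀ h0, ← sq_abs]
      calc |cross (w t) (v t)| ^ 2 ≤ (B * ‖w t‖ * t) ^ 2 := by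
            gcongr; exact (hcr t ht).2
        _ = _ := by ring
    have l3 := ((l1.add_const (2 * M)).sub l2).const_mul (9 / 4)
    rw [show 9 / 4 * (0 + 2 * M - 0) = 9 * M / 2 by ring] at l3
    refine l3.congr' ?_
    filter_upwards [Ioo_mem_nhdsGT hτ₂] with t ht using (hf'sq t ht).symm
  have hlim' : Tendsto f' (𝓝[>] 0) (𝓝 (Real.sqrt (9 * M / 2))) := by
    refine hlimsq.sqrt.congr' ?_
    filter_upwards [Ioo_mem_nhdsGT hτ₂] with t ht
    refine Real.sqrt_sq ?_
    have h0 := h.norm_pos (hsub ht)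
    have := (hcr t ht).1
    simp only [hf']
    positivity
  have hf0 : Tendsto f (𝓝[>] 0) (𝓝 0) := by
    have := h.tendsto_norm.rpow_const (p := (3 / 2 : ℝ)) (Or.inr (by norm_num))
    rwa [Real.zero_rpow (by norm_num)] at this
  have hquot : Tendsto (fun t => f t / t) (𝓝[>] 0) (𝓝 (Real.sqrt (9 * M / 2))) := by
    refine HasDerivAt.lhopital_zero_right_on_Ioo hτ₂ hfd (g := fun t => t) (g' := fun _ => 1)
      (fun t _ => hasDerivAt_id t) (fun _ _ => one_ne_zero) hf0 nhdsWithin_le_nhds ?_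
    simpa using hlim'
  have hfin := hquot.rpow_const (p := (2 / 3 : ℝ)) (Or.inr (by norm_num))
  have e : Real.sqrt (9 * M / 2) ^ (2 / 3 : ℝ) = (9 * M / 2) ^ (1 / 3 : ℝ) := by
    rw [Real.sqrt_eq_rpow, ← Real.rpow_mul (by positivity)]; norm_num
  rw [e] at hfin
  refine hfin.congr' ?_
  filter_upwards [self_mem_nhdsWithin] with t ht
  have ht0 : (0 : ℝ) < t := ht
  simp only [hf]
  rw [Real.div_rpow (by positivity) ht0.le, ← Real.rpow_mul (norm_nonneg _)]
  norm_num

/-- The direction of an ejection has a limit. -/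
lemma exists_tendsto_direction (h : IsEjection M B τ w v F) :
    ∃ σ : ℂ, ‖σ‖ = 1 ∧ Tendsto (fun t => w t / (‖w t‖ : ℂ)) (𝓝[>] 0) (𝓝 σ) := by
  obtain ⟨τ₂, hτ₂, hτ₂τ, hcr⟩ := h.exists_cross_le
  have hM := h.mass_pos
  have hB := h.bound_nonneg
  have hlim := h.tendsto_norm_div_rpow
  set c := (9 * M / 2) ^ (1 / 3 : ℝ) with hc
  have hc0 : 0 < c := by positivity
  have hsub : Ioo 0 τ₂ ⊆ Ioo 0 τ := Ioo_subset_Ioo le_rfl hτ₂τ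
  -- The unit direction rotates at speed |cross(w, v)|/|w|², which the angular momentum bound turns
  -- into Bt/|w|.
  have hd : ∀ t ∈ Ioo 0 τ₂, ∃ u' : ℂ, HasDerivAt (fun t => w t / (‖w t‖ : ℂ)) u' t ∧
      ‖u'‖ ≤ B * t / ‖w t‖ := by
    intro t ht
    have h0 := h.norm_pos (hsub ht)
    have h0' : (‖w t‖ : ℂ) ≠ 0 := by exact_mod_cast h0.ne'
    have h1 := (h.hasDerivAt t (hsub ht)).fun_div (hasDerivAt_ofReal (h.hasDerivAt_norm (hsub ht))) h0'
    refine ⟨_, h1, ?_⟩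
    have e1 : (‖w t‖ : ℂ) ^ 2 * v t - (inner ℝ (w t) (v t) : ℝ) * w t =
        Complex.I * (cross (w t) (v t) : ℝ) * w t := by
      have : (‖w t‖ : ℂ) ^ 2 = ((w t).re * (w t).re + (w t).im * (w t).im : ℝ) := by
        rw [← Complex.normSq_apply, Complex.normSq_eq_norm_sq]; push_cast; ring
      rw [this, inner_eq_re_im, cross]
      apply Complex.ext <;> simp <;> ring
    have e2 : (v t * (‖w t‖ : ℂ) - w t * ((inner ℝ (w t) (v t) / ‖w t‖ : ℝ) : ℂ)) /
        (‖w t‖ : ℂ) ^ 2 = Complex.I * (cross (w t) (v t) : ℝ) * w t / (‖w t‖ : ℂ) ^ 3 := by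
      rw [← e1]
      push_cast
      field_simp
    rw [e2, norm_div, norm_mul, norm_mul, Complex.norm_I, Complex.norm_real, norm_pow,
      Complex.norm_real, norm_norm, Real.norm_eq_abs, one_mul]
    calc |cross (w t) (v t)| * ‖w t‖ / ‖w t‖ ^ 3 = |cross (w t) (v t)| / ‖w t‖ ^ 2 := by field_simp
      _ ≤ B * ‖w t‖ * t / ‖w t‖ ^ 2 := by gcongr; exact (hcr t ht).2
      _ = _ := by field_simp
  have hev : ∀ᶠ t in 𝓝[>] 0, c / 2 < ‖w t‖ / t ^ (2 / 3 : ℝ) :=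
    hlim.eventually_const_lt (by linarith)
  obtain ⟨τ₃, hτ₃, hlow⟩ := mem_nhdsGT_iff_exists_Ioo_subset.1 hev
  have hτ₃0 : (0 : ℝ) < τ₃ := hτ₃
  set τ' := min 1 (min τ₂ τ₃) with hτ'
  have hτ'0 : 0 < τ' := lt_min one_pos (lt_min hτ₂ hτ₃0)
  -- For t < 1 one has |w| ≥ (c/2) t^(2/3) ≥ (c/2) t. Hence the direction is Lipschitz and satisfies
  -- the Cauchy criterion.
  have hbound : ∀ t ∈ Ioo 0 τ', B * t / ‖w t‖ ≤ B * (2 / c) := by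
    intro t ht
    have h1 : t < 1 := ht.2.trans_le (min_le_left _ _)
    have h2 : c / 2 < ‖w t‖ / t ^ (2 / 3 : ℝ) :=
      hlow ⟨ht.1, ht.2.trans_le ((min_le_right _ _).trans (min_le_right _ _))⟩
    have h3 : 0 < t ^ (2 / 3 : ℝ) := Real.rpow_pos_of_pos ht.1 _
    rw [lt_div_iff₀ h3] at h2
    have h4 : t ≤ t ^ (2 / 3 : ℝ) := by
      calc t = t ^ (1 : ℝ) := (Real.rpow_one t).symm
        _ ≤ _ := Real.rpow_le_rpow_of_exponent_ge ht.1 h1.le (by norm_num)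
    have h0 : 0 < ‖w t‖ := lt_trans (by positivity) h2
    rw [mul_div_assoc]
    refine mul_le_mul_of_nonneg_left ?_ hB
    rw [div_le_iff₀ h0, div_mul_eq_mul_div, le_div_iff₀ hc0]
    nlinarith
  have hLip : ∀ s ∈ Ioo 0 τ', ∀ t ∈ Ioo 0 τ', ‖w t / (‖w t‖ : ℂ) - w s / (‖w s‖ : ℂ)‖ ≤
      B * (2 / c) * ‖t - s‖ := by
    intro s hs t ht
    refine (convex_Ioo 0 τ').norm_image_sub_le_of_norm_deriv_le
      (f := fun t => w t / (‖w t‖ : ℂ)) (fun x hx => ?_) (fun x hx => ?_) hs ht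
    · obtain ⟨u', h1, -⟩ := hd x ⟨hx.1, hx.2.trans_le ((min_le_right _ _).trans (min_le_left _ _))⟩
      exact h1.differentiableAt
    · obtain ⟨u', h1, h2⟩ := hd x ⟨hx.1, hx.2.trans_le ((min_le_right _ _).trans (min_le_left _ _))⟩
      rw [h1.deriv]
      exact h2.trans (hbound x hx)
  obtain ⟨σ, hσ⟩ : ∃ σ : ℂ, Tendsto (fun t => w t / (‖w t‖ : ℂ)) (𝓝[>] 0) (𝓝 σ) := by
    refine cauchy_map_iff_exists_tendsto.1 (Metric.cauchy_iff.2 ⟨inferInstance, fun ε hε => ?_⟩)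
    set K := B * (2 / c) with hK
    have hK0 : 0 ≤ K := by positivity
    set r := min τ' (ε / (K + 1)) with hr
    have hr0 : 0 < r := lt_min hτ'0 (by positivity)
    refine ⟨_, image_mem_map (Ioo_mem_nhdsGT hr0), ?_⟩
    rintro _ ⟨t, ht, rfl⟩ _ ⟨s, hs, rfl⟩
    rw [dist_eq_norm]
    have h1 := hLip s ⟨hs.1, hs.2.trans_le (min_le_left _ _)⟩ t ⟨ht.1, ht.2.trans_le (min_le_left _ _)⟩
    have h2 : ‖t - s‖ < r := by
      rw [Real.norm_eq_abs, abs_lt]; constructor <;> linarith [ht.1, ht.2, hs.1, hs.2]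
    have h3 : r ≤ ε / (K + 1) := min_le_right _ _
    rw [le_div_iff₀ (by positivity)] at h3
    have h4 : K * ‖t - s‖ ≤ K * r := by gcongr
    linarith
  refine ⟨σ, ?_, hσ⟩
  refine tendsto_nhds_unique hσ.norm (tendsto_const_nhds.congr' ?_)
  filter_upwards [h.eventually_mem] with t ht
  rw [norm_div, Complex.norm_real, norm_norm, div_self (h.norm_pos ht).ne']

end IsEjection

/-! ### A parabolic arc of small action -/

/-- The inverse of the monotone cubic polynomial `k (a² x + x³ / 3)` (Barker's equation). -/
lemma exists_barker_inverse {a k : ℝ} (ha : 0 < a) (hk : 0 < k) :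
    ∃ g : ℝ → ℝ, (∀ x, g (k * (a ^ 2 * x + x ^ 3 / 3)) = x) ∧
      ∀ t, HasDerivAt g (k * (a ^ 2 + g t ^ 2))⁻¹ t := by
  set p : ℝ → ℝ := fun x => k * (a ^ 2 * x + x ^ 3 / 3) with hp
  have hd : ∀ x, HasDerivAt p (k * (a ^ 2 + x ^ 2)) x := fun x => by
    have := (((hasDerivAt_id x).const_mul (a ^ 2)).add
      (((hasDerivAt_id x).pow 3).div_const 3)).const_mul k
    refine this.congr_deriv ?_
    simp
  have hpos : ∀ x : ℝ, 0 < k * (a ^ 2 + x ^ 2) := fun x => by positivity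
  have hmono : StrictMono p := strictMono_of_hasDerivAt_pos hd hpos
  have hcont : Continuous p := continuous_iff_continuousAt.2 fun x => (hd x).continuousAt
  have hlow : ∀ x : ℝ, 0 ≤ x → k * a ^ 2 * x ≤ p x := fun x hx => by
    have : 0 ≤ k * (x ^ 3 / 3) := by positivity
    simp only [hp]; linarith
  have hodd : ∀ x, p (-x) = -p x := fun x => by simp only [hp]; ring
  have htop : Tendsto p atTop atTop := by
    refine tendsto_atTop_mono' _ ?_ (tendsto_id.const_mul_atTop (by positivity : 0 < k * a ^ 2))
    filter_upwards [eventually_ge_atTop 0] with x hx using hlow x hx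
  have hbot : Tendsto p atBot atBot := by
    have h1 : Tendsto (fun x => -p (-x)) atBot atBot :=
      tendsto_neg_atTop_atBot.comp (htop.comp tendsto_neg_atBot_atTop)
    simpa [hodd] using h1
  set e := hmono.orderIsoOfSurjective p (hcont.surjective htop hbot) with he
  have hep : ∀ x, e x = p x := fun x => rfl
  refine ⟨e.symm, fun x => (e.symm_apply_eq).2 rfl, fun t => ?_⟩
  refine HasDerivAt.of_local_left_inverse e.symm.continuous.continuousAt (hd _) (hpos _).ne' ?_
  exact Eventually.of_forall fun y => by rw [← hep, e.apply_symm_apply]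

/-- With `s` the sine of a quarter of the angle between the end directions, the two summands are the
kinetic and potential actions of the arc in units of 4c²/3. In these units the collision-ejection
path has action 2, and equality would occur at s = 1, the full turn. -/
lemma parabolic_action_lt {s : ℝ} (h1 : s < 1) (h0 : 0 < s) :
    s ^ 2 * (3 - 2 * s ^ 2) + 1 / (3 - 2 * s ^ 2) < 2 := by
  have hu : 0 < 3 - 2 * s ^ 2 := by nlinarith
  rw [← lt_sub_iff_add_lt', div_lt_iff₀ hu]
  have h2 : 0 < 1 - s ^ 2 := by nlinarith
  have h3 : (2 - s ^ 2 * (3 - 2 * s ^ 2)) * (3 - 2 * s ^ 2) - 1 =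
    (1 - s ^ 2) * (4 * (s ^ 2 - 1 ) ^ 2 + 1) := by ring
  nlinarith [mul_pos h2 (by positivity : 0 < 4 * (s ^ 2 - 1 ) ^ 2 + 1)]

/-- Two points at distance `c` from the centre of attraction, seen from it under an angle
`2 |φ| ≠ 0, 2 π`, are joined by an arc which avoids the negative real axis and whose action is
smaller than that of the parabolic collision-ejection path. -/
lemma exists_parabolic_arc {M c φ : ℝ} (hc : 0 < c) (hM : M = 2 * c ^ 3 / 9) (h0 : φ ≠ 0)
    (hπ : |φ| < Real.pi) :
    ∃ W W' : ℝ → ℂ, (∀ t, HasDerivAt W (W' t) t) ∧ Continuous W' ∧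
      (∀ t, W t ∈ Complex.slitPlane) ∧ W 1 = c * Complex.exp (φ * Complex.I) ∧
      W (-1) = c * Complex.exp (-φ * Complex.I) ∧
      ∫ t in (-1)..1, (‖W' t‖ ^ 2 / 2 + M / ‖W t‖) < 8 * c ^ 2 / 3 := by
  -- Time reversal exchanges the two ends and changes the sign of `φ`.
  wlog hpos : 0 < φ generalizing φ
  · obtain ⟨W, W', h1, h2, h3, h4, h5, h6⟩ := this (neg_ne_zero.2 h0) (by rwa [abs_neg])
      (by have := lt_of_le_of_ne (not_lt.1 hpos) h0; linarith)
    refine ⟨fun t => W (-t), fun t => -W' (-t), fun t => ?_, by fun_prop, fun t => h3 _, ?_, ?_, ?_⟩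
    · exact ((h1 (-t)).scomp t (hasDerivAt_neg t)).congr_deriv (by simp)
    · simpa using h5
    · simpa using h4
    · have := intervalIntegral.integral_comp_neg (a := -1) (b := 1)
        (fun t => ‖W' t‖ ^ 2 / 2 + M / ‖W t‖)
      simp only [neg_neg] at this
      simpa only [norm_neg, this] using h6
  rw [abs_of_pos hpos] at hπ
  set s := Real.sin (φ / 2) with hs
  set C := Real.cos (φ / 2) with hC
  have hs0 : 0 < s := Real.sin_pos_of_pos_of_lt_pi (by linarith) (by linarith)
  have hC0 : 0 < C := Real.cos_pos_of_mem_Ioo ⟨by linarith, by linarith⟩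
  have hsC : s ^ 2 + C ^ 2 = 1 := Real.sin_sq_add_cos_sq _
  have hs1 : s < 1 := by nlinarith [pow_pos hC0 2]
  set r := √c with hr
  have hr0 : 0 < r := Real.sqrt_pos.2 hc
  have hrc : r ^ 2 = c := Real.sq_sqrt hc.le
  set a := r * C with ha
  set b := r * s with hb
  have ha0 : 0 < a := mul_pos hr0 hC0
  have hb0 : 0 < b := mul_pos hr0 hs0
  -- The constant in Barker's equation for which `g` runs from -b to b as the time runs from -1 to
  -- 1.
  set D := a ^ 2 * b + b ^ 3 / 3 with hD
  have hD0 : 0 < D := by positivity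
  obtain ⟨g, hg, hgd⟩ := exists_barker_inverse ha0 (inv_pos.2 hD0)
  have hg1 : g 1 = b := by
    have := hg b
    rwa [← hD, inv_mul_cancel₀ hD0.ne'] at this
  have hg2 : g (-1) = -b := by
    have := hg (-b)
    rwa [show a ^ 2 * -b + (-b) ^ 3 / 3 = -D by rw [hD]; ring, mul_neg,
      inv_mul_cancel₀ hD0.ne'] at this
  have hgc : Continuous g := continuous_iff_continuousAt.2 fun t => (hgd t).continuousAt
  have hq0 : ∀ t, 0 < a ^ 2 + g t ^ 2 := fun t => by positivity
  -- The Levi-Civita square root of the arc. It moves on a vertical line with positive real part, so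
  -- its square is a parabola with focus at the origin avoiding the negative real axis.
  set Z : ℝ → ℂ := fun t => a + g t * Complex.I with hZ
  have hZn : ∀ t, ‖Z t‖ ^ 2 = a ^ 2 + g t ^ 2 := fun t => by
    rw [← Complex.normSq_eq_norm_sq, Complex.normSq_apply]; simp [hZ]; ring
  set g' : ℝ → ℝ := fun t => (D⁻¹ * (a ^ 2 + g t ^ 2))⁻¹ with hg'
  have hg'c : Continuous g' := by
    refine Continuous.inv₀ (by fun_prop) fun t => (mul_pos (inv_pos.2 hD0) (hq0 t)).ne'
  have hZd : ∀ t, HasDerivAt Z ((g' t : ℂ) * Complex.I) t := fun t =>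
    ((hasDerivAt_ofReal (hgd t)).mul_const _).const_add _
  have hexp : ∀ x : ℝ, ((r : ℂ) * Complex.exp ((x / 2 : ℝ) * Complex.I)) ^ 2 =
      c * Complex.exp (x * Complex.I) := fun x => by
    rw [mul_pow, ← Complex.exp_nat_mul, ← Complex.ofReal_pow, hrc]
    congr 2
    push_cast; ring
  refine ⟨fun t => Z t ^ 2, fun t => 2 * Z t * ((g' t : ℂ) * Complex.I), fun t => ?_, ?_,
    fun t => ?_, ?_, ?_, ?_⟩
  · exact ((hZd t).fun_pow 2).congr_deriv (by simp)
  · fun_prop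
  · rw [Complex.mem_slitPlane_iff]
    by_contra! h
    simp only [hZ, sq, Complex.mul_re, Complex.mul_im, Complex.add_re, Complex.add_im,
      Complex.ofReal_re, Complex.ofReal_im, Complex.I_re, Complex.I_im] at h
    have h2 : g t = 0 := by
      have : a * g t = 0 := by linarith [h.2]
      exact (mul_eq_zero.1 this).resolve_left ha0.ne'
    rw [h2] at h
    nlinarith [h.1]
  · rw [← hexp φ]
    simp only [hZ, hg1, ha, hb, hs, hC]
    rw [Complex.exp_mul_I, ← Complex.ofReal_cos, ← Complex.ofReal_sin]
    push_cast; ring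
  · rw [← Complex.ofReal_neg, ← hexp (-φ)]
    simp only [hZ, hg2, ha, hb, hs, hC]
    rw [Complex.exp_mul_I, ← Complex.ofReal_cos, ← Complex.ofReal_sin, neg_div, Real.cos_neg,
      Real.sin_neg]
    push_cast; ring
  -- Since |Z|² g' = D, both kinetic and potential energy are constant multiples of g'. Their
  -- integrals depend only on g(1) - g(-1) = 2b.
  · have key : ∀ t, ‖2 * Z t * ((g' t : ℂ) * Complex.I)‖ ^ 2 / 2 + M / ‖Z t ^ 2‖ =
        (2 * D + M / D) * g' t := fun t => by
      have h1 := hq0 t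
      rw [norm_pow, hZn, norm_mul, norm_mul, norm_mul, Complex.norm_real, Complex.norm_I, mul_pow,
        mul_pow, hZn, mul_one, Real.norm_eq_abs, sq_abs, hg']
      simp
      field_simp
    simp only [key]
    rw [intervalIntegral.integral_const_mul, intervalIntegral.integral_eq_sub_of_hasDerivAt
      (fun t _ => hgd t) (hg'c.intervalIntegrable _ _), hg1, hg2]
    have h1 := parabolic_action_lt hs1 hs0
    have hu : 0 < 3 - 2 * s ^ 2 := by nlinarith
    have hDe : D = r ^ 3 * s * (3 - 2 * s ^ 2) / 3 := by
      rw [hD, ha, hb, mul_pow, show C ^ 2 = 1 - s ^ 2 by linarith]; ring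
    have h2 : (2 * D + M / D) * (b - -b) =
        4 * c ^ 2 / 3 * (s ^ 2 * (3 - 2 * s ^ 2) + 1 / (3 - 2 * s ^ 2)) := by
      rw [hDe, hM, hb, ← hrc]
      field_simp
      ring
    rw [h2]
    have : 0 < 4 * c ^ 2 / 3 := by positivity
    nlinarith

/-! ### Asymptotics of a collision-ejection solution -/

namespace IsCollisionEjection

variable {i : Fin N} {t₀ δ : ℝ} {γ : ℝ → ℂ}

lemma continuousAt (hγ : IsCollisionEjection m q i t₀ δ γ) (hδ : 0 < δ) : ContinuousAt γ t₀ :=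
  hγ.h1.continuousOn.continuousAt (Icc_mem_nhds (by linarith) (by linarith))

lemma tendsto_sub (hγ : IsCollisionEjection m q i t₀ δ γ) (hq : IsCollisionFreePeriodic m q)
    (hδ : 0 < δ) : Tendsto (fun t => γ t - q i t) (𝓝 t₀) (𝓝 0) := by
  have := (hγ.continuousAt hδ).sub (hq.continuous i).continuousAt
  rwa [ContinuousAt, Pi.sub_apply, hγ.collision, sub_self] at this

/-- Near the collision with the primary `i` the other primaries are far away. -/
lemma exists_far (hγ : IsCollisionEjection m q i t₀ δ γ) (hq : IsCollisionFreePeriodic m q)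
    (hδ : 0 < δ) : ∃ r τ : ℝ, 0 < r ∧ 0 < τ ∧ τ ≤ δ ∧
      ∀ t, |t - t₀| < τ → ∀ j, j ≠ i → r ≤ ‖γ t - q j t‖ := by
  obtain ⟨ρ, hρ, hsep⟩ := hq.separated
  obtain ⟨τ, hτ, h⟩ := Metric.eventually_nhds_iff.1
    ((hγ.tendsto_sub hq hδ).norm.eventually_lt_const
      (show ‖(0 : ℂ)‖ < ρ / 2 by simpa using hρ))
  refine ⟨ρ / 2, min τ δ, half_pos hρ, lt_min hτ hδ, min_le_right _ _, fun t ht j hj => ?_⟩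
  have h1 : ‖γ t - q i t‖ < ρ / 2 := h (by rw [Real.dist_eq]; exact ht.trans_le (min_le_left _ _))
  have h2 := norm_sub_norm_le (q i t - q j t) (-(γ t - q i t))
  rw [norm_neg, show q i t - q j t - -(γ t - q i t) = γ t - q j t by ring] at h2
  linarith [hsep t i j hj.symm]

lemma integrableOn_comp_affine {f : ℝ → ℝ} {e : ℝ} (he : e = 1 ∨ e = -1)
    (hf : IntegrableOn f (Icc (t₀ - δ) (t₀ + δ))) :
    IntegrableOn (fun s => f (t₀ + e * s)) (Ioo 0 δ) := by
  have h1 : MeasurePreserving (fun s : ℝ => t₀ + e * s) volume volume ∧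
      MeasurableEmbedding (fun s : ℝ => t₀ + e * s) := by
    rcases he with rfl | rfl
    · simp only [one_mul]
      exact ⟨measurePreserving_add_left volume t₀, measurableEmbedding_addLeft t₀⟩
    · simp only [neg_mul, one_mul, ← sub_eq_add_neg]
      exact ⟨Measure.measurePreserving_sub_left volume t₀, measurableEmbedding_subLeft t₀⟩
  refine ((h1.1.integrableOn_comp_preimage h1.2).2 hf).mono_set fun s hs => ?_
  rcases he with rfl | rfl <;> constructor <;> linarith [hs.1, hs.2]

/-- The position relative to the primary at the collision is an ejection, in forward and in
backward time. -/
lemma exists_isEjection (hγ : IsCollisionEjection m q i t₀ δ γ) (hm : ∀ i, 0 < m i)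
    (hq : IsCollisionFreePeriodic m q) (hδ : 0 < δ) {e : ℝ} (he : e = 1 ∨ e = -1) :
    ∃ (B τ : ℝ) (v F : ℝ → ℂ),
      IsEjection (m i) B τ (fun s => γ (t₀ + e * s) - q i (t₀ + e * s)) v F := by
  obtain ⟨r, τ, hr, hτ, hτδ, hfar⟩ := hγ.exists_far hq hδ
  obtain ⟨L, hL, hacc⟩ := hq.exists_acceleration_le i
  have hee : e * e = 1 := by rcases he with rfl | rfl <;> norm_num
  have habs : |e| = 1 := by rcases he with rfl | rfl <;> norm_num
  set x : ℝ → ℝ := fun s => t₀ + e * s with hx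
  have hxd : ∀ s, HasDerivAt x e s := fun s => by
    exact (((hasDerivAt_id s).const_mul e).const_add t₀).congr_deriv (mul_one e)
  have hxm : ∀ s ∈ Ioo 0 τ, |x s - t₀| < τ ∧ x s ≠ t₀ ∧ x s ∈ Ioo (t₀ - δ) (t₀ + δ) := by
    intro s hs
    have h1 : |x s - t₀| = s := by
      rw [hx, add_sub_cancel_left, abs_mul, habs, one_mul, abs_of_pos hs.1]
    refine ⟨h1.trans_lt hs.2, fun h => ?_, ?_⟩
    · rw [h, sub_self, abs_zero] at h1
      exact hs.1.ne h1
    · have := abs_lt.1 (h1.trans_lt (hs.2.trans_le hτδ))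
      constructor <;> linarith [this.1, this.2]
  -- The perturbation consists of the attraction of the distant primaries and the acceleration of
  -- the primary `i`, which carries the moving frame. Both are bounded near the collision; as e² =
  -- 1, reversing time leaves it unchanged.
  set G : ℝ → ℂ := fun t => -∑ j ∈ Finset.univ.erase i, (m j / ‖γ t - q j t‖ ^ 3) • (γ t - q j t) -
    deriv (deriv (q i)) t with hG
  refine ⟨(∑ j ∈ Finset.univ.erase i, m j / r ^ 2) + L, τ,
    fun s => e • (deriv γ (x s) - deriv (q i) (x s)), fun s => G (x s),
    hm i, add_nonneg (Finset.sum_nonneg fun j _ => div_nonneg (hm j).le (sq_nonneg r)) hL, hτ, fun s hs => ?_, fun s hs => ?_,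
    fun s hs => ?_, fun s hs => ?_, ?_, ?_⟩
  · obtain ⟨-, h2, h3⟩ := hxm s hs
    exact HasDerivAt.scomp (g₁ := fun t => γ t - q i t) s
      ((hγ.solves _ h3 h2).1.hasDerivAt.fun_sub (hq.hasDerivAt i _)) (hxd s)
  · obtain ⟨-, h2, h3⟩ := hxm s hs
    have h4 := (hγ.solves _ h3 h2).2.fun_sub (hq.solves i (x s)).2
    have h5 := (HasDerivAt.scomp (g₁ := fun t => deriv γ t - deriv (q i) t) s h4 (hxd s)).const_smul e
    refine h5.congr_deriv ?_
    rw [smul_smul, hee, one_smul, ← Finset.add_sum_erase _ _ (Finset.mem_univ i), hG,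
      ← (hq.solves i (x s)).2.deriv]
    simp only
    abel
  · obtain ⟨h1, h2, h3⟩ := hxm s hs
    refine (norm_sub_le _ _).trans (add_le_add ?_ (hacc _))
    rw [norm_neg]
    refine (norm_sum_le _ _).trans (Finset.sum_le_sum fun j hj => ?_)
    have h4 := hfar _ h1 j (Finset.ne_of_mem_erase hj)
    have h5 : 0 < ‖γ (x s) - q j (x s)‖ := hr.trans_le h4
    have h6 := (hm j).le
    rw [norm_smul, norm_div, norm_pow, norm_norm, Real.norm_of_nonneg h6]
    calc m j / ‖γ (x s) - q j (x s)‖ ^ 3 * ‖γ (x s) - q j (x s)‖ =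
          m j / ‖γ (x s) - q j (x s)‖ ^ 2 := by field_simp
      _ ≤ _ := by gcongr
  · obtain ⟨-, h2, h3⟩ := hxm s hs
    exact sub_ne_zero.2 (hγ.collisionFree _ (Ioo_subset_Icc_self h3) h2 i)
  · have hx0 : Tendsto x (𝓝[>] 0) (𝓝 t₀) := by
      have := (hxd 0).continuousAt.tendsto.mono_left (nhdsWithin_le_nhds (s := Ioi 0))
      simpa [hx] using this
    exact (hγ.tendsto_sub hq hδ).comp hx0
  · have h1 : IntegrableOn (fun t => ‖deriv γ t - deriv (q i) t‖) (Icc (t₀ - δ) (t₀ + δ)) := by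
      have h2 := (hγ.h1.2.integrable (by norm_num)).sub
        ((hq.continuous_deriv i).continuousOn.integrableOn_compact
          (isCompact_Icc (a := t₀ - δ) (b := t₀ + δ)))
      exact h2.norm
    have h2 := (integrableOn_comp_affine he h1).mono_set (Ioo_subset_Ioo le_rfl hτδ)
    simpa only [norm_smul, Real.norm_eq_abs, habs, one_mul] using h2

/-- The asymptotics of a collision-ejection solution at the collision, on one side. -/
lemma exists_tendsto (hγ : IsCollisionEjection m q i t₀ δ γ) (hm : ∀ i, 0 < m i)
    (hq : IsCollisionFreePeriodic m q) (hδ : 0 < δ) {e : ℝ} (he : e = 1 ∨ e = -1) :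
    ∃ σ : ℂ, ‖σ‖ = 1 ∧ Tendsto (fun s => direction γ (q i) (t₀ + e * s)) (𝓝[>] 0) (𝓝 σ) ∧
      Tendsto (fun μ => (γ (t₀ + e * μ ^ 3) - q i (t₀ + e * μ ^ 3)) / ((μ ^ 2 : ℝ) : ℂ)) (𝓝[>] 0)
        (𝓝 (((9 * m i / 2) ^ (1 / 3 : ℝ) : ℝ) * σ)) := by
  obtain ⟨B, τ, v, F, hE⟩ := hγ.exists_isEjection hm hq hδ he
  obtain ⟨σ, hσ, hdir⟩ := hE.exists_tendsto_direction
  refine ⟨σ, hσ, hdir, ?_⟩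
  have h1 : Tendsto (fun s => ((‖γ (t₀ + e * s) - q i (t₀ + e * s)‖ / s ^ (2 / 3 : ℝ) : ℝ) : ℂ) *
      direction γ (q i) (t₀ + e * s)) (𝓝[>] 0) (𝓝 (((9 * m i / 2) ^ (1 / 3 : ℝ) : ℝ) * σ)) :=
    ((Complex.continuous_ofReal.tendsto _).comp hE.tendsto_norm_div_rpow).mul hdir
  -- The substitution s = μ³ turns s^(2/3) into μ², so the scaling is polynomial in μ from here on.
  have h2 : Tendsto (fun μ : ℝ => μ ^ 3) (𝓝[>] 0) (𝓝[>] 0) := by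
    refine tendsto_nhdsWithin_iff.2 ⟨?_, ?_⟩
    · have : Tendsto (fun μ : ℝ => μ ^ 3) (𝓝 0) (𝓝 (0 ^ 3)) := (continuous_pow 3).tendsto 0
      rw [zero_pow (by norm_num)] at this
      exact this.mono_left nhdsWithin_le_nhds
    · filter_upwards [self_mem_nhdsWithin] with μ hμ using pow_pos (mem_Ioi.1 hμ) 3
  refine (h1.comp h2).congr' ?_
  filter_upwards [h2.eventually hE.eventually_mem, self_mem_nhdsWithin] with μ hμ hμ0
  have h3 : (‖γ (t₀ + e * μ ^ 3) - q i (t₀ + e * μ ^ 3)‖ : ℂ) ≠ 0 :=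
    Complex.ofReal_ne_zero.2 (hE.norm_pos hμ).ne'
  have h4 : (μ ^ 3) ^ (2 / 3 : ℝ) = μ ^ 2 := by
    rw [← Real.rpow_natCast μ 3, ← Real.rpow_mul (le_of_lt hμ0), ← Real.rpow_natCast μ 2]
    norm_num
  simp only [Function.comp_apply, direction, h4]
  push_cast
  field_simp

lemma direction_tendsto_right {f : ℝ → ℂ} {σ : ℂ}
    (h : Tendsto (fun s => f (t₀ + 1 * s)) (𝓝[>] 0) (𝓝 σ)) : Tendsto f (𝓝[>] t₀) (𝓝 σ) := by
  have h1 : Tendsto (fun t => t - t₀) (𝓝[>] t₀) (𝓝[>] 0) := by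
    refine tendsto_nhdsWithin_iff.2 ⟨?_, ?_⟩
    · have : Tendsto (fun t => t - t₀) (𝓝 t₀) (𝓝 (t₀ - t₀)) := (continuous_sub_right t₀).tendsto _
      rw [sub_self] at this
      exact this.mono_left nhdsWithin_le_nhds
    · filter_upwards [self_mem_nhdsWithin] with t ht using mem_Ioi.2 (sub_pos.2 ht)
  refine (h.comp h1).congr fun t => ?_
  simp

lemma direction_tendsto_left {f : ℝ → ℂ} {σ : ℂ}
    (h : Tendsto (fun s => f (t₀ + (-1) * s)) (𝓝[>] 0) (𝓝 σ)) : Tendsto f (𝓝[<] t₀) (𝓝 σ) := by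
  have h1 : Tendsto (fun t => t₀ - t) (𝓝[<] t₀) (𝓝[>] 0) := by
    refine tendsto_nhdsWithin_iff.2 ⟨?_, ?_⟩
    · have : Tendsto (fun t => t₀ - t) (𝓝 t₀) (𝓝 (t₀ - t₀)) := (continuous_sub_left t₀).tendsto _
      rw [sub_self] at this
      exact this.mono_left nhdsWithin_le_nhds
    · filter_upwards [self_mem_nhdsWithin] with t ht using mem_Ioi.2 (sub_pos.2 ht)
  refine (h.comp h1).congr fun t => ?_
  simp

end IsCollisionEjection

/-! ### Comparison of a collision-ejection solution with a parabolic arc -/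

/-- Maupertuis' inequality for radial motion. -/
lemma sqrt_norm_sub_le_integral {w w' : ℝ → ℂ} {G : ℝ → ℝ} {a b M : ℝ} (hab : a ≤ b) (hM : 0 < M)
    (hw : ContinuousOn w (Icc a b)) (hd : ∀ t ∈ Ioo a b, HasDerivAt w (w' t) t)
    (h0 : ∀ t ∈ Ioo a b, w t ≠ 0) (hG : IntegrableOn G (Icc a b))
    (hle : ∀ t ∈ Ioo a b, ‖w' t‖ ^ 2 / 2 + M / ‖w t‖ ≤ G t) :
    2 * √(2 * M) * |√‖w b‖ - √‖w a‖| ≤ ∫ t in Icc a b, G t := by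
  set f : ℝ → ℝ := fun t => 2 * √(2 * M) * √‖w t‖ with hf
  have hfc : ContinuousOn f (Icc a b) := hw.norm.sqrt.const_mul _
  have hfd : ∀ t ∈ Ioo a b, ∃ f', HasDerivAt f f' t ∧ |f'| ≤ G t := by
    intro t ht
    have hr : 0 < ‖w t‖ := norm_pos_iff.2 (h0 t ht)
    have h1 : HasDerivAt (fun t => ‖w t‖) (deriv (fun t => ‖w t‖) t) t :=
      ((hd t ht).differentiableAt.norm ℝ (h0 t ht)).hasDerivAt
    have h2 : |deriv (fun t => ‖w t‖) t| ≤ ‖w' t‖ :=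
      norm_deriv_le_of_eventually_le h1 (hd t ht)
        (Eventually.of_forall fun x => abs_norm_sub_norm_le _ _)
    refine ⟨_, (h1.sqrt hr.ne').const_mul _, le_trans ?_ (hle t ht)⟩
    have hs : 0 < √‖w t‖ := Real.sqrt_pos.2 hr
    have hs2 : √‖w t‖ ^ 2 = ‖w t‖ := Real.sq_sqrt hr.le
    have hM2 : √(2 * M) ^ 2 = 2 * M := Real.sq_sqrt (by positivity)
    rw [abs_mul, abs_div, abs_of_pos (by positivity : 0 < 2 * √(2 * M)),
      abs_of_pos (by positivity : 0 < 2 * √‖w t‖)]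
    -- By the inequality 2xy ≤ x² + y², kinetic plus potential energy is at least √(2M) |w'|/√|w|,
    -- which bounds the derivative of 2√(2M)√|w|.
    have h3 : 2 * √(2 * M) * (|deriv (fun t => ‖w t‖) t| / (2 * √‖w t‖)) ≤
        ‖w' t‖ * (√(2 * M) / √‖w t‖) := by
      calc _ = |deriv (fun t => ‖w t‖) t| * (√(2 * M) / √‖w t‖) := by field_simp
        _ ≤ _ := by gcongr
    have h4 : (√(2 * M) / √‖w t‖) ^ 2 = 2 * (M / ‖w t‖) := by
      rw [div_pow, hM2, hs2]; ring
    have h5 := two_mul_le_add_sq ‖w' t‖ (√(2 * M) / √‖w t‖)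
    rw [h4] at h5
    linarith
  choose! f' hf' hf'G using hfd
  have h1 := intervalIntegral.sub_le_integral_of_hasDeriv_right_of_le hab hfc
    (fun t ht => (hf' t ht).hasDerivWithinAt) hG fun t ht => (le_abs_self _).trans (hf'G t ht)
  have h2 := intervalIntegral.sub_le_integral_of_hasDeriv_right_of_le hab hfc.neg
    (fun t ht => (hf' t ht).neg.hasDerivWithinAt) hG fun t ht => (neg_le_abs _).trans (hf'G t ht)
  rw [intervalIntegral.integral_of_le hab, ← integral_Icc_eq_integral_Ioc] at h1 h2
  have h3 : |f b - f a| ≤ ∫ t in Icc a b, G t :=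
    abs_le'.2 ⟨h1, by simpa [sub_eq_neg_add, add_comm] using h2⟩
  rwa [hf, ← mul_sub, abs_mul, abs_of_nonneg (by positivity)] at h3

/-- Affine perturbations of a path which avoids the negative real axis. -/
lemma eventually_affine_perturbation {W W' : ℝ → ℂ} (hW : ∀ t, HasDerivAt W (W' t) t)
    (hW' : Continuous W') (hs : ∀ t, W t ∈ Complex.slitPlane) (M : ℝ) {κ : ℝ} (hκ : 0 < κ) :
    ∀ᶠ x : ℂ × ℂ in 𝓝 0, ∀ t ∈ Icc (-1 : ℝ) 1, W t + (x.1 + t * x.2) ∈ Complex.slitPlane ∧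
      ‖W t + (x.1 + t * x.2)‖ < ‖W t‖ + 1 ∧
      ‖W' t + x.2‖ ^ 2 / 2 + M / ‖W t + (x.1 + t * x.2)‖ < ‖W' t‖ ^ 2 / 2 + M / ‖W t‖ + κ := by
  have hWc : Continuous W := continuous_iff_continuousAt.2 fun t => (hW t).continuousAt
  -- The conditions are open in the perturbation and the time jointly; compactness of [-1, 1] makes
  -- the neighbourhood uniform in time.
  refine isCompact_Icc.eventually_forall_of_forall_eventually fun t _ => ?_
  have h0 : ‖W t‖ ≠ 0 := norm_ne_zero_iff.2 (Complex.slitPlane_ne_zero (hs t))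
  have hc : Continuous fun z : (ℂ × ℂ) × ℝ => W z.2 + (z.1.1 + z.2 * z.1.2) := by fun_prop
  refine Eventually.and ?_ (Eventually.and ?_ ?_)
  · refine hc.continuousAt.eventually_mem (Complex.isOpen_slitPlane.mem_nhds ?_)
    simpa using hs t
  · have h1 : Continuous fun z : (ℂ × ℂ) × ℝ => ‖W z.2‖ + 1 := by fun_prop
    refine ContinuousAt.eventually_lt hc.norm.continuousAt h1.continuousAt ?_
    simp
  · have h1 : ContinuousAt (fun z : (ℂ × ℂ) × ℝ => ‖W' z.2 + z.1.2‖ ^ 2 / 2 +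
        M / ‖W z.2 + (z.1.1 + z.2 * z.1.2)‖) (0, t) := by
      refine ContinuousAt.add (by fun_prop) (ContinuousAt.div₀ continuousAt_const
        hc.norm.continuousAt ?_)
      simpa using Complex.slitPlane_ne_zero (hs t)
    have h2 : ContinuousAt (fun z : (ℂ × ℂ) × ℝ => ‖W' z.2‖ ^ 2 / 2 + M / ‖W z.2‖ + κ) (0, t) := by
      refine (ContinuousAt.add (by fun_prop) (ContinuousAt.div₀ continuousAt_const
        (by fun_prop) ?_)).add continuousAt_const
      exact h0
    refine h1.eventually_lt h2 ?_
    simpa using hκ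

/-- Young's inequality. It passes from the absolute to the relative velocity at the cost of a factor
1 - κ and a bounded term, which is negligible at the scale of the action. -/
lemma sq_norm_add_ge {x y : ℂ} {κ P : ℝ} (hκ : 0 < κ) (hy : ‖y‖ ≤ P) :
    (1 - κ) * (‖x‖ ^ 2 / 2) ≤ ‖x + y‖ ^ 2 / 2 + P ^ 2 / (2 * κ) := by
  have h1 := norm_sub_le (x + y) y
  rw [add_sub_cancel_right] at h1
  have hP : 0 ≤ P := (norm_nonneg _).trans hy
  set a := ‖x + y‖
  have ha : 0 ≤ a := norm_nonneg _
  have h2 : ‖x‖ ^ 2 ≤ (a + P) ^ 2 := by gcongr; linarith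
  have h3 : P ^ 2 / (2 * κ) = P ^ 2 / κ / 2 := by field_simp
  have h4 : κ * (P ^ 2 / κ) = P ^ 2 := by field_simp
  by_cases hκ1 : 1 ≤ κ
  · have h5 : 0 ≤ P ^ 2 / (2 * κ) := by positivity
    have h6 : (1 - κ) * (‖x‖ ^ 2 / 2) ≤ 0 :=
      mul_nonpos_of_nonpos_of_nonneg (by linarith) (by positivity)
    linarith [sq_nonneg a]
  · have h5 := mul_le_mul_of_nonneg_left h2 (by linarith : 0 ≤ 1 - κ)
    set R := P ^ 2 / κ
    have h6 : (1 - κ) * (a + P) ^ 2 ≤ a ^ 2 + R := by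
      have h7 : κ * ((1 - κ) * (a + P) ^ 2) ≤ κ * (a ^ 2 + R) := by
        rw [mul_add, h4]
        nlinarith [sq_nonneg (κ * a - (1 - κ) * P), mul_nonneg hκ.le (sq_nonneg P),
          mul_nonneg ha hP]
      exact le_of_mul_le_mul_left h7 hκ
    linarith

/-- Young's inequality in the other direction, for the competitor. -/
lemma sq_norm_add_le {x y : ℂ} {κ P : ℝ} (hκ : 0 < κ) (hy : ‖y‖ ≤ P) :
    ‖x + y‖ ^ 2 / 2 ≤ (1 + κ) * (‖x‖ ^ 2 / 2) + (1 + 1 / κ) * P ^ 2 / 2 := by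
  have h1 := norm_add_le x y
  have hP : 0 ≤ P := (norm_nonneg _).trans hy
  have ha : 0 ≤ ‖x‖ := norm_nonneg _
  set a := ‖x‖
  have h2 : ‖x + y‖ ^ 2 ≤ (a + P) ^ 2 := by gcongr; linarith
  have h4 : (1 + 1 / κ) * P ^ 2 = P ^ 2 + P ^ 2 / κ := by ring
  have h5 : κ * (P ^ 2 / κ) = P ^ 2 := by field_simp
  have h6 : 2 * a * P ≤ κ * a ^ 2 + P ^ 2 / κ := by
    have : κ * (2 * a * P) ≤ κ * (κ * a ^ 2 + P ^ 2 / κ) := by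
      rw [mul_add, h5]
      nlinarith [sq_nonneg (κ * a - P)]
    exact le_of_mul_le_mul_left this hκ
  rw [h4]
  linarith

/-- The action of a collision-ejection solution is at least almost that of a parabolic one. -/
lemma IsCollisionEjection.le_lagInt {i : Fin N} {t₀ δ : ℝ} {γ : ℝ → ℂ}
    (hγ : IsCollisionEjection m q i t₀ δ γ) (hm : ∀ i, 0 < m i) (hq : IsCollisionFreePeriodic m q)
    {κ P s : ℝ} (hκ : 0 < κ) (hκ1 : κ < 1)
    (hP : ∀ t ∈ Icc (t₀ - δ) (t₀ + δ), ‖deriv (q i) t‖ ≤ P) (hs : 0 < s) (hsδ : s ≤ δ) :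
    ENNReal.ofReal ((1 - κ) * (2 * √(2 * m i) * (√‖γ (t₀ + s) - q i (t₀ + s)‖ +
      √‖γ (t₀ - s) - q i (t₀ - s)‖)) - s * (P ^ 2 / κ)) ≤ lagInt m q γ (t₀ - s) (t₀ + s) := by
  have h1 : IsH1Path γ (t₀ - s) (t₀ + s) :=
    hγ.h1.mono (by linarith) (by linarith) (by linarith)
  -- Infinite action makes the lower bound trivial, so no integrability of the potential along the
  -- solution has to be shown beforehand.
  by_cases htop : lagInt m q γ (t₀ - s) (t₀ + s) = ⊤
  · rw [htop]; exact le_top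
  obtain ⟨-, hint, heq⟩ := collisionFree_of_lagInt_ne_top hm hq.continuous h1.continuousOn htop
  rw [heq]
  refine ENNReal.ofReal_le_ofReal ?_
  have hκ' : 0 < 1 - κ := by linarith
  set G : ℝ → ℝ := fun t => (1 - κ)⁻¹ * (lagReal m q γ t + P ^ 2 / (2 * κ)) with hG
  have hGi : IntegrableOn G (Icc (t₀ - s) (t₀ + s)) := by
    have := (hint.add (integrableOn_const (C := P ^ 2 / (2 * κ)) (by simp))).const_mul (1 - κ)⁻¹
    exact this
  have hGint : ∫ t in Icc (t₀ - s) (t₀ + s), G t =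
      (1 - κ)⁻¹ * ((∫ t in Icc (t₀ - s) (t₀ + s), lagReal m q γ t) + s * (P ^ 2 / κ)) := by
    rw [hG, integral_const_mul, integral_add hint (integrableOn_const (by simp)), setIntegral_const,
      measureReal_def, Real.volume_Icc, ENNReal.toReal_ofReal (by linarith), smul_eq_mul]
    congr 2
    field_simp
    ring
  have hwc : ContinuousOn (fun t => γ t - q i t) (Icc (t₀ - s) (t₀ + s)) :=
    h1.continuousOn.sub (hq.continuous i).continuousOn
  have hle : ∀ t ∈ Ioo (t₀ - s) (t₀ + s), t ≠ t₀ →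
      HasDerivAt (fun t => γ t - q i t) (deriv γ t - deriv (q i) t) t ∧ γ t - q i t ≠ 0 ∧
      ‖deriv γ t - deriv (q i) t‖ ^ 2 / 2 + m i / ‖γ t - q i t‖ ≤ G t := by
    intro t ht ht0
    have ht' : t ∈ Ioo (t₀ - δ) (t₀ + δ) := ⟨by linarith [ht.1], by linarith [ht.2]⟩
    refine ⟨(hγ.solves t ht' ht0).1.hasDerivAt.fun_sub (hq.hasDerivAt i t),
      sub_ne_zero.2 (hγ.collisionFree t (Ioo_subset_Icc_self ht') ht0 i), ?_⟩
    have h2 := sq_norm_add_ge (x := deriv γ t - deriv (q i) t) hκ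
      (hP t (Ioo_subset_Icc_self ht'))
    rw [sub_add_cancel] at h2
    have h3 : m i / ‖γ t - q i t‖ ≤ ∑ j, m j / ‖γ t - q j t‖ :=
      Finset.single_le_sum (f := fun j => m j / ‖γ t - q j t‖)
        (fun j _ => div_nonneg (hm j).le (norm_nonneg _)) (Finset.mem_univ i)
    have h4 : 0 ≤ κ * (m i / ‖γ t - q i t‖) :=
      mul_nonneg hκ.le (div_nonneg (hm i).le (norm_nonneg _))
    simp only [hG]
    rw [inv_mul_eq_div, le_div_iff₀ hκ', lagReal]
    linarith
  have hr := sqrt_norm_sub_le_integral (a := t₀) (b := t₀ + s) (by linarith) (hm i)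
    (hwc.mono (Icc_subset_Icc (by linarith) le_rfl))
    (fun t ht => (hle t ⟨by linarith [ht.1], ht.2⟩ ht.1.ne').1)
    (fun t ht => (hle t ⟨by linarith [ht.1], ht.2⟩ ht.1.ne').2.1)
    (hGi.mono_set (Icc_subset_Icc (by linarith) le_rfl))
    (fun t ht => (hle t ⟨by linarith [ht.1], ht.2⟩ ht.1.ne').2.2)
  have hl := sqrt_norm_sub_le_integral (a := t₀ - s) (b := t₀) (by linarith) (hm i)
    (hwc.mono (Icc_subset_Icc le_rfl (by linarith)))
    (fun t ht => (hle t ⟨ht.1, by linarith [ht.2]⟩ ht.2.ne).1)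
    (fun t ht => (hle t ⟨ht.1, by linarith [ht.2]⟩ ht.2.ne).2.1)
    (hGi.mono_set (Icc_subset_Icc le_rfl (by linarith)))
    (fun t ht => (hle t ⟨ht.1, by linarith [ht.2]⟩ ht.2.ne).2.2)
  simp only [hγ.collision, sub_self, norm_zero, Real.sqrt_zero, sub_zero, zero_sub, abs_neg] at hr hl
  rw [abs_of_nonneg (Real.sqrt_nonneg _)] at hr hl
  have hsum : (∫ t in Icc (t₀ - s) t₀, G t) + ∫ t in Icc t₀ (t₀ + s), G t =
      ∫ t in Icc (t₀ - s) (t₀ + s), G t := by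
    rw [integral_Icc_eq_integral_Ioc, integral_Icc_eq_integral_Ioc, integral_Icc_eq_integral_Ioc,
      ← intervalIntegral.integral_of_le (by linarith), ← intervalIntegral.integral_of_le (by linarith),
      ← intervalIntegral.integral_of_le (by linarith)]
    refine intervalIntegral.integral_add_adjacent_intervals ?_ ?_ <;>
    · rw [intervalIntegrable_iff_integrableOn_Icc_of_le (by linarith)]
      exact hGi.mono_set (Icc_subset_Icc (by linarith) (by linarith))
  rw [hGint] at hsum
  have h5 : 2 * √(2 * m i) * (√‖γ (t₀ + s) - q i (t₀ + s)‖ + √‖γ (t₀ - s) - q i (t₀ - s)‖) ≤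
      (1 - κ)⁻¹ * ((∫ t in Icc (t₀ - s) (t₀ + s), lagReal m q γ t) + s * (P ^ 2 / κ)) := by
    linarith
  rw [inv_mul_eq_div, le_div_iff₀ hκ'] at h5
  linarith

/-- The action of a rescaled arc around the primary `i`. -/
lemma lagInt_rescaled_le (hm : ∀ i, 0 < m i) (hq : IsCollisionFreePeriodic m q) {i : Fin N}
    {t₀ κ P ρ μ : ℝ} {ω : ℂ} {V V' : ℝ → ℂ} {k : ℝ → ℝ} (hκ : 0 < κ) (hμ : 0 < μ)
    (hP : ∀ t ∈ Icc (t₀ - μ ^ 3) (t₀ + μ ^ 3), ‖deriv (q i) t‖ ≤ P) (hρ : 0 < ρ)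
    (hsep : ∀ t i j, i ≠ j → ρ ≤ ‖q i t - q j t‖) (hω : ‖ω‖ = 1)
    (hV : ∀ τ, HasDerivAt V (V' τ) τ) (hV' : Continuous V') (hk : Continuous k)
    (h0 : ∀ τ ∈ Icc (-1 : ℝ) 1, V τ ≠ 0) (hVρ : ∀ τ ∈ Icc (-1 : ℝ) 1, μ ^ 2 * ‖V τ‖ ≤ ρ / 2)
    (hle : ∀ τ ∈ Icc (-1 : ℝ) 1, ‖V' τ‖ ^ 2 / 2 + m i / ‖V τ‖ ≤ k τ) :
    IsH1Path (fun t => q i t + ω * μ ^ 2 * V ((t - t₀) / μ ^ 3)) (t₀ - μ ^ 3) (t₀ + μ ^ 3) ∧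
    (∀ t ∈ Icc (t₀ - μ ^ 3) (t₀ + μ ^ 3),
      CollisionFreeAt q (fun t => q i t + ω * μ ^ 2 * V ((t - t₀) / μ ^ 3)) t) ∧
    lagInt m q (fun t => q i t + ω * μ ^ 2 * V ((t - t₀) / μ ^ 3)) (t₀ - μ ^ 3) (t₀ + μ ^ 3) ≤
      ENNReal.ofReal ((1 + κ) * (μ * ∫ τ in (-1)..1, k τ) +
        μ ^ 3 * ((1 + 1 / κ) * P ^ 2 + 4 * (∑ j, m j) / ρ)) := by
  set η : ℝ → ℂ := fun t => q i t + ω * μ ^ 2 * V ((t - t₀) / μ ^ 3) with hη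
  have hμ3 : 0 < μ ^ 3 := by positivity
  have hτ : ∀ t ∈ Icc (t₀ - μ ^ 3) (t₀ + μ ^ 3), (t - t₀) / μ ^ 3 ∈ Icc (-1 : ℝ) 1 := by
    intro t ht
    rw [mem_Icc, le_div_iff₀ hμ3, div_le_iff₀ hμ3]
    constructor <;> linarith [ht.1, ht.2]
  have hηd : ∀ t, HasDerivAt η (deriv (q i) t + ω * μ ^ 2 * (((μ ^ 3)⁻¹ : ℝ) • V' ((t - t₀) / μ ^ 3)))
      t := by
    intro t
    refine (hq.hasDerivAt i t).fun_add (HasDerivAt.const_mul _ ?_)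
    refine HasDerivAt.scomp (h := fun t => (t - t₀) / μ ^ 3) t (hV _) ?_
    exact (((hasDerivAt_id t).sub_const t₀).div_const _).congr_deriv (by rw [one_div])
  have hsum : 0 ≤ ∑ j, m j := Finset.sum_nonneg fun j _ => (hm j).le
  have hcf : ∀ t ∈ Icc (t₀ - μ ^ 3) (t₀ + μ ^ 3), CollisionFreeAt q η t ∧
      lagReal m q η t ≤ (1 + κ) * ((μ ^ 2)⁻¹ * k ((t - t₀) / μ ^ 3)) +
        ((1 + 1 / κ) * P ^ 2 / 2 + (∑ j, m j) * (2 / ρ)) := by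
    intro t ht
    have hτt := hτ t ht
    set τ := (t - t₀) / μ ^ 3 with hτdef
    have hn : ‖ω * μ ^ 2 * V τ‖ = μ ^ 2 * ‖V τ‖ := by
      rw [norm_mul, norm_mul, hω, norm_pow, Complex.norm_real, Real.norm_of_nonneg hμ.le, one_mul]
    have hV0 : 0 < ‖V τ‖ := norm_pos_iff.2 (h0 τ hτt)
    have hself : η t - q i t = ω * μ ^ 2 * V τ := by rw [hη, add_sub_cancel_left]
    have hfar : ∀ j, j ≠ i → ρ / 2 ≤ ‖η t - q j t‖ := by
      intro j hj
      have h1 := norm_sub_norm_le (q i t - q j t) (-(η t - q i t))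
      rw [norm_neg, hself, hn, ← hself, sub_neg_eq_add, add_comm, sub_add_sub_cancel] at h1
      linarith [hsep t i j hj.symm, hVρ τ hτt]
    refine ⟨fun j h => ?_, ?_⟩
    · by_cases hj : j = i
      · subst hj
        rw [← sub_eq_zero, hself, ← norm_eq_zero, hn] at h
        exact (mul_pos (pow_pos hμ 2) hV0).ne' h
      · have := hfar j hj
        rw [h, sub_self, norm_zero] at this
        linarith
    · rw [lagReal, (hηd t).deriv, add_comm (deriv (q i) t), ← Finset.add_sum_erase _ _
        (Finset.mem_univ i), hself, hn, ← hτdef]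
      have h1 := sq_norm_add_le (x := ω * μ ^ 2 * (((μ ^ 3)⁻¹ : ℝ) • V' τ)) hκ (hP t ht)
      -- Velocities scale by μ⁻¹, so kinetic and potential energy both scale by μ⁻². Over a time of
      -- order μ³ this gives the factor μ in the action, whereas bounded terms contribute only order
      -- μ³.
      have h2 : ‖ω * μ ^ 2 * (((μ ^ 3)⁻¹ : ℝ) • V' τ)‖ ^ 2 / 2 = (μ ^ 2)⁻¹ * (‖V' τ‖ ^ 2 / 2) := by
        rw [norm_mul, norm_mul, hω, norm_pow, Complex.norm_real, Real.norm_of_nonneg hμ.le, norm_smul,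
          norm_inv, norm_pow, Real.norm_of_nonneg hμ.le]
        field_simp
      have h3 : m i / (μ ^ 2 * ‖V τ‖) = (μ ^ 2)⁻¹ * (m i / ‖V τ‖) := by field_simp
      have h4 : ∑ j ∈ Finset.univ.erase i, m j / ‖η t - q j t‖ ≤ (∑ j, m j) * (2 / ρ) := by
        rw [Finset.sum_mul]
        refine (Finset.sum_le_sum fun j hj => ?_).trans
          (Finset.sum_le_sum_of_subset_of_nonneg (Finset.erase_subset _ _)
            fun j _ _ => mul_nonneg (hm j).le (by positivity))
        have h5 := hfar j (Finset.ne_of_mem_erase hj)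
        have h6 := (hm j).le
        calc m j / ‖η t - q j t‖ ≤ m j / (ρ / 2) := by gcongr
          _ = m j * (2 / ρ) := by field_simp
      have h5 := mul_le_mul_of_nonneg_left (hle τ hτt) (by positivity : 0 ≤ (1 + κ) * (μ ^ 2)⁻¹)
      have h6 : 0 ≤ κ * ((μ ^ 2)⁻¹ * (m i / ‖V τ‖)) := by have := (hm i).le; positivity
      rw [h2] at h1
      rw [h3]
      linarith
  refine ⟨isH1Path_of_hasDerivAt (by linarith) (fun t _ => hηd t) ?_, fun t ht => (hcf t ht).1, ?_⟩
  · have := hq.continuous_deriv i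
    exact Continuous.continuousOn (by fun_prop)
  · set G : ℝ → ℝ := fun t => (1 + κ) * ((μ ^ 2)⁻¹ * k ((t - t₀) / μ ^ 3)) +
        ((1 + 1 / κ) * P ^ 2 / 2 + (∑ j, m j) * (2 / ρ)) with hG
    have hGc : Continuous G := by fun_prop
    have h1 : lagInt m q η (t₀ - μ ^ 3) (t₀ + μ ^ 3) ≤
        ENNReal.ofReal (∫ t in Icc (t₀ - μ ^ 3) (t₀ + μ ^ 3), G t) := by
      rw [ofReal_integral_eq_lintegral_ofReal (hGc.continuousOn.integrableOn_compact isCompact_Icc)]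
      · refine setLIntegral_mono' measurableSet_Icc fun t ht => ?_
        rw [lagr_eq hm (hcf t ht).1]
        exact ENNReal.ofReal_le_ofReal (hcf t ht).2
      · rw [EventuallyLE, ae_restrict_iff' measurableSet_Icc]
        exact Eventually.of_forall fun t ht => (lagReal_nonneg hm η t).trans (hcf t ht).2
    refine h1.trans (ENNReal.ofReal_le_ofReal (le_of_eq ?_))
    rw [integral_Icc_eq_integral_Ioc, ← intervalIntegral.integral_of_le (by linarith), hG,
      intervalIntegral.integral_add (Continuous.intervalIntegrable (by fun_prop) _ _)
        intervalIntegrable_const, intervalIntegral.integral_const_mul,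
      intervalIntegral.integral_const_mul, intervalIntegral.integral_const,
      intervalIntegral.integral_comp_sub_right (fun t => k (t / μ ^ 3)),
      intervalIntegral.integral_comp_div _ hμ3.ne', add_sub_cancel_left, sub_sub_cancel_left,
      neg_div, div_self hμ3.ne', smul_eq_mul, smul_eq_mul]
    field_simp
    ring

/-! ### Lowering deformations on short intervals -/

lemma eventually_nhdsGT_pow_lt {n : ℕ} (hn : n ≠ 0) {x : ℝ} (hx : 0 < x) :
    ∀ᶠ μ : ℝ in 𝓝[>] 0, μ ^ n < x := by
  have : Tendsto (fun μ : ℝ => μ ^ n) (𝓝 0) (𝓝 (0 ^ n)) := (continuous_pow n).tendsto 0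
  rw [zero_pow hn] at this
  exact (this.mono_left nhdsWithin_le_nhds).eventually_lt_const hx

/-- The inequality holds at κ = 0 and is open. The factors are margins for the velocity of the
primary on both sides, for the affine correction of the arc and for the convergence in the
asymptotics. -/
lemma exists_gap {A S : ℝ} (h : A < S) :
    ∃ κ : ℝ, 0 < κ ∧ κ < 1 ∧ (1 + κ) * (A + 2 * κ) < (1 - κ) * ((1 - κ) * S) := by
  have h1 : ∀ᶠ κ : ℝ in 𝓝 0, (1 + κ) * (A + 2 * κ) < (1 - κ) * ((1 - κ) * S) := by
    refine ContinuousAt.eventually_lt (f := fun κ : ℝ => (1 + κ) * (A + 2 * κ))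
      (g := fun κ : ℝ => (1 - κ) * ((1 - κ) * S)) (by fun_prop) (by fun_prop) ?_
    simpa using h
  obtain ⟨κ, h2, h3⟩ := ((h1.filter_mono nhdsWithin_le_nhds).and
    (Ioo_mem_nhdsGT (zero_lt_one (α := ℝ)))).exists
  exact ⟨κ, h3.1, h3.2, h2⟩

lemma tendsto_sqrt_norm_div {f : ℝ → ℂ} {c : ℝ} {σ : ℂ} (hc : 0 ≤ c) (hσ : ‖σ‖ = 1)
    (h : Tendsto (fun μ => f μ / ((μ ^ 2 : ℝ) : ℂ)) (𝓝[>] 0) (𝓝 (c * σ))) :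
    Tendsto (fun μ => √‖f μ‖ / μ) (𝓝[>] 0) (𝓝 √c) := by
  have h1 := (Real.continuous_sqrt.tendsto _).comp h.norm
  rw [norm_mul, hσ, mul_one, Complex.norm_real, Real.norm_of_nonneg hc] at h1
  refine h1.congr' ?_
  filter_upwards [self_mem_nhdsWithin] with μ hμ
  have hμ0 : 0 < μ := hμ
  rw [Function.comp_apply, norm_div, Complex.norm_real, Real.norm_of_nonneg (by positivity),
    Real.sqrt_div (norm_nonneg _), Real.sqrt_sq hμ0.le]

/-- Near the collision there is a path of smaller action, on the prescribed side. -/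
lemma IsCollisionEjection.exists_deformation {i : Fin N} {t₀ δ : ℝ} {γ : ℝ → ℂ}
    (hγ : IsCollisionEjection m q i t₀ δ γ) (hm : ∀ i, 0 < m i) (hq : IsCollisionFreePeriodic m q)
    (hδ : 0 < δ) {c φ : ℝ} {ω : ℂ} (hc0 : 0 < c) (hc : m i = 2 * c ^ 3 / 9) (hω : ‖ω‖ = 1)
    (hφ : φ ≠ 0) (hφπ : |φ| < Real.pi)
    (hp : Tendsto (fun μ => (γ (t₀ + 1 * μ ^ 3) - q i (t₀ + 1 * μ ^ 3)) / ((μ ^ 2 : ℝ) : ℂ)) (𝓝[>] 0)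
      (𝓝 (c * (ω * Complex.exp (φ * Complex.I)))))
    (hn : Tendsto (fun μ => (γ (t₀ + -1 * μ ^ 3) - q i (t₀ + -1 * μ ^ 3)) / ((μ ^ 2 : ℝ) : ℂ))
      (𝓝[>] 0) (𝓝 (c * (ω * Complex.exp (-φ * Complex.I)))))
    {d ε : ℝ} (hd : 0 < d) (hε : 0 < ε) :
    ∃ s, 0 < s ∧ s < d ∧ ∃ η : ℝ → ℂ, IsH1Path η (t₀ - s) (t₀ + s) ∧ η (t₀ - s) = γ (t₀ - s) ∧
      η (t₀ + s) = γ (t₀ + s) ∧ (∀ t ∈ Icc (t₀ - s) (t₀ + s), CollisionFreeAt q η t ∧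
        ‖η t - γ t‖ ≤ ε ∧ (η t - q i t) / ω ∈ Complex.slitPlane) ∧
      lagInt m q η (t₀ - s) (t₀ + s) < lagInt m q γ (t₀ - s) (t₀ + s) := by
  have hω0 : ω ≠ 0 := norm_ne_zero_iff.1 (by rw [hω]; exact one_ne_zero)
  obtain ⟨ρ, hρ, hsep⟩ := hq.separated
  obtain ⟨P, hP⟩ := (isCompact_Icc (a := t₀ - δ) (b := t₀ + δ)).exists_bound_of_continuousOn
    (hq.continuous_deriv i).continuousOn
  obtain ⟨W, W', hW, hW', hslit, hW1, hW2, hWA⟩ := exists_parabolic_arc hc0 hc hφ hφπ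
  have hWc : Continuous W := continuous_iff_continuousAt.2 fun t => (hW t).continuousAt
  obtain ⟨D, hD⟩ := (isCompact_Icc (a := (-1 : ℝ)) (b := 1)).exists_bound_of_continuousOn
    hWc.continuousOn
  have hD0 : 0 ≤ D := (norm_nonneg _).trans (hD 0 (by norm_num))
  have hkc : Continuous fun τ => ‖W' τ‖ ^ 2 / 2 + m i / ‖W τ‖ :=
    (by fun_prop : Continuous fun τ => ‖W' τ‖ ^ 2 / 2).add
      (continuous_const.div₀ hWc.norm fun τ => norm_ne_zero_iff.2 (Complex.slitPlane_ne_zero (hslit τ)))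
  set A := ∫ τ in (-1)..1, (‖W' τ‖ ^ 2 / 2 + m i / ‖W τ‖) with hA
  obtain ⟨κ, hκ, hκ1, hgap⟩ := exists_gap hWA
  set S := 8 * c ^ 2 / 3 with hS
  set K := (1 + 1 / κ) * P ^ 2 + 4 * (∑ j, m j) / ρ + P ^ 2 / κ with hK
  set fp : ℝ → ℂ := fun μ => γ (t₀ + 1 * μ ^ 3) - q i (t₀ + 1 * μ ^ 3) with hfp
  set fn : ℝ → ℂ := fun μ => γ (t₀ + -1 * μ ^ 3) - q i (t₀ + -1 * μ ^ 3) with hfn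
  -- The mismatches at the two ends between the rescaled solution and the model arc. Their half-sum
  -- and half-difference are the coefficients of the affine correction, so the corrected arc has
  -- exactly the ends of the solution.
  set x : ℝ → ℂ := fun μ => fp μ / ((μ ^ 2 : ℝ) : ℂ) / ω - W 1 with hx
  set y : ℝ → ℂ := fun μ => fn μ / ((μ ^ 2 : ℝ) : ℂ) / ω - W (-1) with hy
  have hx0 : Tendsto x (𝓝[>] 0) (𝓝 0) := by
    have := (hp.div_const ω).sub_const (W 1)
    rwa [hW1, mul_left_comm, mul_div_cancel_left₀ _ hω0, sub_self, ← hW1] at this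
  have hy0 : Tendsto y (𝓝[>] 0) (𝓝 0) := by
    have := (hn.div_const ω).sub_const (W (-1))
    rwa [hW2, mul_left_comm, mul_div_cancel_left₀ _ hω0, sub_self, ← hW2] at this
  have hxy : Tendsto (fun μ => ((x μ + y μ) / 2, (x μ - y μ) / 2)) (𝓝[>] 0) (𝓝 (0 : ℂ × ℂ)) := by
    have := ((hx0.add hy0).div_const 2).prodMk_nhds ((hx0.sub hy0).div_const 2)
    rw [add_zero, sub_zero, zero_div] at this
    exact this
  have e1 := hxy.eventually (eventually_affine_perturbation hW hW' hslit (m i) hκ)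
  have hσ : ∀ x : ℝ, ‖ω * Complex.exp (x * Complex.I)‖ = 1 := fun x => by
    rw [norm_mul, hω, Complex.norm_exp_ofReal_mul_I, one_mul]
  -- For the homothetic parabolic path Maupertuis' inequality is an equality, so its lower bound is
  -- exactly the action 8c²/3 with which the arc is compared.
  have hSeq : 2 * √(2 * m i) * (√c + √c) = S := by
    have h1 : 2 * m i * c = (2 * c ^ 2 / 3) ^ 2 := by rw [hc]; ring
    have h2 : √(2 * m i) * √c = 2 * c ^ 2 / 3 := by
      rw [← Real.sqrt_mul (by have := hm i; positivity), h1, Real.sqrt_sq (by positivity)]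
    rw [hS]
    linarith
  have hS0 : 0 < S := by positivity
  have e2 : ∀ᶠ μ in 𝓝[>] 0, (1 - κ) * S < 2 * √(2 * m i) * (√‖fp μ‖ / μ + √‖fn μ‖ / μ) := by
    have h1 := tendsto_sqrt_norm_div hc0.le (hσ φ) hp
    have h2 := tendsto_sqrt_norm_div hc0.le (hσ (-φ)) (f := fn)
      (by rw [Complex.ofReal_neg]; exact hn)
    refine ((h1.add h2).const_mul (2 * √(2 * m i))).eventually_const_lt ?_
    rw [hSeq]
    have := mul_pos hκ hS0
    linarith
  have e3 : ∀ᶠ μ : ℝ in 𝓝[>] 0, μ ^ 2 * (D + 1) ≤ min (ρ / 2) (ε / 2) := by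
    filter_upwards [eventually_nhdsGT_pow_lt (n := 2) two_ne_zero
      (x := min (ρ / 2) (ε / 2) / (D + 1)) (by positivity)] with μ hμ
    exact ((lt_div_iff₀ (by positivity)).1 hμ).le
  obtain ⟨τ, hτ, hclose⟩ := Metric.eventually_nhds_iff.1
    ((hγ.tendsto_sub hq hδ).norm.eventually_lt_const (show ‖(0 : ℂ)‖ < ε / 2 by simpa using hε))
  have e4 : ∀ᶠ μ : ℝ in 𝓝[>] 0, μ ^ 3 < min τ (min δ d) :=
    eventually_nhdsGT_pow_lt (by norm_num) (lt_min hτ (lt_min hδ hd))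
  have e5 : ∀ᶠ μ : ℝ in 𝓝[>] 0,
      μ ^ 2 * K < (1 - κ) * ((1 - κ) * S) - (1 + κ) * (A + 2 * κ) := by
    have hK0 : 0 ≤ K := by
      have : 0 ≤ ∑ j, m j := Finset.sum_nonneg fun j _ => (hm j).le
      positivity
    filter_upwards [eventually_nhdsGT_pow_lt (n := 2) two_ne_zero
      (x := ((1 - κ) * ((1 - κ) * S) - (1 + κ) * (A + 2 * κ)) / (K + 1))
      (div_pos (by linarith) (by positivity))] with μ hμ
    rw [lt_div_iff₀ (by positivity)] at hμ
    linarith [sq_nonneg μ]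
  obtain ⟨μ, h1, h2, h3, h4, h5, hμ⟩ :=
    (e1.and (e2.and (e3.and (e4.and (e5.and self_mem_nhdsWithin))))).exists
  replace hμ : 0 < μ := hμ
  have hμ3 : 0 < μ ^ 3 := by positivity
  have hμτ : μ ^ 3 < τ := h4.trans_le (min_le_left _ _)
  have hμδ : μ ^ 3 < δ := h4.trans_le ((min_le_right _ _).trans (min_le_left _ _))
  have hμd : μ ^ 3 < d := h4.trans_le ((min_le_right _ _).trans (min_le_right _ _))
  set V : ℝ → ℂ := fun t => W t + ((x μ + y μ) / 2 + t * ((x μ - y μ) / 2)) with hV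
  have hVd : ∀ t, HasDerivAt V (W' t + (x μ - y μ) / 2) t := fun t => by
    refine ((hW t).fun_add (((hasDerivAt_ofReal (hasDerivAt_id t)).mul_const _).const_add _)).congr_deriv
      ?_
    simp
  have hVn : ∀ t ∈ Icc (-1 : ℝ) 1, μ ^ 2 * ‖V t‖ ≤ min (ρ / 2) (ε / 2) := fun t ht => by
    refine le_trans ?_ h3
    have := (h1 t ht).2.1.le
    have := hD t ht
    gcongr
    linarith
  obtain ⟨g1, g2, g3⟩ := lagInt_rescaled_le hm hq (i := i) (t₀ := t₀) (P := P) (ω := ω) (V := V)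
    (k := fun τ => ‖W' τ‖ ^ 2 / 2 + m i / ‖W τ‖ + κ) hκ hμ
    (fun t ht => hP t ⟨by linarith [ht.1], by linarith [ht.2]⟩) hρ hsep hω hVd (by fun_prop)
    (hkc.add continuous_const) (fun t ht => Complex.slitPlane_ne_zero (h1 t ht).1)
    (fun t ht => (hVn t ht).trans (min_le_left _ _)) (fun t ht => (h1 t ht).2.2.le)
  set η : ℝ → ℂ := fun t => q i t + ω * μ ^ 2 * V ((t - t₀) / μ ^ 3) with hη
  have hμC : (μ : ℂ) ≠ 0 := Complex.ofReal_ne_zero.2 hμ.ne'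
  refine ⟨μ ^ 3, hμ3, hμd, η, g1, ?_, ?_, fun t ht => ⟨g2 t ht, ?_, ?_⟩, g3.trans_lt ?_⟩
  · have : (t₀ - μ ^ 3 - t₀) / μ ^ 3 = -1 := by field_simp; ring
    simp only [hη, this, hV, hy, hx]
    push_cast
    field_simp
    simp only [hfn, neg_mul, one_mul, ← sub_eq_add_neg]
    ring
  · have : (t₀ + μ ^ 3 - t₀) / μ ^ 3 = 1 := by field_simp; ring
    simp only [hη, this, hV, hy, hx]
    push_cast
    field_simp
    simp only [hfp, one_mul]
    ring
  · have ht' : (t - t₀) / μ ^ 3 ∈ Icc (-1 : ℝ) 1 := by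
      rw [mem_Icc, le_div_iff₀ hμ3, div_le_iff₀ hμ3]
      constructor <;> linarith [ht.1, ht.2]
    have h6 : ‖γ t - q i t‖ < ε / 2 := by
      refine hclose ?_
      rw [Real.dist_eq, abs_lt]
      constructor <;> linarith [ht.1, ht.2]
    have h7 : ‖ω * μ ^ 2 * V ((t - t₀) / μ ^ 3)‖ ≤ ε / 2 := by
      rw [norm_mul, norm_mul, hω, norm_pow, Complex.norm_real, Real.norm_of_nonneg hμ.le, one_mul]
      exact (hVn _ ht').trans (min_le_right _ _)
    have h8 := norm_sub_le (ω * μ ^ 2 * V ((t - t₀) / μ ^ 3)) (γ t - q i t)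
    rw [show η t - γ t = ω * μ ^ 2 * V ((t - t₀) / μ ^ 3) - (γ t - q i t) by simp only [hη]; ring]
    linarith
  · have ht' : (t - t₀) / μ ^ 3 ∈ Icc (-1 : ℝ) 1 := by
      rw [mem_Icc, le_div_iff₀ hμ3, div_le_iff₀ hμ3]
      constructor <;> linarith [ht.1, ht.2]
    have h6 : (η t - q i t) / ω = ((μ ^ 2 : ℝ) : ℂ) * V ((t - t₀) / μ ^ 3) := by
      simp only [hη]
      push_cast
      field_simp
      ring
    rw [h6]
    have h7 := (h1 _ ht').1
    have hμ2 : 0 < μ ^ 2 := by positivity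
    rw [Complex.mem_slitPlane_iff, Complex.re_ofReal_mul, Complex.im_ofReal_mul]
    exact h7.imp (fun h => mul_pos hμ2 h) fun h => mul_ne_zero hμ2.ne' h
  · refine lt_of_lt_of_le ?_ (hγ.le_lagInt hm hq hκ hκ1 hP hμ3 hμδ.le)
    have hkint : ∫ τ in (-1)..1, (‖W' τ‖ ^ 2 / 2 + m i / ‖W τ‖ + κ) = A + 2 * κ := by
      rw [intervalIntegral.integral_add (hkc.intervalIntegrable _ _) intervalIntegrable_const,
        intervalIntegral.integral_const, smul_eq_mul]
      ring
    rw [hkint]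
    have hB : (1 - κ) * S * μ < 2 * √(2 * m i) * (√‖γ (t₀ + μ ^ 3) - q i (t₀ + μ ^ 3)‖ +
        √‖γ (t₀ - μ ^ 3) - q i (t₀ - μ ^ 3)‖) := by
      simp only [hfp, hfn, one_mul, neg_mul, ← sub_eq_add_neg] at h2
      rwa [← add_div, ← mul_div_assoc (2 * √(2 * m i)), lt_div_iff₀ hμ] at h2
    have h6 := mul_lt_mul_of_pos_left hB (sub_pos.2 hκ1)
    have h7 := mul_lt_mul_of_pos_left h5 hμ
    have h8 : (1 + κ) * (μ * (A + 2 * κ)) + μ ^ 3 * ((1 + 1 / κ) * P ^ 2 + 4 * (∑ j, m j) / ρ) <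
        (1 - κ) * (2 * √(2 * m i) * (√‖γ (t₀ + μ ^ 3) - q i (t₀ + μ ^ 3)‖ +
        √‖γ (t₀ - μ ^ 3) - q i (t₀ - μ ^ 3)‖)) - μ ^ 3 * (P ^ 2 / κ) := by
      have h9 : μ * (μ ^ 2 * K) = μ ^ 3 * ((1 + 1 / κ) * P ^ 2 + 4 * (∑ j, m j) / ρ) +
        μ ^ 3 * (P ^ 2 / κ) := by rw [hK]; ring
      rw [h9] at h7
      linarith
    refine (ENNReal.ofReal_lt_ofReal_iff_of_nonneg ?_).2 h8
    have h9 : 0 ≤ A + 2 * κ := by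
      rw [← hkint]
      refine intervalIntegral.integral_nonneg (by norm_num) fun τ _ => ?_
      have := (hm i).le
      positivity
    have : 0 ≤ ∑ j, m j := Finset.sum_nonneg fun j _ => (hm j).le
    positivity

/-! ### Variation of the argument -/

/-- After rotation by the inverse of ω the path stays off the cut of the principal argument, which
then is a continuous determination along it. Its variation is read off at the ends. -/
lemma argVariationIn_of_slitPlane {η p : ℝ → ℂ} {a b : ℝ} {ω : ℂ} {S : Set ℝ} (hω : ‖ω‖ = 1)
    (hη : ContinuousOn η (Icc a b)) (hp : Continuous p)
    (hs : ∀ t ∈ Icc a b, (η t - p t) / ω ∈ Complex.slitPlane)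
    (hS : Complex.arg ((η b - p b) / ω) - Complex.arg ((η a - p a) / ω) ∈ S) :
    ArgVariationIn η p a b S := by
  have hω0 : ω ≠ 0 := norm_ne_zero_iff.1 (by rw [hω]; exact one_ne_zero)
  refine ⟨fun t => Complex.arg ((η t - p t) / ω) + Complex.arg ω, fun t ht => ?_, fun t _ => ?_, ?_⟩
  · have h1 : ContinuousWithinAt (fun t => (η t - p t) / ω) (Icc a b) t :=
      ((hη t ht).sub hp.continuousWithinAt).div_const _
    have h2 : ContinuousWithinAt (fun t => Complex.arg ((η t - p t) / ω)) (Icc a b) t :=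
      (Complex.continuousAt_arg (hs t ht)).tendsto.comp h1
    exact h2.add continuousWithinAt_const
  · have h1 := Complex.norm_mul_exp_arg_mul_I ((η t - p t) / ω)
    have h2 := Complex.norm_mul_exp_arg_mul_I ω
    rw [hω, Complex.ofReal_one, one_mul] at h2
    rw [norm_div, hω, div_one] at h1
    rw [Complex.ofReal_add, add_mul, Complex.exp_add, ← mul_assoc, h1, h2, div_mul_cancel₀ _ hω0]
  · simpa using hS

/-- The variation of the argument of a path without zeros is unique. -/
lemma argVariation_unique {η η' p : ℝ → ℂ} {a b : ℝ} (hab : a ≤ b)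
    (h0 : ∀ t ∈ Icc a b, η t ≠ p t) (heq : ∀ t ∈ Icc a b, η t = η' t) {θ θ' : ℝ → ℝ}
    (hθ : ContinuousOn θ (Icc a b)) (hθ' : ContinuousOn θ' (Icc a b))
    (h1 : ∀ t ∈ Icc a b, η t - p t = (‖η t - p t‖ : ℂ) * Complex.exp ((θ t : ℂ) * Complex.I))
    (h2 : ∀ t ∈ Icc a b, η' t - p t = (‖η' t - p t‖ : ℂ) * Complex.exp ((θ' t : ℂ) * Complex.I)) :
    θ b - θ a ≤ θ' b - θ' a := by
  by_contra! hlt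
  set f : ℝ → ℝ := fun t => θ t - θ' t with hf
  have hfc : ContinuousOn f (Icc a b) := hθ.sub hθ'
  have hexp : ∀ t ∈ Icc a b, Complex.exp ((f t : ℂ) * Complex.I) = 1 := by
    intro t ht
    have h3 : (‖η t - p t‖ : ℂ) ≠ 0 :=
      Complex.ofReal_ne_zero.2 (norm_ne_zero_iff.2 (sub_ne_zero.2 (h0 t ht)))
    have h4 := h2 t ht
    rw [← heq t ht, h1 t ht, norm_mul, Complex.norm_exp_ofReal_mul_I, mul_one, Complex.norm_real,
      norm_norm] at h4
    rw [hf, Complex.ofReal_sub, sub_mul, Complex.exp_sub, mul_left_cancel₀ h3 h4,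
      div_self (Complex.exp_ne_zero _)]
  -- The two determinations differ by multiples of 2π. An unequal variation would, by the
  -- intermediate value theorem, produce an increment of this difference in (0, π], whose cosine
  -- cannot be 1.
  set x := min Real.pi (f b - f a) with hx
  have hx0 : 0 < x := lt_min Real.pi_pos (by simp only [hf]; linarith)
  have hxπ : x ≤ Real.pi := min_le_left _ _
  obtain ⟨t, ht, hft⟩ := intermediate_value_Icc hab hfc
    (show f a + x ∈ Icc (f a) (f b) from ⟨by linarith, by linarith [min_le_right Real.pi (f b - f a)]⟩)
  have h3 := hexp t ht
  rw [hft, Complex.ofReal_add, add_mul, Complex.exp_add, hexp a (left_mem_Icc.2 hab), one_mul] at h3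
  have h4 : Real.cos x = 1 := by
    rw [← Complex.exp_ofReal_mul_I_re, h3, Complex.one_re]
  have := (Real.cos_eq_one_iff_of_lt_of_lt (by linarith) (by linarith [Real.pi_pos])).1 h4
  linarith

/-- Two distinct directions `σ₋`, `σ₊` determine a bisecting direction `ω`, from which one turns by
`∓ φ ∈ (-π, π)` to reach them. -/
lemma exists_bisector {σm σp : ℂ} (hm : ‖σm‖ = 1) (hp : ‖σp‖ = 1) (hne : σm ≠ σp) :
    ∃ (ω : ℂ) (φ : ℝ), ‖ω‖ = 1 ∧ 0 < φ ∧ φ < Real.pi ∧ σp = ω * Complex.exp (φ * Complex.I) ∧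
      σm = ω * Complex.exp (-φ * Complex.I) := by
  have hm0 : σm ≠ 0 := norm_ne_zero_iff.1 (by rw [hm]; exact one_ne_zero)
  -- The counterclockwise angle from σ₋ to σ₊, taken in (0, 2π). Half of it is φ.
  obtain ⟨α, h0, h1, h2⟩ : ∃ α : ℝ, 0 < α ∧ α < 2 * Real.pi ∧
      Complex.exp (α * Complex.I) = σp / σm := by
    have h3 := Complex.norm_mul_exp_arg_mul_I (σp / σm)
    rw [norm_div, hm, hp, div_one, Complex.ofReal_one, one_mul] at h3
    have h4 := Complex.arg_le_pi (σp / σm)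
    have h5 := Complex.neg_pi_lt_arg (σp / σm)
    rcases lt_trichotomy (Complex.arg (σp / σm)) 0 with h | h | h
    · refine ⟨Complex.arg (σp / σm) + 2 * Real.pi, by linarith, by linarith, ?_⟩
      rw [Complex.ofReal_add, add_mul, Complex.exp_add, h3]
      push_cast
      rw [Complex.exp_two_pi_mul_I, mul_one]
    · rw [h, Complex.ofReal_zero, zero_mul, Complex.exp_zero, eq_div_iff hm0, one_mul] at h3
      exact absurd h3 hne
    · exact ⟨Complex.arg (σp / σm), h, by linarith [Real.pi_pos], h3⟩
  refine ⟨σm * Complex.exp ((α / 2 : ℝ) * Complex.I), α / 2, ?_, by linarith, by linarith, ?_, ?_⟩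
  · rw [norm_mul, hm, Complex.norm_exp_ofReal_mul_I, one_mul]
  · rw [mul_assoc, ← Complex.exp_add, ← add_mul, ← Complex.ofReal_add, add_halves, h2,
      mul_div_cancel₀ _ hm0]
  · rw [mul_assoc, ← Complex.exp_add, ← add_mul, add_neg_cancel, zero_mul, Complex.exp_zero, mul_one]

lemma arg_exp_mul_I_of_abs_lt {ψ : ℝ} (h : |ψ| < Real.pi) :
    Complex.arg (Complex.exp (ψ * Complex.I)) = ψ := by
  rw [Complex.exp_mul_I]
  exact Complex.arg_cos_add_sin_mul_I ⟨(abs_lt.1 h).1, (abs_lt.1 h).2.le⟩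

/-- Near a collision the argument is close to that of the limit direction. -/
lemma eventually_arg_sub_lt {γ p : ℝ → ℂ} {f : ℝ → ℝ} {l : Filter ℝ} {ω : ℂ} {ψ τ : ℝ}
    (hω : ‖ω‖ = 1) (hψ : |ψ| < Real.pi) (hτ : 0 < τ)
    (h : Tendsto (fun s => direction γ p (f s)) l (𝓝 (ω * Complex.exp (ψ * Complex.I)))) :
    ∀ᶠ s in l, (γ (f s) - p (f s)) / ω ∈ Complex.slitPlane ∧
      |Complex.arg ((γ (f s) - p (f s)) / ω) - ψ| < τ := by
  have hω0 : ω ≠ 0 := norm_ne_zero_iff.1 (by rw [hω]; exact one_ne_zero)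
  have hslit : Complex.exp (ψ * Complex.I) ∈ Complex.slitPlane := by
    rw [Complex.mem_slitPlane_iff_arg, arg_exp_mul_I_of_abs_lt hψ]
    exact ⟨(abs_lt.1 hψ).2.ne, Complex.exp_ne_zero _⟩
  have h1 := h.div_const ω
  rw [mul_div_cancel_left₀ _ hω0] at h1
  have h2 := ((Complex.continuousAt_arg hslit).tendsto.comp h1).sub_const ψ
  rw [arg_exp_mul_I_of_abs_lt hψ, sub_self] at h2
  filter_upwards [h1.eventually_mem (Complex.isOpen_slitPlane.mem_nhds hslit),
    h2.abs.eventually_lt_const (show |(0 : ℝ)| < τ by simpa using hτ)] with s h3 h4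
  have h5 : 0 < ‖γ (f s) - p (f s)‖ := by
    rw [norm_pos_iff]
    intro h6
    rw [direction, h6, zero_div, zero_div] at h3
    exact Complex.slitPlane_ne_zero h3 rfl
  have h6 : (γ (f s) - p (f s)) / ω = (‖γ (f s) - p (f s)‖ : ℂ) * (direction γ p (f s) / ω) := by
    rw [direction, ← mul_div_assoc, mul_div_cancel₀ _ (Complex.ofReal_ne_zero.2 h5.ne')]
  rw [h6, Complex.arg_real_mul _ h5]
  refine ⟨?_, h4⟩
  rw [Complex.mem_slitPlane_iff, Complex.re_ofReal_mul, Complex.im_ofReal_mul]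
  rw [Complex.mem_slitPlane_iff] at h3
  exact h3.imp (fun h => mul_pos h5 h) fun h => mul_ne_zero h5.ne' h

/-! ### Extension of deformations -/

lemma IsH1Path.lagInt_ne_top {γ : ℝ → ℂ} {a b : ℝ} (hγ : IsH1Path γ a b) (hm : ∀ i, 0 < m i)
    (hq : ∀ i, Continuous (q i)) (hcf : ∀ t ∈ Icc a b, CollisionFreeAt q γ t) :
    lagInt m q γ a b ≠ ⊤ := by
  have h1 : IntegrableOn (lagReal m q γ) (Icc a b) := by
    refine (hγ.integrable_sq.div_const 2).add (ContinuousOn.integrableOn_compact isCompact_Icc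
      (f := fun t => ∑ i, m i / ‖γ t - q i t‖) ?_)
    refine continuousOn_finsetSum _ fun i _ => continuousOn_const.div₀
      (hγ.continuousOn.sub (hq i).continuousOn).norm fun t ht => ?_
    exact norm_ne_zero_iff.2 (sub_ne_zero.2 (hcf t ht i))
  have h2 : lagInt m q γ a b = ∫⁻ t in Icc a b, ENNReal.ofReal (lagReal m q γ t) :=
    setLIntegral_congr_fun measurableSet_Icc fun t ht => lagr_eq hm (hcf t ht)
  rw [h2]
  exact h1.lintegral_lt_top.ne

namespace IsCollisionEjection

variable {i : Fin N} {t₀ δ : ℝ} {γ : ℝ → ℂ}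

lemma mono (hγ : IsCollisionEjection m q i t₀ δ γ) {δ' : ℝ} (h0 : 0 < δ') (h : δ' ≤ δ) :
    IsCollisionEjection m q i t₀ δ' γ :=
  ⟨hγ.h1.mono (by linarith) (by linarith) (by linarith), hγ.collision,
    fun t ht => hγ.collisionFree t ⟨by linarith [ht.1], by linarith [ht.2]⟩,
    fun t ht => hγ.solves t ⟨by linarith [ht.1], by linarith [ht.2]⟩⟩

/-- Away from the collision the action is finite. -/
lemma lintegral_ne_top (hγ : IsCollisionEjection m q i t₀ δ γ) (hm : ∀ i, 0 < m i)
    (hq : ∀ i, Continuous (q i)) {s : ℝ} (hs : 0 < s) (hsδ : s ≤ δ) :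
    ∫⁻ t in Icc (t₀ - δ) (t₀ + δ) \ Icc (t₀ - s) (t₀ + s), lagr m q γ t ≠ ⊤ := by
  have h1 : Icc (t₀ - δ) (t₀ + δ) \ Icc (t₀ - s) (t₀ + s) ⊆
      Icc (t₀ - δ) (t₀ - s) ∪ Icc (t₀ + s) (t₀ + δ) := by
    rintro t ⟨ht, hts⟩
    rcases le_or_gt t (t₀ - s) with h | h
    · exact Or.inl ⟨ht.1, h⟩
    · refine Or.inr ⟨le_of_not_gt fun h' => hts ⟨h.le, h'.le⟩, ht.2⟩
  have h2 : lagInt m q γ (t₀ - δ) (t₀ - s) ≠ ⊤ :=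
    (hγ.h1.mono le_rfl (by linarith) (by linarith)).lagInt_ne_top hm hq fun t ht =>
      hγ.collisionFree t ⟨ht.1, by linarith [ht.2]⟩ (by linarith [ht.2] : t < t₀).ne
  have h3 : lagInt m q γ (t₀ + s) (t₀ + δ) ≠ ⊤ :=
    (hγ.h1.mono (by linarith) (by linarith) le_rfl).lagInt_ne_top hm hq fun t ht =>
      hγ.collisionFree t ⟨by linarith [ht.1], ht.2⟩ (by linarith [ht.1] : t₀ < t).ne'
  exact ne_top_of_le_ne_top (ENNReal.add_ne_top.2 ⟨h2, h3⟩)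
    ((lintegral_mono_set h1).trans (lintegral_union_le _ _ _))

/-- A path near the collision of smaller action gives a lowering deformation. -/
lemma isLoweringDeformation_splice (hγ : IsCollisionEjection m q i t₀ δ γ) (hm : ∀ i, 0 < m i)
    (hq : ∀ i, Continuous (q i)) {h s ε : ℝ} {η : ℝ → ℂ} (hs : 0 < s) (hsδ : s ≤ δ) (hε : 0 < ε)
    (h1 : IsH1Path η (t₀ - s) (t₀ + s)) (h2 : η (t₀ - s) = γ (t₀ - s))
    (h3 : η (t₀ + s) = γ (t₀ + s))
    (h4 : ∀ t ∈ Icc (t₀ - s) (t₀ + s), CollisionFreeAt q η t ∧ ‖η t - γ t‖ ≤ ε)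
    (h5 : lagInt m q η (t₀ - s) (t₀ + s) < lagInt m q γ (t₀ - s) (t₀ + s)) :
    IsLoweringDeformation m q h (t₀ - δ) (t₀ + δ) ε γ (splice γ η (t₀ - s) (t₀ + s)) := by
  refine ⟨⟨isH1Path_splice hγ.h1 h1 (by linarith) (by linarith) (by linarith) h2 h3,
    splice_eq_of_le h2 (by linarith) (by linarith), splice_eq_of_ge h3 (by linarith) (by linarith)⟩,
    -- Only the action away from the collision has to be finite for the strict inequality to survive
    -- the splice.
    fun t ht => ?_, action_lt_action (lagInt_splice_lt (by linarith) (by linarith)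
      (hγ.lintegral_ne_top hm hq hs hsδ) h5), fun t ht => ?_⟩
  · by_cases hts : t ∈ Icc (t₀ - s) (t₀ + s)
    · intro j
      rw [splice_of_mem hts]
      exact (h4 t hts).1 j
    · intro j
      rw [splice_of_notMem hts]
      refine hγ.collisionFree t ht (fun h => hts ?_) j
      rw [h]
      constructor <;> linarith
  · by_cases hts : t ∈ Icc (t₀ - s) (t₀ + s)
    · rw [splice_of_mem hts]
      exact (h4 t hts).2
    · rw [splice_of_notMem hts, sub_self, norm_zero]
      exact hε.le

/-- Lowering deformations which pass the primary on the side of `ω`. -/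
lemma exists_loweringDeformation (hγ : IsCollisionEjection m q i t₀ δ γ) (hm : ∀ i, 0 < m i)
    (hq : IsCollisionFreePeriodic m q) (hδ : 0 < δ) {c φ : ℝ} {ω : ℂ} (hc0 : 0 < c)
    (hc : m i = 2 * c ^ 3 / 9) (hω : ‖ω‖ = 1) (hφ : φ ≠ 0) (hφπ : |φ| < Real.pi)
    (hp : Tendsto (fun μ => (γ (t₀ + 1 * μ ^ 3) - q i (t₀ + 1 * μ ^ 3)) / ((μ ^ 2 : ℝ) : ℂ)) (𝓝[>] 0)
      (𝓝 (c * (ω * Complex.exp (φ * Complex.I)))))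
    (hn : Tendsto (fun μ => (γ (t₀ + -1 * μ ^ 3) - q i (t₀ + -1 * μ ^ 3)) / ((μ ^ 2 : ℝ) : ℂ))
      (𝓝[>] 0) (𝓝 (c * (ω * Complex.exp (-φ * Complex.I)))))
    (hp' : Tendsto (fun s => direction γ (q i) (t₀ + 1 * s)) (𝓝[>] 0)
      (𝓝 (ω * Complex.exp (φ * Complex.I))))
    (hn' : Tendsto (fun s => direction γ (q i) (t₀ + -1 * s)) (𝓝[>] 0)
      (𝓝 (ω * Complex.exp (-φ * Complex.I))))
    {S : Set ℝ} (hS : ∀ x, |x - 2 * φ| < 2 * min |φ| (Real.pi - |φ|) → x ∈ S) (h : ℝ) :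
    ∃ δ₀, 0 < δ₀ ∧ δ₀ ≤ δ ∧ ∀ δ', 0 < δ' → δ' ≤ δ₀ → ∀ ε, 0 < ε → ∃ η : ℝ → ℂ,
      IsLoweringDeformation m q h (t₀ - δ') (t₀ + δ') ε γ η ∧
      ArgVariationIn η (q i) (t₀ - δ') (t₀ + δ') S := by
  -- The tolerance for each end. An error below twice this amount cannot move 2φ out of (0, 2π) if φ
  -- > 0, or out of (-2π, 0) if φ < 0.
  have hτ : 0 < min |φ| (Real.pi - |φ|) := lt_min (abs_pos.2 hφ) (sub_pos.2 hφπ)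
  have hev := (eventually_arg_sub_lt hω hφπ hτ hp').and
    (eventually_arg_sub_lt (ψ := -φ) hω (by rwa [abs_neg]) hτ (by rwa [Complex.ofReal_neg]))
  obtain ⟨δ₁, hδ₁, hsub⟩ := mem_nhdsGT_iff_exists_Ioc_subset.1 hev
  have hδ₁0 : (0 : ℝ) < δ₁ := hδ₁
  refine ⟨min δ δ₁, lt_min hδ hδ₁0, min_le_left _ _, fun δ' hδ' hle ε hε => ?_⟩
  have hδδ : δ' ≤ δ := hle.trans (min_le_left _ _)
  obtain ⟨s, hs, hsd, η, h1, h2, h3, h4, h5⟩ :=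
    hγ.exists_deformation hm hq hδ hc0 hc hω hφ hφπ hp hn hδ' hε
  have hγ' := hγ.mono hδ' hδδ
  have hdef := hγ'.isLoweringDeformation_splice (h := h) hm hq.continuous hs hsd.le hε h1 h2 h3
    (fun t ht => ⟨(h4 t ht).1, (h4 t ht).2.1⟩) h5
  have hside : ∀ x : ℝ, 0 < x → x ≤ δ' →
      ((γ (t₀ + 1 * x) - q i (t₀ + 1 * x)) / ω ∈ Complex.slitPlane ∧
      |Complex.arg ((γ (t₀ + 1 * x) - q i (t₀ + 1 * x)) / ω) - φ| < min |φ| (Real.pi - |φ|)) ∧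
      (γ (t₀ + -1 * x) - q i (t₀ + -1 * x)) / ω ∈ Complex.slitPlane ∧
      |Complex.arg ((γ (t₀ + -1 * x) - q i (t₀ + -1 * x)) / ω) - -φ| < min |φ| (Real.pi - |φ|) :=
    fun x hx hxδ => hsub ⟨hx, hxδ.trans (hle.trans (min_le_right _ _))⟩
  refine ⟨_, hdef, argVariationIn_of_slitPlane hω hdef.mem.1.continuousOn (hq.continuous i)
    (fun t ht => ?_) (hS _ ?_)⟩
  · by_cases hts : t ∈ Icc (t₀ - s) (t₀ + s)
    · rw [splice_of_mem hts]
      exact (h4 t hts).2.2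
    · rw [splice_of_notMem hts]
      rcases lt_trichotomy t t₀ with hlt | heq | hlt
      · have := (hside (t₀ - t) (by linarith) (by linarith [ht.1])).2.1
        rwa [show t₀ + -1 * (t₀ - t) = t by ring] at this
      · exact absurd ⟨by linarith, by linarith⟩ hts
      · have := (hside (t - t₀) (by linarith) (by linarith [ht.2])).1.1
        rwa [show t₀ + 1 * (t - t₀) = t by ring] at this
  · obtain ⟨⟨-, h6⟩, -, h7⟩ := hside δ' hδ' le_rfl
    rw [hdef.mem.2.1, hdef.mem.2.2]
    rw [one_mul] at h6
    rw [neg_one_mul, ← sub_eq_add_neg] at h7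
    rw [abs_lt] at h6 h7 ⊢
    constructor <;> linarith [h6.1, h6.2, h7.1, h7.2]

end IsCollisionEjection

-- Passing the primary on either side

namespace IsCollisionEjection

variable {i : Fin N} {t₀ δ : ℝ} {γ : ℝ → ℂ}

/-- A lowering deformation near the collision extends to one on the whole interval. -/
lemma extend_loweringDeformation (hγ : IsCollisionEjection m q i t₀ δ γ) (hm : ∀ i, 0 < m i)
    (hq : ∀ i, Continuous (q i)) {h s ε : ℝ} {η : ℝ → ℂ} (hs : 0 < s) (hsδ : s ≤ δ) (hε : 0 < ε)
    (hη : IsLoweringDeformation m q h (t₀ - s) (t₀ + s) ε γ η) :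
    IsLoweringDeformation m q h (t₀ - δ) (t₀ + δ) ε γ (splice γ η (t₀ - s) (t₀ + s)) :=
  hγ.isLoweringDeformation_splice hm hq hs hsδ hε hη.mem.1 hη.mem.2.1 hη.mem.2.2
    (fun t ht => ⟨hη.collisionFree t ht, hη.close t ht⟩)
    (not_le.1 fun hle => not_le.2 hη.action_lt (add_le_add_left
      (EReal.coe_ennreal_le_coe_ennreal_iff.2 hle) _))

/-- Lowering deformations which pass the primary on both sides. -/
lemma exists_two_loweringDeformations (hγ : IsCollisionEjection m q i t₀ δ γ) (hm : ∀ i, 0 < m i)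
    (hq : IsCollisionFreePeriodic m q) (hδ : 0 < δ) (h : ℝ) :
    ∃ σm σp : ℂ, Tendsto (direction γ (q i)) (𝓝[<] t₀) (𝓝 σm) ∧
      Tendsto (direction γ (q i)) (𝓝[>] t₀) (𝓝 σp) ∧ (σm ≠ σp →
        ∃ δ₀, 0 < δ₀ ∧ δ₀ ≤ δ ∧ ∀ δ', 0 < δ' → δ' ≤ δ₀ → ∀ ε, 0 < ε → ∃ ηp ηm : ℝ → ℂ,
          IsLoweringDeformation m q h (t₀ - δ') (t₀ + δ') ε γ ηp ∧
          IsLoweringDeformation m q h (t₀ - δ') (t₀ + δ') ε γ ηm ∧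
          ArgVariationIn ηp (q i) (t₀ - δ') (t₀ + δ') (Ioo 0 (2 * Real.pi)) ∧
          ArgVariationIn ηm (q i) (t₀ - δ') (t₀ + δ') (Ioo (-(2 * Real.pi)) 0)) := by
  obtain ⟨σp, hσp, hp', hp⟩ := hγ.exists_tendsto hm hq hδ (e := 1) (Or.inl rfl)
  obtain ⟨σm, hσm, hn', hn⟩ := hγ.exists_tendsto hm hq hδ (e := -1) (Or.inr rfl)
  refine ⟨σm, σp, direction_tendsto_left hn', direction_tendsto_right hp', fun hne => ?_⟩
  set c : ℝ := (9 * m i / 2) ^ (1 / 3 : ℝ) with hc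
  have hMi := hm i
  have hc0 : 0 < c := Real.rpow_pos_of_pos (by positivity) _
  have hc3 : m i = 2 * c ^ 3 / 9 := by
    have : c ^ 3 = 9 * m i / 2 := by
      rw [hc, ← Real.rpow_natCast, ← Real.rpow_mul (by positivity)]
      norm_num
    rw [this]; ring
  obtain ⟨ω, φ, hω, hφ0, hφπ, rfl, rfl⟩ := exists_bisector hσm hσp hne
  -- The same two directions are reached from the opposite bisector -ω by turning through ∓(φ - π).
  -- The arc for this choice turns by about 2(φ - π), which lies in (-2π, 0), and so passes on the
  -- other side.
  have hturn : ∀ x : ℂ, (-ω) * Complex.exp (x - Real.pi * Complex.I) = ω * Complex.exp x ∧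
      (-ω) * Complex.exp (x + Real.pi * Complex.I) = ω * Complex.exp x := fun x => by
    rw [Complex.exp_sub, Complex.exp_add, Complex.exp_pi_mul_I]
    constructor <;> ring
  have h1 : ω * Complex.exp (φ * Complex.I) =
      (-ω) * Complex.exp (((φ - Real.pi : ℝ) : ℂ) * Complex.I) := by
    rw [Complex.ofReal_sub, sub_mul, (hturn _).1]
  have h2 : ω * Complex.exp (-φ * Complex.I) =
      (-ω) * Complex.exp (-((φ - Real.pi : ℝ) : ℂ) * Complex.I) := by
    rw [Complex.ofReal_sub, neg_sub, sub_mul, sub_eq_neg_add, ← neg_mul, (hturn _).2]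
  obtain ⟨δ₁, hδ₁, hδ₁δ, H1⟩ := hγ.exists_loweringDeformation hm hq hδ hc0 hc3 hω hφ0.ne'
    (by rwa [abs_of_pos hφ0]) hp hn hp' hn' (S := Ioo 0 (2 * Real.pi)) (fun x hx => by
      rw [abs_of_pos hφ0, abs_lt] at hx
      constructor
      · linarith [hx.1, min_le_left φ (Real.pi - φ)]
      · linarith [hx.2, min_le_right φ (Real.pi - φ)]) h
  rw [h1] at hp hp'
  rw [h2] at hn hn'
  obtain ⟨δ₂, hδ₂, -, H2⟩ := hγ.exists_loweringDeformation hm hq hδ hc0 hc3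
    (by rwa [norm_neg]) (sub_neg.2 hφπ).ne (by rw [abs_of_neg (sub_neg.2 hφπ)]; linarith)
    hp hn hp' hn' (S := Ioo (-(2 * Real.pi)) 0) (fun x hx => by
      rw [abs_of_neg (sub_neg.2 hφπ), abs_lt] at hx
      constructor
      · linarith [hx.1, min_le_right (-(φ - Real.pi)) (Real.pi - -(φ - Real.pi))]
      · linarith [hx.2, min_le_left (-(φ - Real.pi)) (Real.pi - -(φ - Real.pi))]) h
  refine ⟨min δ₁ δ₂, lt_min hδ₁ hδ₂, (min_le_left _ _).trans hδ₁δ, fun δ' hδ' hle ε hε => ?_⟩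
  obtain ⟨ηp, hp1, hp2⟩ := H1 δ' hδ' (hle.trans (min_le_left _ _)) ε hε
  obtain ⟨ηm, hm1, hm2⟩ := H2 δ' hδ' (hle.trans (min_le_right _ _)) ε hε
  exact ⟨ηp, ηm, hp1, hm1, hp2, hm2⟩

end IsCollisionEjection

/-- Paths without zeros whose arguments vary in opposite directions are distinct. -/
lemma exists_ne_of_argVariationIn {η η' p : ℝ → ℂ} {a b : ℝ} (hab : a ≤ b)
    (h0 : ∀ t ∈ Icc a b, η t ≠ p t) {x y : ℝ} (h : ArgVariationIn η p a b (Ioo 0 x))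
    (h' : ArgVariationIn η' p a b (Ioo y 0)) : ∃ t ∈ Icc a b, η t ≠ η' t := by
  by_contra! heq
  obtain ⟨θ, h1, h2, h3⟩ := h
  obtain ⟨θ', h1', h2', h3'⟩ := h'
  linarith [argVariation_unique hab h0 heq h1 h1' h2 h2', h3.1, h3'.2]

end

end RestrictedNBody

-- The theorem

theorem proposition2p5 (N : ℕ) (m : Fin N → ℝ) (hm : ∀ i, 0 < m i) (q : Fin N → ℝ → ℂ)
    (hq : RestrictedNBody.IsCollisionFreePeriodic m q) (h : ℝ) :
    -- every fixed-end local minimizer is a collision-free solution on the open interval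
    (∀ (t₁ t₂ : ℝ) (x y : ℂ) (γ : ℝ → ℂ), t₁ < t₂ →
      RestrictedNBody.IsFixedEndLocalMinimizer m q h t₁ t₂ x y γ →
      ∀ t ∈ Ioo t₁ t₂, RestrictedNBody.CollisionFreeAt q γ t ∧
        RestrictedNBody.SolvesRestrictedAt m q γ t) ∧
    -- local deformation near an isolated collision
    (∀ (i₀ : Fin N) (t₀ δ : ℝ) (γ : ℝ → ℂ), 0 < δ →
      RestrictedNBody.IsCollisionEjection m q i₀ t₀ δ γ →
      ∃ σm σp : ℂ,
        Tendsto (RestrictedNBody.direction γ (q i₀)) (𝓝[<] t₀) (𝓝 σm) ∧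
        Tendsto (RestrictedNBody.direction γ (q i₀)) (𝓝[>] t₀) (𝓝 σp) ∧
        (σm ≠ σp →
          (∀ ε : ℝ, 0 < ε → ∃ ηp ηm : ℝ → ℂ,
            RestrictedNBody.IsLoweringDeformation m q h (t₀ - δ) (t₀ + δ) ε γ ηp ∧
            RestrictedNBody.IsLoweringDeformation m q h (t₀ - δ) (t₀ + δ) ε γ ηm ∧
            ∃ t ∈ Icc (t₀ - δ) (t₀ + δ), ηp t ≠ ηm t) ∧
          ∃ δ₀ : ℝ, 0 < δ₀ ∧ δ₀ ≤ δ ∧ ∀ δ' : ℝ, 0 < δ' → δ' ≤ δ₀ →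
            ∀ ε : ℝ, 0 < ε → ∃ ηp ηm : ℝ → ℂ,
              RestrictedNBody.IsLoweringDeformation m q h (t₀ - δ') (t₀ + δ') ε γ ηp ∧
              RestrictedNBody.IsLoweringDeformation m q h (t₀ - δ') (t₀ + δ') ε γ ηm ∧
              RestrictedNBody.ArgVariationIn ηp (q i₀) (t₀ - δ') (t₀ + δ')
                (Ioo 0 (2 * Real.pi)) ∧
              RestrictedNBody.ArgVariationIn ηm (q i₀) (t₀ - δ') (t₀ + δ')
                (Ioo (-(2 * Real.pi)) 0))) := by
  refine ⟨fun t₁ t₂ x y γ _ hγ t ht => hγ.collisionFree_and_solves hm hq ht,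
    fun i₀ t₀ δ γ hδ hγ => ?_⟩
  obtain ⟨σm, σp, h1, h2, h3⟩ := hγ.exists_two_loweringDeformations hm hq hδ h
  refine ⟨σm, σp, h1, h2, fun hne => ?_⟩
  obtain ⟨δ₀, hδ₀, hle, H⟩ := h3 hne
  refine ⟨fun ε hε => ?_, δ₀, hδ₀, hle, H⟩
  -- The argument is controlled only on the short interval. Distinctness is established there and
  -- survives the extension by the original path.
  obtain ⟨ηp, ηm, hp, hm', hpa, hma⟩ := H δ₀ hδ₀ le_rfl ε hε
  obtain ⟨t, ht, hne'⟩ := RestrictedNBody.exists_ne_of_argVariationIn (by linarith)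
    (fun t ht => hp.collisionFree t ht i₀) hpa hma
  refine ⟨_, _, hγ.extend_loweringDeformation hm hq.continuous hδ₀ hle hε hp,
    hγ.extend_loweringDeformation hm hq.continuous hδ₀ hle hε hm', t,
    ⟨by linarith [ht.1], by linarith [ht.2]⟩, ?_⟩
  rwa [RestrictedNBody.splice_of_mem ht, RestrictedNBody.splice_of_mem ht]
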